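/- Let $k\ge 3$ be an integer and let $0<d'<2(k-1)\ln(k-1)$ be fixed. For $n\ge1$ put $m=\lceil d'n/2\rceil$ and $d=d(n)=2m/n$, and let $\mathcal G(n,m)$ be the random multigraph on $[n]=\{1,\dots,n\}$ obtained by choosing $m$ edges of the complete graph on $[n]$ independently and uniformly at random (with replacement). For $l\ge2$ let $$\lambda_l=\frac{d^l}{2l},\qquad \delta_l=\frac{(-1)^l}{(k-1)^{l-1}}.$$ Let $\omega,\nu$ be fixed odd natural numbers, and let $s\in S_{k,\omega,\nu}$ be fixed, where $$S_{k,\omega,\nu}=\Big\{s\in\mathbb Z^k:\ \|s\|_1=2i\ \text{ for some integer } 0\le i\le \tfrac{\omega\nu-1}{2}\Big\}.$$ For $\sigma:[n]\to[k]$ let $\rho(\sigma)=(|\sigma^{-1}(i)|/n)_{i\in[k]}$ be its colour density. For a multigraph $G$ on $[n]$ let $Z^s_{k,\omega,\nu}(G)$ be the number of maps $\sigma:[n]\to[k]$ with $\sigma(u)\neq\sigma(v)$ for every edge $\{u,v\}$ of $G$ such that, for all $i\in[k]$, $$\rho_i(\sigma)\in\Big[\tfrac1k-\tfrac{\omega}{\sqrt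 n},\ \tfrac1k+\tfrac{\omega}{\sqrt n}\Big)\quad\text{and}\quad \rho_i(\sigma)\in\Big[\tfrac1k+\tfrac{s_i-1}{\nu\sqrt n},\ \tfrac1k+\tfrac{s_i+1}{\nu\sqrt n}\Big).$$ Then the series $\sum_{l\ge2}\lambda_l\delta_l^2$ converges for all sufficiently large $n$, and $$\frac{\mathbb E\big[Z^s_{k,\omega,\nu}(\mathcal G(n,m))^2\big]}{\mathbb E\big[Z^s_{k,\omega,\nu}(\mathcal G(n,m))\big]^2}\ \sim\ \exp\Big(\sum_{l\ge2}\lambda_l\delta_l^2\Big)$$ as $n\to\infty$ through those $n$ for which the left-hand side is defined, that is, for which $\mathbb E[Z^s_{k,\omega,\nu}(\mathcal G(n,m))]\neq0$. If $|s_1+\dots+s_k|<k$ (in particular if $s_1+\dots+s_k=0$), this is the case for all sufficiently large $n$. -/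

import Mathlib

open Filter Asymptotics
open scoped Topology

/-- An outcome of the random multigraph on the vertex set `Fin n` with `m` edges: a sequence of
`m` edges of the complete graph on `n` vertices, where repetitions are allowed. -/
abbrev EdgeSeq (n m : ℕ) : Type := Fin m → {e : Sym2 (Fin n) // ¬ e.IsDiag}

/-- Expectation over the random multigraph: the `m` edges are chosen independently and uniformly
at random, with replacement, i.e. every sequence in `EdgeSeq n m` is equally likely. -/
noncomputable def expectation (n m : ℕ) (X : EdgeSeq n m → ℝ) : ℝ :=
  Finset.expect Finset.univ X

/-- `σ` is a `k`-colouring of `G`: the ends of every edge get different colours. -/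
def IsColouring {n m k : ℕ} (G : EdgeSeq n m) (σ : Fin n → Fin k) : Prop :=
  ∀ u v : Fin n, (∃ j : Fin m, (G j : Sym2 (Fin n)) = s(u, v)) → σ u ≠ σ v

/-- The colour density `ρ(σ)`, with entries `|σ⁻¹(i)| / n`. -/
noncomputable def colourDensity {n k : ℕ} (σ : Fin n → Fin k) (i : Fin k) : ℝ :=
  ((Finset.univ.filter fun v => σ v = i).card : ℝ) / n

/-- The set of all colour densities of maps `[n] → [k]`. -/
def densities (k n : ℕ) : Set (Fin k → ℝ) :=
  Set.range fun σ : Fin n → Fin k => colourDensity σ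

/-- The set of all `(ω, n)`-balanced colour densities. -/
def balancedDensities (k ω n : ℕ) : Set (Fin k → ℝ) :=
  {ρ | ρ ∈ densities k n ∧
    ∀ i, ρ i ∈ Set.Ico (1 / (k : ℝ) - ω / √(n : ℝ)) (1 / (k : ℝ) + ω / √(n : ℝ))}

/-- The index set of the cells: the integer vectors whose 1-norm is an even number `2 i` with
`i ≤ (ω ν - 1) / 2`. -/
def cellIndices (k ω ν : ℕ) : Set (Fin k → ℤ) :=
  {s | ∃ i : ℕ, ∑ j, |s j| = 2 * (i : ℤ) ∧ (i : ℝ) ≤ ((ω : ℝ) * ν - 1) / 2}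

/-- The centre of the cell indexed by `s`. -/
noncomputable def cellCentre (k ν n : ℕ) (s : Fin k → ℤ) (i : Fin k) : ℝ :=
  1 / (k : ℝ) + (s i : ℝ) / (ν * √(n : ℝ))

/-- The cell indexed by `s`. -/
def cell (k ω ν n : ℕ) (s : Fin k → ℤ) : Set (Fin k → ℝ) :=
  {ρ | ρ ∈ balancedDensities k ω n ∧
    ∀ i, ρ i ∈ Set.Ico (cellCentre k ν n s i - 1 / (ν * √(n : ℝ)))
      (cellCentre k ν n s i + 1 / (ν * √(n : ℝ)))}

open Classical in
/-- The number of `k`-colourings of `G` whose colour density lies in the cell indexed by `s`. -/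
noncomputable def cellColourings (k ω ν : ℕ) (s : Fin k → ℤ) {n m : ℕ} (G : EdgeSeq n m) : ℕ :=
  (Finset.univ.filter fun σ : Fin n → Fin k =>
    IsColouring G σ ∧ colourDensity σ ∈ cell k ω ν n s).card

/-- The number of edges `m = ⌈d' n / 2⌉`. -/
noncomputable def numEdges (d' : ℝ) (n : ℕ) : ℕ := ⌈d' * n / 2⌉₊

/-- The first moment of the number of colourings in the cell indexed by `s`. -/
noncomputable def firstMoment (k ω ν : ℕ) (s : Fin k → ℤ) (d' : ℝ) (n : ℕ) : ℝ :=
  expectation n (numEdges d' n) fun G => (cellColourings k ω ν s G : ℝ)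

/-- The second moment of the number of colourings in the cell indexed by `s`. -/
noncomputable def secondMoment (k ω ν : ℕ) (s : Fin k → ℤ) (d' : ℝ) (n : ℕ) : ℝ :=
  expectation n (numEdges d' n) fun G => (cellColourings k ω ν s G : ℝ) ^ 2

/-- The actual average degree `d = 2 m / n`, which depends on `n`. -/
noncomputable def avgDegree (d' : ℝ) (n : ℕ) : ℝ := 2 * (numEdges d' n : ℝ) / n

/-- `λ_l = d ^ l / (2 l)`. -/
noncomputable def cycleLambda (d : ℝ) (l : ℕ) : ℝ := d ^ l / (2 * (l : ℝ))

/-- `δ_l = (-1) ^ l / (k - 1) ^ (l - 1)`, used for `l ≥ 2` only. -/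
noncomputable def cycleDelta (k l : ℕ) : ℝ := (-1) ^ l / ((k : ℝ) - 1) ^ (l - 1)

/-! Fix two vectors `a`, `b` of colour class sizes, each within `O(√n)` of the uniform one, and sort
pairs of maps with these class sizes by their overlap table `T`. The number of pairs with overlap
`T` is the number of all such pairs times `tableWeight T`, the probability of `T` given its margins.
The probability that both maps are colourings is the product of the two individual probabilities
times `pairRatio`. Both the second moment and the square of the first moment are therefore sums over
`(a, b)` with the same positive coefficients, of `∑ tableWeight T * pairRatio T` and `∑ tableWeight
T` respectively. It suffices that the quotient of these inner sums tends to one constant, uniformly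
in `a` and `b`.

Write `D` for `n` times the squared distance of `T / n` from the product of its margins. Stirling's
formula gives `tableWeight T ≈ const * n ^ (-(k - 1) ^ 2 / 2) * exp (-(k ^ 2 / 2) * D)` in the
central range. Since the margins are uniform up to `O(1 / √n)`, also `pairRatio T ≈ exp (-d / 2) *
exp (β * D)` with `β = d * k ^ 2 / (2 * (k - 1) ^ 2)`. The sums become Gaussian integrals in
dimension `(k - 1) ^ 2`. Their quotient is `exp (-d / 2) * (1 - d / (k - 1) ^ 2) ^ (-(k - 1) ^ 2 /
2)`, which is the exponential of the cycle series, because that series is a logarithm series without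
its first term.

The difficulty is domination: tables far from independence must not contribute. This needs the
mutual information to be at least `K` times the squared distance for some `K > β` (`tableKL_ge`),
and the hypothesis on `d'` says exactly that `β < k ^ 2 * log (k - 1) / (k - 1)`. For uniform
margins the bound follows from the sharp inequality between entropy and Euclidean norm on `k` points
(`entropy_ineq`), which reduces to the two-point inequality of Kearns and Saul. Compactness,
together with a local estimate near the uniform table, extends it to nearly uniform margins.
`tableWeight_le` then supplies the Gaussian bound for dominated convergence in
`tendsto_sum_tableWeight_mul`. -/

/-! ### The two-point inequality of Kearns and Saul -/

/-- The gap in the binary Kullback-Leibler inequality of Kearns and Saul. -/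
noncomputable def binaryGap (p K x : ℝ) : ℝ :=
  x * Real.log x + (1 - x) * Real.log (1 - x) - x * Real.log p - (1 - x) * Real.log (1 - p)
    - K * (x - p) ^ 2

/-- The derivative of `binaryGap`. -/
noncomputable def binaryGapDeriv (p K x : ℝ) : ℝ :=
  Real.log x - Real.log (1 - x) - Real.log p + Real.log (1 - p) - 2 * K * (x - p)

lemma hasDerivAt_binaryGap (p K : ℝ) {x : ℝ} (h0 : 0 < x) (h1 : x < 1) :
    HasDerivAt (binaryGap p K) (binaryGapDeriv p K x) x := by
  have hx := Real.hasDerivAt_mul_log h0.ne'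
  have h1x : HasDerivAt (fun y : ℝ => 1 - y) (-1) x := by
    simpa using (hasDerivAt_id x).const_sub 1
  have hy := (Real.hasDerivAt_mul_log (x := 1 - x) (by linarith)).comp x h1x
  have hz := ((((hx.add hy).sub ((hasDerivAt_id x).mul_const (Real.log p))).sub
    (h1x.mul_const (Real.log (1 - p)))).sub
    ((((hasDerivAt_id x).sub_const p).pow 2).const_mul K))
  refine (hz.congr_deriv ?_)
  simp [binaryGapDeriv]
  ring

lemma continuous_binaryGap (p K : ℝ) : Continuous (binaryGap p K) := by
  unfold binaryGap
  have h := Real.continuous_mul_log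
  have h' : Continuous fun x : ℝ => (1 - x) * Real.log (1 - x) :=
    h.comp (continuous_const.sub continuous_id)
  fun_prop

/-- The slope is `1 / (x * (1 - x)) - 2 * K`, which decreases up to `1 / 2`. Concavity settles the
sign of the derivative of the gap from two of its zeros. -/
lemma concaveOn_binaryGapDeriv (p K : ℝ) :
    ConcaveOn ℝ (Set.Ioc 0 (1 / 2)) (binaryGapDeriv p K) := by
  have hd : ∀ x ∈ Set.Ioo (0 : ℝ) 1, HasDerivAt (binaryGapDeriv p K)
      (x⁻¹ + (1 - x)⁻¹ - 2 * K) x := by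
    intro x hx
    have h1x : HasDerivAt (fun y : ℝ => 1 - y) (-1) x := by
      simpa using (hasDerivAt_id x).const_sub 1
    have hx1 := Real.hasDerivAt_log hx.1.ne'
    have hx2 := (Real.hasDerivAt_log (x := 1 - x) (by linarith [hx.2])).comp x h1x
    have := (((hx1.sub hx2).sub_const (Real.log p)).add_const (Real.log (1 - p))).sub
      (((hasDerivAt_id x).sub_const p).const_mul (2 * K))
    refine this.congr_deriv ?_
    ring
  apply AntitoneOn.concaveOn_of_deriv (convex_Ioc _ _)
  · intro x hx
    exact (hd x ⟨hx.1, by linarith [hx.2]⟩).continuousAt.continuousWithinAt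
  · rw [interior_Ioc]
    intro x hx
    exact (hd x ⟨hx.1, by linarith [hx.2]⟩).differentiableAt.differentiableWithinAt
  · rw [interior_Ioc]
    intro x hx y hy hxy
    rw [(hd x ⟨hx.1, by linarith [hx.2]⟩).deriv, (hd y ⟨hy.1, by linarith [hy.2]⟩).deriv]
    have hx0 := hx.1
    have hy0 := hy.1
    have hx2 := hx.2
    have hy2 := hy.2
    have e : ∀ t : ℝ, 0 < t → t < 1 / 2 → t⁻¹ + (1 - t)⁻¹ = (t * (1 - t))⁻¹ := by
      intro t ht ht2
      have : 1 - t ≠ 0 := by linarith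
      field_simp
      ring
    rw [e x hx0 hx2, e y hy0 hy2]
    have : x * (1 - x) ≤ y * (1 - y) := by nlinarith
    have h0 : 0 < x * (1 - x) := by apply mul_pos <;> linarith
    have := inv_anti₀ h0 this
    linarith

/-- The **Kearns-Saul inequality**, on the left half of the unit interval. -/
lemma binaryGap_nonneg_of_le_half {p x : ℝ} (hp0 : 0 < p) (hp : p < 1 / 2) (hx0 : 0 ≤ x)
    (hx : x ≤ 1 / 2) : 0 ≤ binaryGap p (Real.log ((1 - p) / p) / (1 - 2 * p)) x := by
  set K := Real.log ((1 - p) / p) / (1 - 2 * p) with hK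
  -- This `K` makes the derivative of the gap vanish at `1 / 2` as well as at `p`. By concavity it
  -- is nonnegative between the two zeros and nonpositive to the left of `p`, so the gap is smallest
  -- at `p`, where it is `0`.
  have hKm : K * (1 - 2 * p) = Real.log (1 - p) - Real.log p := by
    rw [hK, Real.log_div (by linarith) hp0.ne', div_mul_cancel₀]
    linarith
  have hcon := concaveOn_binaryGapDeriv p K
  have hp_mem : p ∈ Set.Ioc (0 : ℝ) (1 / 2) := ⟨hp0, hp.le⟩
  have hh_mem : (1 / 2 : ℝ) ∈ Set.Ioc (0 : ℝ) (1 / 2) := ⟨by norm_num, le_rfl⟩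
  have hzp : binaryGapDeriv p K p = 0 := by simp [binaryGapDeriv]
  have hzh : binaryGapDeriv p K (1 / 2) = 0 := by
    have : (1 - 1 / 2 : ℝ) = 1 / 2 := by norm_num
    rw [binaryGapDeriv, this]
    linarith
  have hgp : binaryGap p K p = 0 := by simp [binaryGap]
  have hpos : ∀ t, p ≤ t → t ≤ 1 / 2 → 0 ≤ binaryGapDeriv p K t := by
    intro t h1 h2
    have := hcon.min_le_of_mem_Icc hp_mem hh_mem ⟨h1, h2⟩
    rwa [hzp, hzh, min_self] at this
  have hneg : ∀ t, 0 < t → t < p → binaryGapDeriv p K t ≤ 0 := by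
    intro t h1 h2
    have := hcon.slope_anti_adjacent (x := t) (y := p) (z := 1 / 2)
      ⟨h1, by linarith⟩ hh_mem h2 hp
    rw [hzp, hzh] at this
    simp only [sub_zero, zero_div, zero_sub] at this
    rw [le_div_iff₀ (by linarith)] at this
    linarith
  rcases le_total x p with hxp | hxp
  · have han : AntitoneOn (binaryGap p K) (Set.Icc 0 p) := by
      apply antitoneOn_of_deriv_nonpos (convex_Icc _ _) (continuous_binaryGap p K).continuousOn
      · rw [interior_Icc]
        intro t ht
        exact (hasDerivAt_binaryGap p K ht.1
          (by linarith [ht.2])).differentiableAt.differentiableWithinAt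
      · rw [interior_Icc]
        intro t ht
        rw [(hasDerivAt_binaryGap p K ht.1 (by linarith [ht.2])).deriv]
        exact hneg t ht.1 ht.2
    have := han ⟨hx0, hxp⟩ ⟨hp0.le, le_rfl⟩ hxp
    linarith
  · have hmo : MonotoneOn (binaryGap p K) (Set.Icc p (1 / 2)) := by
      apply monotoneOn_of_deriv_nonneg (convex_Icc _ _) (continuous_binaryGap p K).continuousOn
      · rw [interior_Icc]
        intro t ht
        exact (hasDerivAt_binaryGap p K (by linarith [ht.1])
          (by linarith [ht.2])).differentiableAt.differentiableWithinAt
      · rw [interior_Icc]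
        intro t ht
        rw [(hasDerivAt_binaryGap p K (by linarith [ht.1]) (by linarith [ht.2])).deriv]
        exact hpos t ht.1.le ht.2.le
    have := hmo ⟨le_rfl, hp.le⟩ ⟨hxp, hx⟩ hxp
    linarith

/-- The **Kearns-Saul inequality**. -/
lemma binaryGap_nonneg {p x : ℝ} (hp0 : 0 < p) (hp : p < 1 / 2) (hx0 : 0 ≤ x)
    (hx : x ≤ 1) : 0 ≤ binaryGap p (Real.log ((1 - p) / p) / (1 - 2 * p)) x := by
  rcases le_total x (1 / 2) with h | h
  · exact binaryGap_nonneg_of_le_half hp0 hp hx0 h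
  -- For this `K` the gap is symmetric under `x ↦ 1 - x`: the change of the linear terms cancels
  -- that of the quadratic term.
  · have := binaryGap_nonneg_of_le_half hp0 hp (x := 1 - x) (by linarith) (by linarith)
    convert this using 1
    set K := Real.log ((1 - p) / p) / (1 - 2 * p) with hK
    have hKm : K * (1 - 2 * p) = Real.log (1 - p) - Real.log p := by
      rw [hK, Real.log_div (by linarith) hp0.ne', div_mul_cancel₀]
      linarith
    have e : (1 : ℝ) - (1 - x) = x := by ring
    simp only [binaryGap, e]
    linear_combination (1 - 2 * x) * hKm

/-! ### The sharp entropy inequality on `k` points -/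

/-- The constant in the entropy inequality on `k` points. -/
noncomputable def entropyConst (k : ℕ) : ℝ :=
  ((k : ℝ) - 1) * Real.log ((k : ℝ) - 1) / ((k : ℝ) - 2)

lemma entropyConst_pos {k : ℕ} (hk : 3 ≤ k) : 0 < entropyConst k := by
  have : (3 : ℝ) ≤ k := by exact_mod_cast hk
  have := Real.log_pos (x := (k : ℝ) - 1) (by linarith)
  unfold entropyConst
  apply div_pos (mul_pos _ this) <;> linarith

/-- The entropy inequality for a distribution with masses `x, y, …, y`. -/
lemma two_valued_entropy_ineq {k : ℕ} (hk : 3 ≤ k) {x : ℝ} (hx0 : 0 ≤ x) (hx1 : x ≤ 1) :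
    -Real.log k - entropyConst k / k ≤
      (x * Real.log x - entropyConst k * x ^ 2) +
      ((k : ℝ) - 1) * ((1 - x) / (k - 1) * Real.log ((1 - x) / (k - 1))
        - entropyConst k * ((1 - x) / (k - 1)) ^ 2) := by
  have hk3 : (3 : ℝ) ≤ k := by exact_mod_cast hk
  have hk0 : (0 : ℝ) < k := by linarith
  have hk1 : (0 : ℝ) < (k : ℝ) - 1 := by linarith
  have hk2 : (0 : ℝ) < (k : ℝ) - 2 := by linarith
  have hp : 1 / (k : ℝ) < 1 / 2 := by
    rw [div_lt_div_iff₀ hk0 (by norm_num)]; linarith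
  -- Merging the `k - 1` equal masses into one atom turns the uniform distribution into a Bernoulli
  -- law with `p = 1 / k`, for which `(1 - p) / p = k - 1`.
  have h := binaryGap_nonneg (p := 1 / (k : ℝ)) (by positivity) hp hx0 hx1
  have e1 : (1 - 1 / (k : ℝ)) / (1 / k) = k - 1 := by field_simp
  have e2 : (1 - 1 / (k : ℝ)) = (k - 1) / k := by field_simp
  have e3 : (1 - x) * Real.log ((1 - x) / (k - 1)) =
      (1 - x) * (Real.log (1 - x) - Real.log (k - 1)) := by
    rcases eq_or_ne (1 - x) 0 with h0 | h0
    · rw [h0]; ring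
    · rw [Real.log_div h0 hk1.ne']
  have e4 : ((k : ℝ) - 1) * ((1 - x) / (k - 1) * Real.log ((1 - x) / (k - 1))
      - entropyConst k * ((1 - x) / (k - 1)) ^ 2) =
      (1 - x) * Real.log ((1 - x) / (k - 1)) - entropyConst k * (1 - x) ^ 2 / (k - 1) := by
    field_simp
  rw [binaryGap, e1, e2, Real.log_div hk1.ne' hk0.ne', Real.log_div one_ne_zero hk0.ne',
    Real.log_one] at h
  rw [e4, e3]
  have e5 : Real.log (k - 1) / (1 - 2 * (1 / (k : ℝ))) * (x - 1 / k) ^ 2 =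
      entropyConst k * (x ^ 2 + (1 - x) ^ 2 / (k - 1) - 1 / k) := by
    unfold entropyConst
    have : (1 - 2 * (1 / (k : ℝ))) = (k - 2) / k := by field_simp
    rw [this]
    field_simp
    ring
  rw [e5] at h
  have e6 : entropyConst k * (x ^ 2 + (1 - x) ^ 2 / (k - 1) - 1 / k) =
    entropyConst k * x ^ 2 + entropyConst k * (1 - x) ^ 2 / (k - 1) - entropyConst k / k := by
    ring
  rw [e6] at h
  linarith

/-- The summand of the entropy functional. -/
noncomputable def entropySummand (C x : ℝ) : ℝ := x * Real.log x - C * x ^ 2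

lemma continuous_entropySummand (C : ℝ) : Continuous (entropySummand C) := by
  unfold entropySummand
  have h := Real.continuous_mul_log
  fun_prop

lemma hasDerivAt_entropySummand (C : ℝ) {x : ℝ} (hx : 0 < x) :
    HasDerivAt (entropySummand C) (Real.log x + 1 - 2 * C * x) x := by
  have := (Real.hasDerivAt_mul_log hx.ne').sub ((hasDerivAt_pow 2 x).const_mul C)
  refine this.congr_deriv ?_
  norm_num
  ring

lemma deriv2_entropySummand (C : ℝ) {x : ℝ} (hx : 0 < x) :
    deriv^[2] (entropySummand C) x = x⁻¹ - 2 * C := by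
  simp only [Function.iterate_succ, Function.iterate_zero, Function.comp, id]
  have : deriv (entropySummand C) =ᶠ[𝓝 x] fun x => Real.log x + 1 - 2 * C * x := by
    filter_upwards [lt_mem_nhds hx] with y hy
    exact (hasDerivAt_entropySummand C hy).deriv
  rw [this.deriv_eq]
  have := (((Real.hasDerivAt_log hx.ne').add_const 1).sub ((hasDerivAt_id x).const_mul (2 * C)))
  have h2 := this.deriv
  simp only [mul_one] at h2
  exact h2

/-- The second derivative `1 / x - 2 * C` changes sign only at `1 / (2 * C)`: convexity on the left
allows averaging of small masses, concavity on the right allows spreading of large ones. -/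
lemma convexOn_entropySummand {C : ℝ} (hC : 0 < C) :
    ConvexOn ℝ (Set.Icc 0 (1 / (2 * C))) (entropySummand C) := by
  apply convexOn_of_deriv2_nonneg (convex_Icc _ _) (continuous_entropySummand C).continuousOn
  · rw [interior_Icc]
    intro x hx
    exact (hasDerivAt_entropySummand C hx.1).differentiableAt.differentiableWithinAt
  · rw [interior_Icc]
    intro x hx
    have hev : deriv (entropySummand C) =ᶠ[𝓝 x] fun x => Real.log x + 1 - 2 * C * x := by
      filter_upwards [lt_mem_nhds hx.1] with y hy
      exact (hasDerivAt_entropySummand C hy).deriv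
    have h0 := hx.1.ne'
    refine (hev.differentiableAt_iff.2 ?_).differentiableWithinAt
    fun_prop (disch := assumption)
  · rw [interior_Icc]
    intro x hx
    rw [deriv2_entropySummand C hx.1]
    have := (lt_inv_comm₀ (a := 2 * C) (by positivity) hx.1).2 (by simpa using hx.2)
    linarith

lemma concaveOn_entropySummand {C : ℝ} (hC : 0 < C) :
    ConcaveOn ℝ (Set.Ici (1 / (2 * C))) (entropySummand C) := by
  have hC' : 0 < 1 / (2 * C) := by positivity
  apply concaveOn_of_deriv2_nonpos (convex_Ici _) (continuous_entropySummand C).continuousOn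
  · rw [interior_Ici]
    intro x hx
    exact (hasDerivAt_entropySummand C (hC'.trans hx)).differentiableAt.differentiableWithinAt
  · rw [interior_Ici]
    intro x hx
    have hx0 : 0 < x := hC'.trans hx
    have hev : deriv (entropySummand C) =ᶠ[𝓝 x] fun x => Real.log x + 1 - 2 * C * x := by
      filter_upwards [lt_mem_nhds hx0] with y hy
      exact (hasDerivAt_entropySummand C hy).deriv
    have h0 := hx0.ne'
    refine (hev.differentiableAt_iff.2 ?_).differentiableWithinAt
    fun_prop (disch := assumption)
  · rw [interior_Ici]
    intro x hx
    have hx0 : 0 < x := hC'.trans hx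
    rw [deriv2_entropySummand C hx0]
    have := (inv_lt_comm₀ (a := x) (b := 2 * C) hx0 (by positivity)).2 (by simpa using hx)
    linarith

/-- Spreading two points apart decreases the sum of the values of a concave function. -/
lemma ConcaveOn.spread_le {f : ℝ → ℝ} {t x y : ℝ} (hf : ConcaveOn ℝ (Set.Ici t) f)
    (hx : t ≤ x) (hy : t ≤ y) : f t + f (x + y - t) ≤ f x + f y := by
  rcases eq_or_lt_of_le (show 0 ≤ x + y - 2 * t by linarith) with h | h
  · have h1 : x = t := by linarith
    have h2 : y = t := by linarith
    subst h1; subst h2; simp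
  · have hm : x + y - t ∈ Set.Ici t := by simp; linarith
    have hne : x + y - 2 * t ≠ 0 := h.ne'
    have h0x : 0 ≤ (x - t) / (x + y - 2 * t) := div_nonneg (by linarith) h.le
    have h0y : 0 ≤ (y - t) / (x + y - 2 * t) := div_nonneg (by linarith) h.le
    -- Both `x` and `y` are convex combinations of `t` and `x + y - t`, with the two weights
    -- interchanged, so adding the two concavity inequalities removes the weights.
    have h1 := hf.2 (Set.self_mem_Ici : t ∈ Set.Ici t) hm h0y h0x (by rw [← add_div, div_eq_one_iff_eq hne]; ring)
    have h2 := hf.2 (Set.self_mem_Ici : t ∈ Set.Ici t) hm h0x h0y (by rw [← add_div, div_eq_one_iff_eq hne]; ring)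
    have ex : ((y - t) / (x + y - 2 * t)) • t + ((x - t) / (x + y - 2 * t)) • (x + y - t) = x := by
      rw [smul_eq_mul, smul_eq_mul, div_mul_eq_mul_div, div_mul_eq_mul_div, ← add_div, div_eq_iff hne]; ring
    have ey : ((x - t) / (x + y - 2 * t)) • t + ((y - t) / (x + y - 2 * t)) • (x + y - t) = y := by
      rw [smul_eq_mul, smul_eq_mul, div_mul_eq_mul_div, div_mul_eq_mul_div, ← add_div, div_eq_iff hne]; ring
    rw [ex] at h1
    rw [ey] at h2
    simp only [smul_eq_mul] at h1 h2
    have e : (y - t) / (x + y - 2 * t) + (x - t) / (x + y - 2 * t) = 1 := by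
      rw [← add_div, div_eq_one_iff_eq hne]; ring
    have : (y - t) / (x + y - 2 * t) = 1 - (x - t) / (x + y - 2 * t) := by linarith
    rw [this] at h1 h2
    linarith

/-- The entropy inequality when all masses but one lie in the convex region. -/
lemma entropy_ineq_of_one_large {k : ℕ} (hk : 3 ≤ k) (a : Fin k → ℝ) (ha0 : ∀ i, 0 ≤ a i)
    (ha1 : ∑ i, a i = 1) (i₀ : Fin k)
    (h : ∀ i ≠ i₀, a i ≤ 1 / (2 * entropyConst k)) :
    -Real.log k - entropyConst k / k ≤ ∑ i, entropySummand (entropyConst k) (a i) := by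
  classical
  have hk3 : (3 : ℝ) ≤ k := by exact_mod_cast hk
  have hk1 : (0 : ℝ) < (k : ℝ) - 1 := by linarith
  have hC := entropyConst_pos hk
  have hsum := Finset.add_sum_erase Finset.univ a (Finset.mem_univ i₀)
  have hsumf := Finset.add_sum_erase Finset.univ
    (fun i => entropySummand (entropyConst k) (a i)) (Finset.mem_univ i₀)
  have hrest0 : 0 ≤ ∑ i ∈ Finset.univ.erase i₀, a i := Finset.sum_nonneg fun i _ => ha0 i
  have hcard : ((Finset.univ.erase i₀).card : ℝ) = k - 1 := by
    rw [Finset.card_erase_of_mem (Finset.mem_univ _), Finset.card_univ, Fintype.card_fin,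
      Nat.cast_sub (by omega)]
    simp
  -- Jensen replaces the masses other than `a i₀` by their mean, which leaves the two-valued case.
  have hj := (convexOn_entropySummand hC).map_sum_le (t := Finset.univ.erase i₀)
    (w := fun _ => 1 / ((k : ℝ) - 1)) (p := a) (fun _ _ => by positivity)
    (by rw [Finset.sum_const, nsmul_eq_mul, hcard]; field_simp)
    (fun i hi => ⟨ha0 i, h i (Finset.ne_of_mem_erase hi)⟩)
  simp only [smul_eq_mul, ← Finset.mul_sum] at hj
  have hs : ∑ i ∈ Finset.univ.erase i₀, a i = 1 - a i₀ := by linarith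
  rw [hs, one_div_mul_eq_div, one_div_mul_eq_div, le_div_iff₀ hk1] at hj
  have hx1 : a i₀ ≤ 1 := by linarith
  have h2 := two_valued_entropy_ineq hk (ha0 i₀) hx1
  rw [← hsumf]
  simp only [entropySummand] at hj ⊢
  linarith

/-- The sharp entropy versus Euclidean norm inequality on `k` points (the logarithmic Sobolev
inequality of the complete graph). -/
theorem entropy_ineq {k : ℕ} (hk : 3 ≤ k) (a : Fin k → ℝ) (ha0 : ∀ i, 0 ≤ a i)
    (ha1 : ∑ i, a i = 1) :
    -Real.log k - entropyConst k / k ≤ ∑ i, entropySummand (entropyConst k) (a i) := by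
  classical
  have hC := entropyConst_pos hk
  set t := 1 / (2 * entropyConst k) with ht
  have ht0 : 0 < t := by positivity
  -- Induction on the number of masses beyond the inflection point `t`. Two such masses are replaced
  -- by `t` and `a i + a j - t`: the total is kept, the functional does not increase, and one mass
  -- leaves the concave region.
  induction hN : (Finset.univ.filter fun i => t < a i).card using Nat.strong_induction_on
    generalizing a with
  | _ N ih =>
  by_cases hcase : ∃ i₀, ∀ i ≠ i₀, a i ≤ t
  · obtain ⟨i₀, h⟩ := hcase
    exact entropy_ineq_of_one_large hk a ha0 ha1 i₀ h
  · push Not at hcase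
    obtain ⟨i, -, hi⟩ := hcase ⟨0, by omega⟩
    obtain ⟨j, hji, hj⟩ := hcase i
    set b : Fin k → ℝ := Function.update (Function.update a i (a i + a j - t)) j t with hb
    have hbi : b i = a i + a j - t := by simp [hb, hji.symm]
    have hbj : b j = t := by simp [hb]
    have hbo : ∀ l, l ≠ i → l ≠ j → b l = a l := by
      intro l h1 h2; simp [hb, h1, h2]
    have key : ∀ f : ℝ → ℝ, ∑ l, f (b l) = ∑ l, f (a l) - f (a i) - f (a j)
        + f (a i + a j - t) + f t := by
      intro f
      have e1 := Finset.add_sum_erase Finset.univ (fun l => f (b l)) (Finset.mem_univ i)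
      have e2 := Finset.add_sum_erase (Finset.univ.erase i) (fun l => f (b l))
        (Finset.mem_erase.2 ⟨hji, Finset.mem_univ j⟩)
      have e3 := Finset.add_sum_erase Finset.univ (fun l => f (a l)) (Finset.mem_univ i)
      have e4 := Finset.add_sum_erase (Finset.univ.erase i) (fun l => f (a l))
        (Finset.mem_erase.2 ⟨hji, Finset.mem_univ j⟩)
      have e5 : ∑ l ∈ (Finset.univ.erase i).erase j, f (b l) =
          ∑ l ∈ (Finset.univ.erase i).erase j, f (a l) := by
        apply Finset.sum_congr rfl
        intro l hl
        rw [hbo l]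
        · exact Finset.ne_of_mem_erase (Finset.mem_of_mem_erase hl)
        · exact Finset.ne_of_mem_erase hl
      simp only [hbi, hbj] at e1 e2
      linarith
    have hlt : (Finset.univ.filter fun l => t < b l).card < N := by
      rw [← hN]
      apply Finset.card_lt_card
      rw [Finset.ssubset_iff_of_subset]
      · exact ⟨j, by simp [hj], by simp [hbj]⟩
      · intro l hl
        simp only [Finset.mem_filter, Finset.mem_univ, true_and] at hl ⊢
        by_cases h1 : l = i
        · rw [h1]; exact hi
        · by_cases h2 : l = j
          · rw [h2]; exact hj
          · rwa [hbo l h1 h2] at hl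
    have hb0 : ∀ l, 0 ≤ b l := by
      intro l
      by_cases h2 : l = j
      · rw [h2, hbj]; exact ht0.le
      · by_cases h1 : l = i
        · rw [h1, hbi]; linarith
        · rw [hbo l h1 h2]; exact ha0 l
    have hb1 : ∑ l, b l = 1 := by
      have := key id
      simp only [id] at this
      rw [this]; linarith
    have h1 := ih _ hlt b hb0 hb1 rfl
    rw [key] at h1
    have h2 := (concaveOn_entropySummand hC).spread_le hi.le hj.le
    linarith

/-- The quadratic lower bound for the Kullback-Leibler divergence of a `k × k` table with uniform
margins from the uniform table. -/
lemma uniform_table_entropy_ineq {k : ℕ} (hk : 3 ≤ k) (r : Fin k → Fin k → ℝ)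
    (hr0 : ∀ i j, 0 ≤ r i j) (hr1 : ∀ i, ∑ j, r i j = 1 / k) :
    k * entropyConst k * (∑ i, ∑ j, r i j ^ 2 - 1 / (k : ℝ) ^ 2) ≤
      ∑ i, ∑ j, r i j * Real.log (r i j) + 2 * Real.log k := by
  have hk0 : (0 : ℝ) < k := by positivity
  have hrow : ∀ i, -Real.log k / k - entropyConst k / (k : ℝ) ^ 2 ≤
      ∑ j, r i j * Real.log (r i j) + Real.log k / k - k * entropyConst k * ∑ j, r i j ^ 2 := by
    intro i
    -- Each row times `k` is a probability vector, so the inequality can be summed row by row.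
    have h := entropy_ineq hk (fun j => k * r i j) (fun j => mul_nonneg hk0.le (hr0 i j))
      (by rw [← Finset.mul_sum, hr1]; field_simp)
    have e : ∑ j, entropySummand (entropyConst k) (k * r i j) =
        k * (∑ j, r i j * Real.log (r i j) + Real.log k / k
          - k * entropyConst k * ∑ j, r i j ^ 2) := by
      have : Real.log k / k = ∑ j, r i j * Real.log k := by
        rw [← Finset.sum_mul, hr1]; field_simp
      rw [this, Finset.mul_sum, ← Finset.sum_add_distrib, ← Finset.sum_sub_distrib, Finset.mul_sum]
      apply Finset.sum_congr rfl
      intro j _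
      unfold entropySummand
      rcases eq_or_ne (r i j) 0 with h0 | h0
      · simp [h0]
      · rw [Real.log_mul hk0.ne' h0]; ring
    rw [e] at h
    have : -Real.log k / k - entropyConst k / (k : ℝ) ^ 2 =
        (-Real.log k - entropyConst k / k) / k := by field_simp
    rw [this, div_le_iff₀ hk0]
    linarith
  have := Finset.sum_le_sum fun i (_ : i ∈ Finset.univ) => hrow i
  simp only [Finset.sum_sub_distrib, Finset.sum_add_distrib, Finset.sum_const, Finset.card_univ,
    Fintype.card_fin, nsmul_eq_mul, ← Finset.mul_sum] at this
  have e1 : (k : ℝ) * (-Real.log k / k) = -Real.log k := by field_simp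
  have e2 : (k : ℝ) * (Real.log k / k) = Real.log k := by field_simp
  have e3 : (k : ℝ) * (entropyConst k / k ^ 2) = k * entropyConst k * (1 / (k : ℝ) ^ 2) := by
    field_simp
  rw [e1, e2, e3] at this
  linarith

/-! ### Quadratic bounds for summands of the divergence -/

-- The derivative is `log u - (u - 1) ≤ 0` and the value at `1` is `0`. Hence `klFun u` lies above
-- `(u - 1) ^ 2 / 2` for `u ≤ 1` and below it for `u ≥ 1`.
open InformationTheory in
lemma antitoneOn_klFun_sub_sq :
    AntitoneOn (fun u : ℝ => klFun u - (u - 1) ^ 2 / 2) (Set.Ici 0) := by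
  have hd : ∀ u : ℝ, 0 < u → HasDerivAt (fun u : ℝ => klFun u - (u - 1) ^ 2 / 2)
      (Real.log u - (u - 1)) u := by
    intro u hu
    have := (hasDerivAt_klFun hu.ne').sub ((((hasDerivAt_id u).sub_const 1).pow 2).div_const 2)
    refine this.congr_deriv ?_
    simp
  apply antitoneOn_of_deriv_nonpos (convex_Ici _)
  · have := continuous_klFun
    fun_prop
  · rw [interior_Ici]
    intro u hu
    exact (hd u hu).differentiableAt.differentiableWithinAt
  · rw [interior_Ici]
    intro u hu
    rw [(hd u hu).deriv]
    linarith [Real.log_le_sub_one_of_pos (Set.mem_Ioi.1 hu)]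

-- The derivative is at least `(1 - u⁻¹) ^ 2 / 2`, by `log u ≥ 1 - u⁻¹`. Comparing with the value at
-- `1` gives the bounds that the previous lemma misses on either side of `1`.
open InformationTheory in
lemma monotoneOn_klFun_sub_sq_div :
    MonotoneOn (fun u : ℝ => klFun u - (u - 1) ^ 2 / (2 * u)) (Set.Ioi 0) := by
  have hd : ∀ u : ℝ, 0 < u → HasDerivAt (fun u : ℝ => klFun u - (u - 1) ^ 2 / (2 * u))
      (Real.log u - (1 - 1 / u ^ 2) / 2) u := by
    intro u hu
    have := (hasDerivAt_klFun hu.ne').sub ((((hasDerivAt_id u).sub_const 1).pow 2).div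
      ((hasDerivAt_id u).const_mul 2) (by simp [hu.ne']))
    refine this.congr_deriv ?_
    simp
    field_simp
    ring
  apply monotoneOn_of_deriv_nonneg (convex_Ioi _)
  · intro u hu
    exact (hd u hu).continuousAt.continuousWithinAt
  · rw [interior_Ioi]
    intro u hu
    exact (hd u hu).differentiableAt.differentiableWithinAt
  · rw [interior_Ioi]
    intro u hu
    rw [(hd u hu).deriv]
    have h1 := Real.one_sub_inv_le_log_of_pos (Set.mem_Ioi.1 hu)
    have : (1 - 1 / u ^ 2) / 2 = (1 - u⁻¹) - (1 - u⁻¹) ^ 2 / 2 := by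
      rw [one_div, ← inv_pow]; ring
    have := sq_nonneg (1 - u⁻¹)
    linarith

open InformationTheory in
/-- Quadratic lower bound for a summand of the Kullback-Leibler divergence. -/
lemma le_mul_klFun_div {r p M : ℝ} (hr : 0 ≤ r) (hp : 0 < p) (hrM : r ≤ M) (hpM : p ≤ M) :
    (r - p) ^ 2 / (2 * M) ≤ p * klFun (r / p) := by
  have hM : 0 < M := hp.trans_le hpM
  rcases le_total r p with h | h
  · have h1 := antitoneOn_klFun_sub_sq (Set.mem_Ici.2 (div_nonneg hr hp.le))
      (Set.mem_Ici.2 zero_le_one) ((div_le_one hp).2 h)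
    simp only [klFun_one, sub_self] at h1
    have h2 : (r / p - 1) ^ 2 / 2 ≤ klFun (r / p) := by linarith
    have h3 : p * ((r / p - 1) ^ 2 / 2) = (r - p) ^ 2 / (2 * p) := by field_simp
    calc (r - p) ^ 2 / (2 * M) ≤ (r - p) ^ 2 / (2 * p) := by gcongr
      _ ≤ _ := by rw [← h3]; gcongr
  · have hr' : 0 < r := hp.trans_le h
    have h1 := monotoneOn_klFun_sub_sq_div (Set.mem_Ioi.2 zero_lt_one)
      (Set.mem_Ioi.2 (div_pos hr' hp)) ((one_le_div hp).2 h)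
    simp only [klFun_one, sub_self] at h1
    have h2 : (r / p - 1) ^ 2 / (2 * (r / p)) ≤ klFun (r / p) := by linarith
    have h3 : p * ((r / p - 1) ^ 2 / (2 * (r / p))) = (r - p) ^ 2 / (2 * r) := by field_simp
    calc (r - p) ^ 2 / (2 * M) ≤ (r - p) ^ 2 / (2 * r) := by gcongr
      _ ≤ _ := by rw [← h3]; gcongr

open InformationTheory in
/-- Quadratic upper bound for a summand of the Kullback-Leibler divergence. -/
lemma mul_klFun_div_le {r p m : ℝ} (hm : 0 < m) (hrm : m ≤ r) (hpm : m ≤ p) :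
    p * klFun (r / p) ≤ (r - p) ^ 2 / (2 * m) := by
  have hr : 0 < r := hm.trans_le hrm
  have hp : 0 < p := hm.trans_le hpm
  rcases le_total p r with h | h
  · have h1 := antitoneOn_klFun_sub_sq (Set.mem_Ici.2 zero_le_one)
      (Set.mem_Ici.2 (div_nonneg hr.le hp.le)) ((one_le_div hp).2 h)
    simp only [klFun_one, sub_self] at h1
    have h2 : klFun (r / p) ≤ (r / p - 1) ^ 2 / 2 := by linarith
    have h3 : p * ((r / p - 1) ^ 2 / 2) = (r - p) ^ 2 / (2 * p) := by field_simp
    calc _ ≤ (r - p) ^ 2 / (2 * p) := by rw [← h3]; gcongr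
      _ ≤ (r - p) ^ 2 / (2 * m) := by gcongr
  · have h1 := monotoneOn_klFun_sub_sq_div (Set.mem_Ioi.2 (div_pos hr hp))
      (Set.mem_Ioi.2 zero_lt_one) ((div_le_one hp).2 h)
    simp only [klFun_one, sub_self] at h1
    have h2 : klFun (r / p) ≤ (r / p - 1) ^ 2 / (2 * (r / p)) := by linarith
    have h3 : p * ((r / p - 1) ^ 2 / (2 * (r / p))) = (r - p) ^ 2 / (2 * r) := by field_simp
    calc _ ≤ (r - p) ^ 2 / (2 * r) := by rw [← h3]; gcongr
      _ ≤ (r - p) ^ 2 / (2 * m) := by gcongr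

/-! ### Margins, mutual information and distance from independence -/

section Tables

variable {κ : Type*} [Fintype κ]

/-- The row sums of a table. -/
def rowMass {R : Type*} [AddCommMonoid R] (r : κ → κ → R) (i : κ) : R := ∑ j, r i j

/-- The column sums of a table. -/
def colMass {R : Type*} [AddCommMonoid R] (r : κ → κ → R) (j : κ) : R := ∑ i, r i j

/-- The mutual information of a table: the Kullback-Leibler divergence from the product of its
margins. -/
noncomputable def tableKL (r : κ → κ → ℝ) : ℝ :=
  ∑ i, ∑ j, r i j * Real.log (r i j) - ∑ i, rowMass r i * Real.log (rowMass r i)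
    - ∑ j, colMass r j * Real.log (colMass r j)

/-- The squared Euclidean distance of a table from the product of its margins. -/
def tableDev (r : κ → κ → ℝ) : ℝ := ∑ i, ∑ j, (r i j - rowMass r i * colMass r j) ^ 2

lemma tableDev_nonneg (r : κ → κ → ℝ) : 0 ≤ tableDev r :=
  Finset.sum_nonneg fun _ _ => Finset.sum_nonneg fun _ _ => sq_nonneg _

lemma continuous_rowMass (i : κ) : Continuous fun r : κ → κ → ℝ => rowMass r i := by
  unfold rowMass; fun_prop

lemma continuous_colMass (j : κ) : Continuous fun r : κ → κ → ℝ => colMass r j := by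
  unfold colMass; fun_prop

lemma continuous_tableKL : Continuous (tableKL : (κ → κ → ℝ) → ℝ) := by
  have h := Real.continuous_mul_log
  have h1 : ∀ i j : κ, Continuous fun r : κ → κ → ℝ => r i j * Real.log (r i j) := fun i j =>
    h.comp (by fun_prop : Continuous fun r : κ → κ → ℝ => r i j)
  have h2 := fun i : κ => h.comp (continuous_rowMass i)
  have h3 := fun i : κ => h.comp (continuous_colMass i)
  unfold tableKL
  refine ((continuous_finsetSum _ fun i _ => continuous_finsetSum _ fun j _ => h1 i j).sub
    (continuous_finsetSum _ fun i _ => h2 i)).sub (continuous_finsetSum _ fun i _ => h3 i)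

lemma continuous_tableDev : Continuous (tableDev : (κ → κ → ℝ) → ℝ) := by
  have h2 := fun i : κ => continuous_rowMass i
  have h3 := fun i : κ => continuous_colMass i
  unfold tableDev
  fun_prop

lemma sum_rowMass_eq_sum_colMass {R : Type*} [AddCommMonoid R] (r : κ → κ → R) :
    ∑ i, rowMass r i = ∑ j, colMass r j := by
  simp only [rowMass, colMass]; exact Finset.sum_comm

-- The table and the product of its margins have the same total mass, so the linear terms of `klFun`
-- cancel. In this form every summand is nonnegative and can be compared with a square separately.
open InformationTheory in
lemma tableKL_eq_sum_klFun (r : κ → κ → ℝ) (hrow : ∀ i, 0 < rowMass r i)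
    (hcol : ∀ j, 0 < colMass r j) (h1 : ∑ i, rowMass r i = 1) :
    tableKL r = ∑ i, ∑ j, rowMass r i * colMass r j *
      klFun (r i j / (rowMass r i * colMass r j)) := by
  have h1' : ∑ j, colMass r j = 1 := by rw [← sum_rowMass_eq_sum_colMass, h1]
  have e : ∀ i j, rowMass r i * colMass r j * klFun (r i j / (rowMass r i * colMass r j)) =
      r i j * Real.log (r i j) - r i j * Real.log (rowMass r i)
        - r i j * Real.log (colMass r j) + rowMass r i * colMass r j - r i j := by
    intro i j
    have hi := (hrow i).ne'
    have hj := (hcol j).ne'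
    rw [klFun_apply]
    rcases eq_or_ne (r i j) 0 with h0 | h0
    · simp [h0]
    · rw [Real.log_div h0 (mul_ne_zero hi hj), Real.log_mul hi hj]
      field_simp
      ring
  simp only [e, Finset.sum_sub_distrib, Finset.sum_add_distrib]
  have e1 : ∑ i, ∑ j, r i j * Real.log (rowMass r i) =
      ∑ i, rowMass r i * Real.log (rowMass r i) := by
    simp only [← Finset.sum_mul]; rfl
  have e2 : ∑ i, ∑ j, r i j * Real.log (colMass r j) =
      ∑ i, colMass r i * Real.log (colMass r i) := by
    rw [Finset.sum_comm]; simp only [← Finset.sum_mul]; rfl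
  have e3 : ∑ i, ∑ j, rowMass r i * colMass r j = 1 := by
    rw [← Finset.sum_mul_sum, h1, h1', one_mul]
  have e4 : ∑ i, ∑ j, r i j = 1 := h1
  rw [e1, e2, e3, e4, tableKL]
  ring

end Tables

lemma tableDev_of_uniform {k : ℕ} (hk : k ≠ 0) (r : Fin k → Fin k → ℝ)
    (hrow : ∀ i, rowMass r i = 1 / k) (hcol : ∀ j, colMass r j = 1 / k) :
    tableDev r = ∑ i, ∑ j, r i j ^ 2 - 1 / (k : ℝ) ^ 2 := by
  have hk' : (k : ℝ) ≠ 0 := by exact_mod_cast hk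
  have h1 : ∑ i, ∑ j, r i j = 1 := by
    have : ∑ i, rowMass r i = 1 := by simp [hrow, hk']
    exact this
  simp only [tableDev, hrow, hcol, sub_sq, Finset.sum_add_distrib, Finset.sum_sub_distrib,
    ← Finset.sum_mul, ← Finset.mul_sum, h1]
  simp
  field_simp
  ring

lemma tableKL_of_uniform {k : ℕ} (hk : 3 ≤ k) (r : Fin k → Fin k → ℝ) (hr0 : ∀ i j, 0 ≤ r i j)
    (hrow : ∀ i, rowMass r i = 1 / k) (hcol : ∀ j, colMass r j = 1 / k) :
    k * entropyConst k * tableDev r ≤ tableKL r := by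
  have hk' : (k : ℝ) ≠ 0 := by positivity
  rw [tableDev_of_uniform (by omega) r hrow hcol]
  refine (uniform_table_entropy_ineq hk r hr0 hrow).trans_eq ?_
  simp only [tableKL, hrow, hcol]
  simp
  field_simp
  ring

/-! ### The quadratic bound for nearly uniform margins -/

/-- The supremum of the constants for which the quadratic lower bound for the mutual information
is needed. -/
noncomputable def entropyBound (k : ℕ) : ℝ := (k : ℝ) ^ 2 * Real.log (k - 1) / (k - 1)

/-- This amounts to `k * (k - 2) ≤ (k - 1) ^ 2`: the sharp constant for exactly uniform margins
leaves room. -/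
lemma entropyBound_le_mul_entropyConst {k : ℕ} (hk : 3 ≤ k) :
    entropyBound k ≤ k * entropyConst k := by
  have hk3 : (3 : ℝ) ≤ k := by exact_mod_cast hk
  have := Real.log_pos (x := (k : ℝ) - 1) (by linarith)
  have hk1 : (0 : ℝ) < (k : ℝ) - 1 := by linarith
  have hk2 : (0 : ℝ) < (k : ℝ) - 2 := by linarith
  rw [entropyBound, entropyConst, mul_div_assoc', div_le_div_iff₀ hk1 hk2]
  have : 0 ≤ k * Real.log ((k : ℝ) - 1) := by positivity
  nlinarith

/-- By `log √x ≤ √x - 1` and `4 * (√x - 1) ≤ x`, the latter being `(√x - 2) ^ 2 ≥ 0`. It makes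
`entropyBound` small enough for the local estimate and also gives `d' < (k - 1) ^ 2`. -/
lemma two_mul_log_le {x : ℝ} (hx : 0 < x) : 2 * Real.log x ≤ x := by
  have h := Real.log_le_sub_one_of_pos (Real.sqrt_pos.2 hx)
  rw [Real.log_sqrt hx.le] at h
  have h2 := Real.sq_sqrt hx.le
  nlinarith [sq_nonneg (√x - 2)]

lemma entropyBound_le_sq_half {k : ℕ} (hk : 3 ≤ k) : entropyBound k ≤ (k : ℝ) ^ 2 / 2 := by
  have hk3 : (3 : ℝ) ≤ k := by exact_mod_cast hk
  have hk1 : (0 : ℝ) < (k : ℝ) - 1 := by linarith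
  have := two_mul_log_le hk1
  rw [entropyBound, div_le_div_iff₀ hk1 (by norm_num)]
  have : (0 : ℝ) ≤ (k : ℝ) ^ 2 := by positivity
  nlinarith

/-- The quadratic lower bound for the mutual information near the uniform table. -/
lemma tableKL_ge_near_uniform {k : ℕ} (hk : 3 ≤ k) {K : ℝ} (hK : K < (k : ℝ) ^ 2 / 2) :
    ∃ η > 0, ∀ r : Fin k → Fin k → ℝ, (∀ i j, 0 ≤ r i j) → ∑ i, rowMass r i = 1 →
      (∀ i, |rowMass r i - 1 / k| ≤ η) → (∀ j, |colMass r j - 1 / k| ≤ η) →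
      (∀ i j, |r i j - 1 / (k : ℝ) ^ 2| ≤ η) → K * tableDev r ≤ tableKL r := by
  have hk0 : (0 : ℝ) < k := by positivity
  -- The summandwise bound has constant `1 / (2 * M)`, where `M` bounds the entries and the products
  -- of margins. As `η → 0` it tends to `k ^ 2 / 2`.
  have hc : Tendsto (fun η : ℝ => 1 / (2 * max (1 / (k : ℝ) ^ 2 + η) ((1 / k + η) ^ 2)))
      (𝓝 0) (𝓝 ((k : ℝ) ^ 2 / 2)) := by
    have hm : max (1 / (k : ℝ) ^ 2 + 0) ((1 / (k : ℝ) + 0) ^ 2) = 1 / (k : ℝ) ^ 2 := by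
      simp
    have : ContinuousAt (fun η : ℝ =>
        1 / (2 * max (1 / (k : ℝ) ^ 2 + η) ((1 / k + η) ^ 2))) 0 := by
      apply ContinuousAt.div (by fun_prop) (by fun_prop)
      rw [hm]; positivity
    have he : 1 / (2 * max (1 / (k : ℝ) ^ 2 + 0) ((1 / (k : ℝ) + 0) ^ 2)) = (k : ℝ) ^ 2 / 2 := by
      rw [hm]; field_simp
    exact he ▸ this.tendsto
  have h1 := hc.eventually_const_lt hK
  have h2 : ∀ᶠ η : ℝ in 𝓝 0, η < 1 / k := gt_mem_nhds (by positivity)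
  obtain ⟨η, ⟨h1, h2⟩, hη⟩ := (((h1.and h2).filter_mono nhdsWithin_le_nhds).and
    (self_mem_nhdsWithin : Set.Ioi (0 : ℝ) ∈ 𝓝[>] 0)).exists
  refine ⟨η, hη, fun r hr0 hr1 hrow hcol hr => ?_⟩
  have hρ : ∀ i, 0 < rowMass r i := fun i => by linarith [(abs_le.1 (hrow i)).1]
  have hρ' : ∀ i, 0 < colMass r i := fun i => by linarith [(abs_le.1 (hcol i)).1]
  rw [tableKL_eq_sum_klFun r hρ hρ' hr1, tableDev, Finset.mul_sum]
  refine Finset.sum_le_sum fun i _ => ?_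
  rw [Finset.mul_sum]
  refine Finset.sum_le_sum fun j _ => ?_
  set M := max (1 / (k : ℝ) ^ 2 + η) ((1 / k + η) ^ 2) with hM
  refine le_trans ?_ (le_mul_klFun_div (M := M) (hr0 i j) (mul_pos (hρ i) (hρ' j)) ?_ ?_)
  · rw [div_eq_mul_one_div, mul_comm]
    gcongr
  · exact le_max_of_le_left (by linarith [(abs_le.1 (hr i j)).2])
  · apply le_max_of_le_right
    rw [sq]
    apply mul_le_mul (by linarith [(abs_le.1 (hrow i)).2]) (by linarith [(abs_le.1 (hcol j)).2])
      (hρ' j).le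
    have : 0 < η := hη
    positivity

/-- The quadratic lower bound for the mutual information of a table with nearly uniform
margins. -/
theorem tableKL_ge {k : ℕ} (hk : 3 ≤ k) {K : ℝ} (hK : K < entropyBound k) :
    ∃ ε > 0, ∀ r : Fin k → Fin k → ℝ, (∀ i j, 0 ≤ r i j) → ∑ i, rowMass r i = 1 →
      (∀ i, |rowMass r i - 1 / k| ≤ ε) → (∀ j, |colMass r j - 1 / k| ≤ ε) →
      K * tableDev r ≤ tableKL r := by
  have hk0 : (0 : ℝ) < k := by positivity
  obtain ⟨η, hη, hnear⟩ := tableKL_ge_near_uniform hk (hK.trans_le (entropyBound_le_sq_half hk))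
  -- Compactness: `Z` holds the tables away from the uniform one that satisfy the reverse
  -- inequality, with equality allowed so that `Z` is closed. No table in `Z` has uniform margins,
  -- so `h`, the squared deviation of the margins, is bounded below on `Z` by some `δ > 0`. Margins
  -- within `ε` of uniform with `2 * k * ε ^ 2 < δ` therefore exclude `Z`.
  let h : (Fin k → Fin k → ℝ) → ℝ := fun r =>
    ∑ i, (rowMass r i - 1 / k) ^ 2 + ∑ j, (colMass r j - 1 / k) ^ 2
  let far : Set (Fin k → Fin k → ℝ) := ⋃ i, ⋃ j, {r | η ≤ |r i j - 1 / (k : ℝ) ^ 2|}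
  let Z : Set (Fin k → Fin k → ℝ) :=
    Set.Icc 0 1 ∩ ({r | ∑ i, rowMass r i = 1} ∩ {r | tableKL r ≤ K * tableDev r} ∩ far)
  have hrc := fun i : Fin k => continuous_rowMass i
  have hcc := fun i : Fin k => continuous_colMass i
  have hcont : Continuous h := by fun_prop
  have hfar : IsClosed far := by
    refine isClosed_iUnion_of_finite fun i => isClosed_iUnion_of_finite fun j => ?_
    exact isClosed_le continuous_const (by fun_prop)
  have hZ : IsCompact Z := by
    apply isCompact_Icc.inter_right
    refine (IsClosed.inter ?_ ?_).inter hfar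
    · exact isClosed_eq (by fun_prop) continuous_const
    · exact isClosed_le continuous_tableKL (continuous_const.mul continuous_tableDev)
  have hpos : ∀ r ∈ Z, 0 < h r := by
    rintro r ⟨hr01, ⟨hr1, hr2⟩, hr3⟩
    have h0 : 0 ≤ h r := by
      apply add_nonneg <;> exact Finset.sum_nonneg fun _ _ => sq_nonneg _
    refine h0.lt_of_ne fun heq => ?_
    have hs1 : 0 ≤ ∑ i, (rowMass r i - 1 / k) ^ 2 := Finset.sum_nonneg fun _ _ => sq_nonneg _
    have hs2 : 0 ≤ ∑ i, (colMass r i - 1 / k) ^ 2 := Finset.sum_nonneg fun _ _ => sq_nonneg _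
    have e1 : ∑ i, (rowMass r i - 1 / k) ^ 2 = 0 := by
      have : h r = _ + _ := rfl
      linarith
    have e2 : ∑ i, (colMass r i - 1 / k) ^ 2 = 0 := by
      have : h r = _ + _ := rfl
      linarith
    rw [Finset.sum_eq_zero_iff_of_nonneg fun _ _ => sq_nonneg _] at e1 e2
    have hrow : ∀ i, rowMass r i = 1 / k := fun i => by
      have := pow_eq_zero_iff two_ne_zero |>.1 (e1 i (Finset.mem_univ i)); linarith
    have hcol : ∀ i, colMass r i = 1 / k := fun i => by
      have := pow_eq_zero_iff two_ne_zero |>.1 (e2 i (Finset.mem_univ i)); linarith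
    have hge := tableKL_of_uniform hk r (fun i j => hr01.1 i j) hrow hcol
    have hdev : 0 < tableDev r := by
      simp only [far, Set.mem_iUnion] at hr3
      obtain ⟨i, j, hij⟩ := hr3
      have hij : η ≤ |r i j - 1 / (k : ℝ) ^ 2| := hij
      have hle : (r i j - rowMass r i * colMass r j) ^ 2 ≤ tableDev r := by
        refine le_trans ?_ (Finset.single_le_sum (fun i _ => Finset.sum_nonneg
          fun j _ => sq_nonneg (r i j - rowMass r i * colMass r j)) (Finset.mem_univ i))
        exact Finset.single_le_sum (f := fun j => (r i j - rowMass r i * colMass r j) ^ 2)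
          (fun j _ => sq_nonneg _) (Finset.mem_univ j)
      refine lt_of_lt_of_le ?_ hle
      have e : rowMass r i * colMass r j = 1 / (k : ℝ) ^ 2 := by
        rw [hrow, hcol]; field_simp
      rw [e, ← sq_abs]
      have : 0 < |r i j - 1 / (k : ℝ) ^ 2| := hη.trans_le hij
      positivity
    -- The strict gap between the constants, with a positive deviation, contradicts even the
    -- non-strict inequality in `Z`.
    have hlt : K < k * entropyConst k := hK.trans_le (entropyBound_le_mul_entropyConst hk)
    have : tableKL r ≤ K * tableDev r := hr2
    nlinarith
  obtain ⟨δ, hδ, hmin⟩ : ∃ δ > 0, ∀ r ∈ Z, δ ≤ h r := by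
    rcases Z.eq_empty_or_nonempty with hemp | hne
    · exact ⟨1, one_pos, by simp [hemp]⟩
    · obtain ⟨r₀, hr₀, hm⟩ := hZ.exists_isMinOn hne hcont.continuousOn
      exact ⟨h r₀, hpos r₀ hr₀, fun r hr => hm hr⟩
  have hlim : Tendsto (fun ε : ℝ => 2 * k * ε ^ 2) (𝓝 0) (𝓝 0) := by
    have : Continuous (fun ε : ℝ => 2 * k * ε ^ 2) := by fun_prop
    simpa using this.tendsto 0
  obtain ⟨ε, ⟨hε1, hε2⟩, hε⟩ := ((((hlim.eventually_lt_const hδ).and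
    (gt_mem_nhds hη)).filter_mono nhdsWithin_le_nhds).and
    (self_mem_nhdsWithin : Set.Ioi (0 : ℝ) ∈ 𝓝[>] 0)).exists
  refine ⟨ε, hε, fun r hr0 hr1 hrow hcol => ?_⟩
  by_cases hc : ∀ i j, |r i j - 1 / (k : ℝ) ^ 2| ≤ η
  · exact hnear r hr0 hr1 (fun i => (hrow i).trans hε2.le) (fun j => (hcol j).trans hε2.le) hc
  · push Not at hc
    obtain ⟨i, j, hij⟩ := hc
    by_contra! hlt
    have hmem : r ∈ Z := by
      refine ⟨⟨fun i j => hr0 i j, fun i j => ?_⟩, ⟨hr1, hlt.le⟩, ?_⟩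
      · have h1 : r i j ≤ rowMass r i := Finset.single_le_sum (f := fun j => r i j)
          (fun j _ => hr0 i j) (Finset.mem_univ j)
        have h2 : rowMass r i ≤ ∑ i, rowMass r i := Finset.single_le_sum
          (f := fun i => rowMass r i) (fun i _ => Finset.sum_nonneg fun j _ => hr0 i j)
          (Finset.mem_univ i)
        exact (h1.trans h2).trans_eq hr1
      · exact Set.mem_iUnion.2 ⟨i, Set.mem_iUnion.2 ⟨j, hij.le⟩⟩
    have h1 := hmin r hmem
    have h2 : h r ≤ 2 * k * ε ^ 2 := by
      have a1 : ∑ i, (rowMass r i - 1 / k) ^ 2 ≤ ∑ _i : Fin k, ε ^ 2 :=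
        Finset.sum_le_sum fun i _ => by
          rw [← sq_abs]; exact pow_le_pow_left₀ (abs_nonneg _) (hrow i) 2
      have a2 : ∑ i, (colMass r i - 1 / k) ^ 2 ≤ ∑ _i : Fin k, ε ^ 2 :=
        Finset.sum_le_sum fun i _ => by
          rw [← sq_abs]; exact pow_le_pow_left₀ (abs_nonneg _) (hcol i) 2
      simp only [Finset.sum_const, Finset.card_univ, Fintype.card_fin, nsmul_eq_mul] at a1 a2
      have : h r = _ + _ := rfl
      linarith
    linarith

/-! ### Stirling factors -/

/-- The quotient of `m!` and `(m / e) ^ m`. -/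
noncomputable def stirlingFactor (m : ℕ) : ℝ := m.factorial / Real.exp (m * Real.log m - m)

lemma factorial_eq_stirlingFactor_mul (m : ℕ) :
    (m.factorial : ℝ) = stirlingFactor m * Real.exp (m * Real.log m - m) := by
  rw [stirlingFactor, div_mul_cancel₀ _ (Real.exp_pos _).ne']

lemma stirlingFactor_pos (m : ℕ) : 0 < stirlingFactor m := by
  unfold stirlingFactor; positivity

lemma stirlingFactor_eq {m : ℕ} (hm : m ≠ 0) :
    stirlingFactor m = √2 * Stirling.stirlingSeq m * √(m : ℝ) := by
  have hm' : (0 : ℝ) < m := by positivity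
  have e : Real.exp (m * Real.log m - m) = (m / Real.exp 1) ^ m := by
    rw [Real.exp_sub, div_pow, Real.exp_one_pow, mul_comm, Real.exp_mul, Real.exp_log hm',
      Real.rpow_natCast]
  rw [stirlingFactor, e, Stirling.stirlingSeq, Real.sqrt_mul (by norm_num)]
  have : (0 : ℝ) < √2 := by positivity
  have : (0 : ℝ) < √(m : ℝ) := by positivity
  field_simp

lemma sqrt_le_stirlingFactor (m : ℕ) : √(m : ℝ) ≤ stirlingFactor m := by
  rcases eq_or_ne m 0 with rfl | hm
  · simpa using (stirlingFactor_pos 0).le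
  · rw [stirlingFactor_eq hm]
    have h1 := Stirling.sqrt_pi_le_stirlingSeq hm
    have h2 : (1 : ℝ) ≤ √Real.pi := Real.one_le_sqrt.2 (by linarith [Real.pi_gt_three])
    have h3 : (1 : ℝ) ≤ √2 := Real.one_le_sqrt.2 (by norm_num)
    have : 1 * 1 ≤ √2 * Stirling.stirlingSeq m :=
      mul_le_mul h3 (h2.trans h1) zero_le_one (by positivity)
    nlinarith [Real.sqrt_nonneg (m : ℝ)]

lemma one_le_stirlingFactor (m : ℕ) : 1 ≤ stirlingFactor m := by
  rcases eq_or_ne m 0 with rfl | hm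
  -- Since `Real.log 0 = 0`, the factor at `m = 0` is exactly `1`, so empty cells of a table need no
  -- exception.
  · simp [stirlingFactor]
  · refine le_trans ?_ (sqrt_le_stirlingFactor m)
    exact Real.one_le_sqrt.2 (by exact_mod_cast Nat.one_le_iff_ne_zero.2 hm)

/-- The Stirling sequence decreases from its value `exp 1 / √2` at `1`. -/
lemma stirlingFactor_le {m : ℕ} (hm : m ≠ 0) : stirlingFactor m ≤ Real.exp 1 * √(m : ℝ) := by
  rw [stirlingFactor_eq hm]
  obtain ⟨j, rfl⟩ := Nat.exists_eq_succ_of_ne_zero hm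
  have h := Stirling.stirlingSeq'_antitone (Nat.zero_le j)
  simp only [Function.comp] at h
  rw [show Nat.succ 0 = 1 from rfl, Stirling.stirlingSeq_one, le_div_iff₀ (by positivity)] at h
  gcongr
  linarith

lemma tendsto_stirlingFactor_div_sqrt :
    Tendsto (fun m : ℕ => stirlingFactor m / √(m : ℝ)) atTop (𝓝 (√2 * √Real.pi)) := by
  refine (Stirling.tendsto_stirlingSeq_sqrt_pi.const_mul √2).congr' ?_
  filter_upwards [eventually_ne_atTop 0] with m hm
  have : (0 : ℝ) < √(m : ℝ) := by positivity
  rw [stirlingFactor_eq hm]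
  field_simp

/-- If `m` grows like `c N`, then its Stirling factor grows like `√(2 π c N)`. -/
lemma tendsto_stirlingFactor_div {ι : Type*} {l : Filter ι} {N m : ι → ℕ} {c : ℝ} (hc : 0 < c)
    (hN : Tendsto N l atTop) (hm : Tendsto (fun x => (m x : ℝ) / N x) l (𝓝 c)) :
    Tendsto (fun x => stirlingFactor (m x) / √(N x : ℝ)) l (𝓝 (√2 * √Real.pi * √c)) := by
  have hNr : Tendsto (fun x => (N x : ℝ)) l atTop := tendsto_natCast_atTop_atTop.comp hN
  have hm_top : Tendsto m l atTop := by
    rw [← tendsto_natCast_atTop_iff (R := ℝ)]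
    refine (hm.pos_mul_atTop hc hNr).congr' ?_
    filter_upwards [hN.eventually_ne_atTop 0] with x hx
    have : (N x : ℝ) ≠ 0 := by exact_mod_cast hx
    field_simp
  refine ((tendsto_stirlingFactor_div_sqrt.comp hm_top).mul hm.sqrt).congr' ?_
  filter_upwards [hm_top.eventually_ne_atTop 0] with x hx
  have : (0 : ℝ) < √(m x : ℝ) := by positivity
  simp only [Function.comp]
  rw [Real.sqrt_div (Nat.cast_nonneg _)]
  field_simp

/-! ### The probability of a table: local limit and Gaussian bound -/

section Tables

variable {k : ℕ}

/-- The relative frequencies of a table of counts. -/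
noncomputable def tableFreq (T : Fin k → Fin k → ℕ) (i j : Fin k) : ℝ :=
  (T i j : ℝ) / (∑ i, rowMass T i : ℕ)

/-- The probability of a table of counts given its margins. -/
noncomputable def tableWeight (T : Fin k → Fin k → ℕ) : ℝ :=
  ((∏ i, (rowMass T i).factorial : ℝ) * ∏ j, ((colMass T j).factorial : ℝ)) /
    (((∑ i, rowMass T i : ℕ).factorial : ℝ) * ∏ i, ∏ j, ((T i j).factorial : ℝ))

/-- The product of the Stirling factors in `tableWeight`. -/
noncomputable def tableStirling (T : Fin k → Fin k → ℕ) : ℝ :=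
  ((∏ i, stirlingFactor (rowMass T i)) * ∏ j, stirlingFactor (colMass T j)) /
    (stirlingFactor (∑ i, rowMass T i) * ∏ i, ∏ j, stirlingFactor (T i j))

lemma rowMass_tableFreq (T : Fin k → Fin k → ℕ) (i : Fin k) :
    rowMass (tableFreq T) i = ((rowMass T i : ℕ) : ℝ) / (∑ i, rowMass T i : ℕ) := by
  simp only [rowMass, tableFreq, ← Finset.sum_div, Nat.cast_sum]

lemma colMass_tableFreq (T : Fin k → Fin k → ℕ) (j : Fin k) :
    colMass (tableFreq T) j = ((colMass T j : ℕ) : ℝ) / (∑ i, rowMass T i : ℕ) := by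
  simp only [colMass, tableFreq, ← Finset.sum_div, Nat.cast_sum]

lemma sum_rowMass_tableFreq (T : Fin k → Fin k → ℕ) (hT : ∑ i, rowMass T i ≠ 0) :
    ∑ i, rowMass (tableFreq T) i = 1 := by
  simp only [rowMass_tableFreq, ← Finset.sum_div]
  rw [← Nat.cast_sum, div_self]
  exact_mod_cast hT

lemma mul_div_mul_log_div (n : ℝ) (hn : n ≠ 0) (t : ℝ) :
    n * (t / n * Real.log (t / n)) = t * Real.log t - t * Real.log n := by
  rcases eq_or_ne t 0 with rfl | ht
  · simp
  · rw [Real.log_div ht hn]; field_simp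

lemma mul_tableKL_tableFreq (T : Fin k → Fin k → ℕ) (hT : ∑ i, rowMass T i ≠ 0) :
    (∑ i, rowMass T i : ℕ) * tableKL (tableFreq T) =
      ∑ i, ∑ j, (T i j : ℝ) * Real.log (T i j)
      - ∑ i, ((rowMass T i : ℕ) : ℝ) * Real.log ((rowMass T i : ℕ) : ℝ)
      - ∑ j, ((colMass T j : ℕ) : ℝ) * Real.log ((colMass T j : ℕ) : ℝ)
      + (∑ i, rowMass T i : ℕ) * Real.log (∑ i, rowMass T i : ℕ) := by
  have hn : ((∑ i, rowMass T i : ℕ) : ℝ) ≠ 0 := by exact_mod_cast hT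
  simp only [tableKL, rowMass_tableFreq, colMass_tableFreq, mul_sub, Finset.mul_sum]
  simp only [tableFreq, mul_div_mul_log_div _ hn, Finset.sum_sub_distrib, ← Finset.sum_mul]
  have e1 : ∑ i, ∑ j, (T i j : ℝ) = (∑ i, rowMass T i : ℕ) := by
    push_cast [rowMass]; rfl
  have e2 : ∑ i, ((rowMass T i : ℕ) : ℝ) = (∑ i, rowMass T i : ℕ) := by push_cast; rfl
  have e3 : ∑ j, ((colMass T j : ℕ) : ℝ) = (∑ i, rowMass T i : ℕ) := by
    rw [sum_rowMass_eq_sum_colMass]; push_cast; rfl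
  rw [e1, e2, e3]
  ring

/-- An exact identity: the linear terms of the exponents cancel because rows, columns and entries
have the same total, and the terms `m * log m` assemble to the mutual information. All error of
Stirling's formula sits in `tableStirling`. -/
lemma tableWeight_eq (T : Fin k → Fin k → ℕ) (hT : ∑ i, rowMass T i ≠ 0) :
    tableWeight T = tableStirling T *
      Real.exp (-((∑ i, rowMass T i : ℕ) * tableKL (tableFreq T))) := by
  rw [mul_tableKL_tableFreq T hT]
  have e1 : ∑ i, ∑ j, (T i j : ℝ) = (∑ i, rowMass T i : ℕ) := by
    push_cast [rowMass]; rfl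
  have e2 : ∑ i, ((rowMass T i : ℕ) : ℝ) = (∑ i, rowMass T i : ℕ) := by push_cast; rfl
  have e3 : ∑ j, ((colMass T j : ℕ) : ℝ) = (∑ i, rowMass T i : ℕ) := by
    rw [sum_rowMass_eq_sum_colMass]; push_cast; rfl
  simp only [tableWeight, tableStirling, factorial_eq_stirlingFactor_mul, Finset.prod_mul_distrib,
    ← Real.exp_sum, Finset.sum_sub_distrib, e1, e2, e3]
  set n : ℝ := ((∑ i, rowMass T i : ℕ) : ℝ) with hn
  set A := ∑ i, ((rowMass T i : ℕ) : ℝ) * Real.log ((rowMass T i : ℕ) : ℝ)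
  set B := ∑ i, ((colMass T i : ℕ) : ℝ) * Real.log ((colMass T i : ℕ) : ℝ)
  set E := ∑ i, ∑ j, (T i j : ℝ) * Real.log (T i j)
  set sn := stirlingFactor (∑ i, rowMass T i)
  set sA := ∏ i, stirlingFactor (rowMass T i)
  set sB := ∏ i, stirlingFactor (colMass T i)
  set sE := ∏ i, ∏ j, stirlingFactor (T i j)
  have : Real.exp (-(E - A - B + n * Real.log n)) =
      Real.exp (A - n) * Real.exp (B - n) /
        (Real.exp (n * Real.log n - n) * Real.exp (E - n)) := by
    rw [← Real.exp_add, ← Real.exp_add, ← Real.exp_sub]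
    congr 1; ring
  rw [this, div_mul_div_comm]
  congr 1 <;> ring

/-- There are `2 * k` factors above and `k ^ 2 + 1` below, so dividing each by `s` costs `s ^ ((k -
1) ^ 2)`. For `s = √n` each quotient converges when the frequencies do. -/
lemma sqrt_pow_mul_tableStirling (hk : 1 ≤ k) (T : Fin k → Fin k → ℕ) {s : ℝ} (hs : 0 < s) :
    s ^ ((k - 1) ^ 2) * tableStirling T =
      ((∏ i, stirlingFactor (rowMass T i) / s) * ∏ j, stirlingFactor (colMass T j) / s) /
      ((stirlingFactor (∑ i, rowMass T i) / s) * ∏ i, ∏ j, stirlingFactor (T i j) / s) := by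
  have hs' := hs.ne'
  simp only [Finset.prod_div_distrib, Finset.prod_const, Finset.card_univ, Fintype.card_fin,
    tableStirling]
  set sn := stirlingFactor (∑ i, rowMass T i) with hsn
  set sE := ∏ i, ∏ j, stirlingFactor (T i j) with hsE
  have h1 : 0 < sn := stirlingFactor_pos _
  have h2 : 0 < sE := Finset.prod_pos fun i _ => Finset.prod_pos fun j _ => stirlingFactor_pos _
  obtain ⟨r, rfl⟩ : ∃ r, k = r + 1 := ⟨k - 1, by omega⟩
  field_simp
  rw [Nat.add_sub_cancel]
  ring

/-- The leading constant in the local limit theorem for tables. -/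
noncomputable def tableConst (k : ℕ) : ℝ :=
  ((∏ _i : Fin k, √2 * √Real.pi * √(1 / k : ℝ)) * ∏ _j : Fin k, √2 * √Real.pi * √(1 / k : ℝ)) /
    (√2 * √Real.pi * √1 * ∏ _i : Fin k, ∏ _j : Fin k, √2 * √Real.pi * √(1 / (k : ℝ) ^ 2))

lemma tableConst_pos (hk : k ≠ 0) : 0 < tableConst k := by
  have : (0 : ℝ) < k := by positivity
  unfold tableConst
  positivity

variable {ι : Type*} {l : Filter ι} {T : ι → Fin k → Fin k → ℕ}

lemma tendsto_sqrt_pow_mul_tableStirling (hk : k ≠ 0)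
    (hN : Tendsto (fun x => ∑ i, rowMass (T x) i) l atTop)
    (hrow : ∀ i, Tendsto (fun x => rowMass (tableFreq (T x)) i) l (𝓝 (1 / k)))
    (hcol : ∀ j, Tendsto (fun x => colMass (tableFreq (T x)) j) l (𝓝 (1 / k)))
    (hT : ∀ i j, Tendsto (fun x => tableFreq (T x) i j) l (𝓝 (1 / (k : ℝ) ^ 2))) :
    Tendsto (fun x => √(∑ i, rowMass (T x) i : ℕ) ^ ((k - 1) ^ 2) * tableStirling (T x)) l
      (𝓝 (tableConst k)) := by
  have hk0 : (0 : ℝ) < k := by positivity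
  have h1 := fun i => tendsto_stirlingFactor_div (one_div_pos.2 hk0) hN
    (by simpa only [rowMass_tableFreq] using hrow i)
  have h2 := fun j => tendsto_stirlingFactor_div (one_div_pos.2 hk0) hN
    (by simpa only [colMass_tableFreq] using hcol j)
  have h3 := fun i j => tendsto_stirlingFactor_div (by positivity) hN (hT i j)
  have h4 := tendsto_stirlingFactor_div (m := fun x => ∑ i, rowMass (T x) i) zero_lt_one hN (by
    refine tendsto_const_nhds.congr' ?_
    filter_upwards [hN.eventually_ne_atTop 0] with x hx
    rw [div_self]; exact_mod_cast hx)
  have h5 := ((tendsto_finsetProd Finset.univ fun i _ => h1 i).mul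
    (tendsto_finsetProd Finset.univ fun j _ => h2 j)).div (h4.mul
    (tendsto_finsetProd Finset.univ fun i _ => tendsto_finsetProd Finset.univ fun j _ => h3 i j))
    (by positivity)
  refine h5.congr' ?_
  filter_upwards [hN.eventually_gt_atTop 0] with x hx
  rw [sqrt_pow_mul_tableStirling (by omega) _ (Real.sqrt_pos.2 (by exact_mod_cast hx))]
  rfl

open InformationTheory in
/-- The Gaussian approximation of the mutual information. -/
lemma tendsto_mul_tableKL (hk : k ≠ 0) {V : Fin k → Fin k → ℝ}
    (hN : Tendsto (fun x => ∑ i, rowMass (T x) i) l atTop)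
    (hrow : ∀ i, Tendsto (fun x => rowMass (tableFreq (T x)) i) l (𝓝 (1 / k)))
    (hcol : ∀ j, Tendsto (fun x => colMass (tableFreq (T x)) j) l (𝓝 (1 / k)))
    (hT : ∀ i j, Tendsto (fun x => tableFreq (T x) i j) l (𝓝 (1 / (k : ℝ) ^ 2)))
    (hV : ∀ i j, Tendsto (fun x => √(∑ i, rowMass (T x) i : ℕ) * (tableFreq (T x) i j -
      rowMass (tableFreq (T x)) i * colMass (tableFreq (T x)) j)) l (𝓝 (V i j))) :
    Tendsto (fun x => (∑ i, rowMass (T x) i : ℕ) * tableKL (tableFreq (T x))) l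
      (𝓝 ((k : ℝ) ^ 2 / 2 * ∑ i, ∑ j, V i j ^ 2)) := by
  have hk0 : (0 : ℝ) < k := by positivity
  have hp : ∀ i j, Tendsto (fun x => rowMass (tableFreq (T x)) i * colMass (tableFreq (T x)) j) l
      (𝓝 (1 / (k : ℝ) ^ 2)) := fun i j => by
    convert (hrow i).mul (hcol j) using 2; field_simp
  have hterm : ∀ i j, Tendsto (fun x => ((∑ i, rowMass (T x) i : ℕ) : ℝ) *
      (rowMass (tableFreq (T x)) i * colMass (tableFreq (T x)) j * klFun (tableFreq (T x) i j /
        (rowMass (tableFreq (T x)) i * colMass (tableFreq (T x)) j)))) l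
      (𝓝 ((k : ℝ) ^ 2 / 2 * V i j ^ 2)) := by
    intro i j
    have hsq := (hV i j).pow 2
    -- The entry and the product of its margins have the same limit, so the denominators of the
    -- lower and the upper quadratic bound agree in the limit.
    have hlo := hsq.div (((hT i j).max (hp i j)).const_mul 2) (by rw [max_self]; positivity)
    have hup := hsq.div (((hT i j).min (hp i j)).const_mul 2) (by rw [min_self]; positivity)
    have elim : V i j ^ 2 / (2 * (1 / (k : ℝ) ^ 2)) = (k : ℝ) ^ 2 / 2 * V i j ^ 2 := by
      field_simp
    rw [max_self, elim] at hlo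
    rw [min_self, elim] at hup
    have hpos : (0 : ℝ) < 1 / (k : ℝ) ^ 2 := by positivity
    have hev := ((hT i j).eventually_const_lt hpos).and ((hp i j).eventually_const_lt hpos)
    have esq : ∀ (n : ℕ) (u v : ℝ), (√(n : ℝ) * u) ^ 2 / v = n * (u ^ 2 / v) := by
      intro n u v
      rw [mul_pow, Real.sq_sqrt (Nat.cast_nonneg _), mul_div_assoc]
    refine tendsto_of_tendsto_of_tendsto_of_le_of_le' hlo hup ?_ ?_
    · filter_upwards [hev] with x hx
      rw [Pi.div_apply, esq]
      gcongr
      exact le_mul_klFun_div hx.1.le hx.2 (le_max_left _ _) (le_max_right _ _)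
    · filter_upwards [hev] with x hx
      rw [Pi.div_apply, esq]
      gcongr
      exact mul_klFun_div_le (lt_min hx.1 hx.2) (min_le_left _ _) (min_le_right _ _)
  have hsum := tendsto_finsetSum Finset.univ fun i _ =>
    tendsto_finsetSum Finset.univ fun j _ => hterm i j
  simp only [← Finset.mul_sum] at hsum
  refine hsum.congr' ?_
  have hpos : (0 : ℝ) < 1 / k := by positivity
  filter_upwards [hN.eventually_ne_atTop 0, eventually_all.2 fun i =>
    (hrow i).eventually_const_lt hpos, eventually_all.2 fun i =>
    (hcol i).eventually_const_lt hpos] with x hx h1 h2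
  rw [tableKL_eq_sum_klFun _ h1 h2 (sum_rowMass_tableFreq _ hx)]

/-- The local limit theorem for tables with nearly uniform margins. -/
theorem tendsto_tableWeight (hk : k ≠ 0) {V : Fin k → Fin k → ℝ}
    (hN : Tendsto (fun x => ∑ i, rowMass (T x) i) l atTop)
    (hrow : ∀ i, Tendsto (fun x => rowMass (tableFreq (T x)) i) l (𝓝 (1 / k)))
    (hcol : ∀ j, Tendsto (fun x => colMass (tableFreq (T x)) j) l (𝓝 (1 / k)))
    (hV : ∀ i j, Tendsto (fun x => √(∑ i, rowMass (T x) i : ℕ) * (tableFreq (T x) i j -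
      rowMass (tableFreq (T x)) i * colMass (tableFreq (T x)) j)) l (𝓝 (V i j))) :
    Tendsto (fun x => √(∑ i, rowMass (T x) i : ℕ) ^ ((k - 1) ^ 2) * tableWeight (T x)) l
      (𝓝 (tableConst k * Real.exp (-((k : ℝ) ^ 2 / 2 * ∑ i, ∑ j, V i j ^ 2)))) := by
  have hk0 : (0 : ℝ) < k := by positivity
  have hNr : Tendsto (fun x => ((∑ i, rowMass (T x) i : ℕ) : ℝ)) l atTop :=
    tendsto_natCast_atTop_atTop.comp hN
  have hsqrt : Tendsto (fun x => √(∑ i, rowMass (T x) i : ℕ)) l atTop :=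
    Real.tendsto_sqrt_atTop.comp hNr
  have hT : ∀ i j, Tendsto (fun x => tableFreq (T x) i j) l (𝓝 (1 / (k : ℝ) ^ 2)) := by
    intro i j
    have h1 := ((hV i j).div_atTop hsqrt).add ((hrow i).mul (hcol j))
    have e : 0 + 1 / (k : ℝ) * (1 / k) = 1 / (k : ℝ) ^ 2 := by field_simp; ring
    rw [e] at h1
    refine h1.congr' ?_
    filter_upwards [hsqrt.eventually_gt_atTop 0] with x hx
    rw [mul_div_cancel_left₀ _ hx.ne']
    ring
  have h1 := tendsto_sqrt_pow_mul_tableStirling hk hN hrow hcol hT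
  have h2 := (Real.continuous_exp.tendsto _).comp (tendsto_mul_tableKL hk hN hrow hcol hT hV).neg
  refine (h1.mul h2).congr' ?_
  filter_upwards [hN.eventually_ne_atTop 0] with x hx
  rw [tableWeight_eq _ hx, mul_assoc]
  rfl

/-- Powers are dominated by exponentials. -/
lemma pow_mul_exp_neg_le {c : ℝ} (hc : 0 < c) (M : ℕ) {x : ℝ} (hx : 0 ≤ x) :
    x ^ M * Real.exp (-(c * x)) ≤ M.factorial / c ^ M := by
  have h := Real.pow_div_factorial_le_exp (c * x) (by positivity) M
  rw [Real.exp_neg, ← div_eq_mul_inv, div_le_div_iff₀ (Real.exp_pos _) (by positivity)]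
  rw [div_le_iff₀ (by positivity), mul_pow] at h
  linarith

/-- The Gaussian upper bound for the probability of a table with nearly uniform margins. -/
theorem tableWeight_le (hk : 3 ≤ k) {K : ℝ} (hK : K < entropyBound k) :
    ∃ ε > 0, ∃ C > 0, ∀ T : Fin k → Fin k → ℕ, ∑ i, rowMass T i ≠ 0 →
      (∀ i, |rowMass (tableFreq T) i - 1 / k| ≤ ε) →
      (∀ j, |colMass (tableFreq T) j - 1 / k| ≤ ε) →
      √(∑ i, rowMass T i : ℕ) ^ ((k - 1) ^ 2) * tableWeight T ≤
        C * Real.exp (-(K * ((∑ i, rowMass T i : ℕ) * tableDev (tableFreq T)))) := by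
  have hk0 : (0 : ℝ) < k := by positivity
  obtain ⟨K₁, hK1, hK2⟩ := exists_between hK
  obtain ⟨ε₁, hε₁, hKL⟩ := tableKL_ge hk hK2
  -- `M` is the power of `√n` in the crude bound for the prefactor, and `c * n` is what the slack
  -- `K₁ - K` gains from a deviation of at least `1 / (4 * k ^ 4)`.
  set M := (k - 1) ^ 2 + 2 * k with hM
  set c := (K₁ - K) / (4 * (k : ℝ) ^ 4) with hc
  have hc0 : 0 < c := by
    apply div_pos (by linarith) (by positivity)
  set C₁ := (Real.exp 1) ^ (2 * k) * (2 * k : ℝ) ^ (k ^ 2) with hC₁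
  set C₂ := (Real.exp 1) ^ (2 * k) * (M.factorial / c ^ M) with hC₂
  refine ⟨min ε₁ (1 / (10 * k)), by positivity, max C₁ C₂, by positivity,
    fun T hT hrow hcol => ?_⟩
  set n : ℕ := ∑ i, rowMass T i with hn
  have hn0 : (0 : ℝ) < n := by positivity
  have hn1 : (1 : ℝ) ≤ n := by exact_mod_cast Nat.one_le_iff_ne_zero.2 hT
  have hs0 : 0 < √(n : ℝ) := Real.sqrt_pos.2 hn0
  have hr0 : ∀ i j, 0 ≤ tableFreq T i j := fun i j => by unfold tableFreq; positivity
  have hkl := hKL (tableFreq T) hr0 (sum_rowMass_tableFreq T hT)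
    (fun i => (hrow i).trans (min_le_left _ _)) (fun i => (hcol i).trans (min_le_left _ _))
  -- Margins of at least `9 / 10` of the uniform value suffice because `(9 / 10) ^ 2 - 1 / 4 ≥ 1 /
  -- 2`: an entry below `1 / (4 * k ^ 2)` then misses the product of its margins by at least `1 / (2
  -- * k ^ 2)`.
  have hρ : ∀ i, 9 / (10 * k) ≤ rowMass (tableFreq T) i := fun i => by
    have h1 := (abs_le.1 ((hrow i).trans (min_le_right _ _))).1
    have : 9 / (10 * (k : ℝ)) = 1 / k - 1 / (10 * k) := by field_simp; norm_num
    linarith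
  have hρ' : ∀ i, 9 / (10 * k) ≤ colMass (tableFreq T) i := fun i => by
    have h1 := (abs_le.1 ((hcol i).trans (min_le_right _ _))).1
    have : 9 / (10 * (k : ℝ)) = 1 / k - 1 / (10 * k) := by field_simp; norm_num
    linarith
  have hfac : ∀ m : ℕ, m ≤ n → 0 < (m : ℝ) / n → stirlingFactor m / √(n : ℝ) ≤ Real.exp 1 := by
    intro m hmn hm
    have hm0 : m ≠ 0 := by rintro rfl; simp at hm
    rw [div_le_iff₀ hs0]
    refine (stirlingFactor_le hm0).trans ?_
    gcongr
  have hrowfac : ∏ i, stirlingFactor (rowMass T i) / √(n : ℝ) ≤ Real.exp 1 ^ k := by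
    refine (Finset.prod_le_prod (fun i _ => (div_pos (stirlingFactor_pos _) hs0).le)
      fun i _ => hfac (rowMass T i) (Finset.single_le_sum (f := rowMass T) (fun _ _ => Nat.zero_le _)
        (Finset.mem_univ i)) ?_).trans_eq (by simp)
    rw [hn, ← rowMass_tableFreq]
    exact lt_of_lt_of_le (by positivity) (hρ i)
  have hcolfac : ∏ i, stirlingFactor (colMass T i) / √(n : ℝ) ≤ Real.exp 1 ^ k := by
    refine (Finset.prod_le_prod (fun i _ => (div_pos (stirlingFactor_pos _) hs0).le)
      fun i _ => hfac (colMass T i) ?_ ?_).trans_eq (by simp)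
    · rw [hn, sum_rowMass_eq_sum_colMass]
      exact Finset.single_le_sum (f := colMass T) (fun _ _ => Nat.zero_le _) (Finset.mem_univ i)
    · rw [hn, ← colMass_tableFreq]
      exact lt_of_lt_of_le (by positivity) (hρ' i)
  have hnum0 : 0 ≤ ∏ i, stirlingFactor (rowMass T i) / √(n : ℝ) :=
    Finset.prod_nonneg fun i _ => (div_pos (stirlingFactor_pos _) hs0).le
  have hnum : (∏ i, stirlingFactor (rowMass T i) / √(n : ℝ)) *
      ∏ j, stirlingFactor (colMass T j) / √(n : ℝ) ≤ Real.exp 1 ^ (2 * k) := by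
    rw [two_mul, pow_add]
    exact mul_le_mul hrowfac hcolfac
      (Finset.prod_nonneg fun i _ => (div_pos (stirlingFactor_pos _) hs0).le) (by positivity)
  have hnum0' : 0 ≤ (∏ i, stirlingFactor (rowMass T i) / √(n : ℝ)) *
      ∏ j, stirlingFactor (colMass T j) / √(n : ℝ) := mul_nonneg hnum0
    (Finset.prod_nonneg fun i _ => (div_pos (stirlingFactor_pos _) hs0).le)
  have hn_le : 1 ≤ stirlingFactor n / √(n : ℝ) := by
    rw [one_le_div hs0]; exact sqrt_le_stirlingFactor n
  have hdev0 := tableDev_nonneg (tableFreq T)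
  rw [tableWeight_eq T hT, ← mul_assoc]
  -- If all entries are of order `n`, the Stirling factors below are of order `√n` and the prefactor
  -- is bounded. Otherwise the prefactor is only polynomial in `n`, but the deviation is bounded
  -- below and the slack yields `exp (-(c * n))`.
  by_cases hcase : ∀ i j, 1 / (4 * (k : ℝ) ^ 2) ≤ tableFreq T i j
  · have hst : √(n : ℝ) ^ ((k - 1) ^ 2) * tableStirling T ≤ C₁ := by
      rw [sqrt_pow_mul_tableStirling (by omega) T hs0]
      have hT_le : (1 / (2 * k : ℝ)) ^ (k ^ 2) ≤
          ∏ i, ∏ j, stirlingFactor (T i j) / √(n : ℝ) := by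
        have : (1 / (2 * k : ℝ)) ^ (k ^ 2) = ∏ _i : Fin k, ∏ _j : Fin k, (1 / (2 * k : ℝ)) := by
          simp [← pow_mul, sq]
        rw [this]
        refine Finset.prod_le_prod (fun _ _ => by positivity) fun i _ =>
          Finset.prod_le_prod (fun _ _ => by positivity) fun j _ => ?_
        refine le_trans ?_ (div_le_div_of_nonneg_right (sqrt_le_stirlingFactor _) hs0.le)
        rw [← Real.sqrt_div (Nat.cast_nonneg _)]
        apply Real.le_sqrt_of_sq_le
        have h1 := hcase i j
        have e : (1 / (2 * k : ℝ)) ^ 2 = 1 / (4 * (k : ℝ) ^ 2) := by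
          rw [div_pow, mul_pow]; norm_num
        rw [e]
        exact h1
      rw [div_le_iff₀ (by
        apply mul_pos (by linarith)
        exact Finset.prod_pos fun i _ => Finset.prod_pos fun j _ =>
          div_pos (stirlingFactor_pos _) hs0)]
      refine hnum.trans ?_
      have hle : (1 / (2 * k : ℝ)) ^ (k ^ 2) ≤ (stirlingFactor n / √(n : ℝ)) *
          ∏ i, ∏ j, stirlingFactor (T i j) / √(n : ℝ) := by
        refine hT_le.trans ?_
        refine le_mul_of_one_le_left ?_ hn_le
        exact Finset.prod_nonneg fun i _ => Finset.prod_nonneg fun j _ =>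
          (div_pos (stirlingFactor_pos _) hs0).le
      calc Real.exp 1 ^ (2 * k) = C₁ * (1 / (2 * k : ℝ)) ^ (k ^ 2) := by
            rw [hC₁, mul_assoc, ← mul_pow, mul_one_div_cancel (by positivity), one_pow, mul_one]
        _ ≤ _ := by gcongr
    refine mul_le_mul (hst.trans (le_max_left _ _)) ?_ (Real.exp_pos _).le (by positivity)
    apply Real.exp_le_exp.2
    rw [neg_le_neg_iff]
    have h1 : K * tableDev (tableFreq T) ≤ tableKL (tableFreq T) := by nlinarith
    nlinarith
  · push Not at hcase
    obtain ⟨i, j, hij⟩ := hcase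
    have hdev : 1 / (4 * (k : ℝ) ^ 4) ≤ tableDev (tableFreq T) := by
      have hle : (tableFreq T i j - rowMass (tableFreq T) i * colMass (tableFreq T) j) ^ 2 ≤
          tableDev (tableFreq T) := by
        refine le_trans ?_ (Finset.single_le_sum (fun i _ => Finset.sum_nonneg fun j _ =>
          sq_nonneg (tableFreq T i j - rowMass (tableFreq T) i * colMass (tableFreq T) j))
          (Finset.mem_univ i))
        exact Finset.single_le_sum (f := fun j =>
          (tableFreq T i j - rowMass (tableFreq T) i * colMass (tableFreq T) j) ^ 2)
          (fun j _ => sq_nonneg _) (Finset.mem_univ j)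
      refine le_trans ?_ hle
      have h1 : 9 / (10 * (k : ℝ)) * (9 / (10 * k)) ≤
          rowMass (tableFreq T) i * colMass (tableFreq T) j :=
        mul_le_mul (hρ i) (hρ' j) (by positivity) ((by positivity : (0 : ℝ) ≤ _).trans (hρ i))
      have e1 : 9 / (10 * (k : ℝ)) * (9 / (10 * k)) = 81 / 100 * (1 / (k : ℝ) ^ 2) := by
        field_simp; norm_num
      have e2 : 1 / (4 * (k : ℝ) ^ 2) = 1 / 4 * (1 / (k : ℝ) ^ 2) := by field_simp
      have e3 : 1 / (4 * (k : ℝ) ^ 4) = (1 / 2 * (1 / (k : ℝ) ^ 2)) ^ 2 := by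
        field_simp; norm_num
      rw [e1] at h1
      rw [e2] at hij
      rw [e3, ← neg_sub, neg_sq]
      have h3 : (0 : ℝ) < 1 / (k : ℝ) ^ 2 := by positivity
      apply pow_le_pow_left₀ (by positivity)
      nlinarith
    have hst : √(n : ℝ) ^ ((k - 1) ^ 2) * tableStirling T ≤ Real.exp 1 ^ (2 * k) * (n : ℝ) ^ M := by
      have h1 : tableStirling T ≤ (∏ i, stirlingFactor (rowMass T i)) *
          ∏ j, stirlingFactor (colMass T j) := by
        refine div_le_self ?_ ?_
        · exact mul_nonneg (Finset.prod_nonneg fun i _ => (stirlingFactor_pos _).le)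
            (Finset.prod_nonneg fun i _ => (stirlingFactor_pos _).le)
        · have : 1 ≤ ∏ i, ∏ j, stirlingFactor (T i j) := by
            refine Finset.one_le_prod fun i _ => Finset.one_le_prod fun j _ => ?_
            exact one_le_stirlingFactor _
          nlinarith [one_le_stirlingFactor n]
      have h2 : (∏ i, stirlingFactor (rowMass T i)) * ∏ j, stirlingFactor (colMass T j) =
          √(n : ℝ) ^ (2 * k) * ((∏ i, stirlingFactor (rowMass T i) / √(n : ℝ)) *
            ∏ j, stirlingFactor (colMass T j) / √(n : ℝ)) := by
        simp only [Finset.prod_div_distrib, Finset.prod_const, Finset.card_univ, Fintype.card_fin]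
        field_simp
        ring
      calc √(n : ℝ) ^ ((k - 1) ^ 2) * tableStirling T
          ≤ √(n : ℝ) ^ ((k - 1) ^ 2) * (√(n : ℝ) ^ (2 * k) * Real.exp 1 ^ (2 * k)) := by
            rw [h2] at h1
            gcongr
            exact h1.trans (by gcongr)
        _ = Real.exp 1 ^ (2 * k) * √(n : ℝ) ^ M := by rw [hM, pow_add]; ring
        _ ≤ Real.exp 1 ^ (2 * k) * (n : ℝ) ^ M := by
            gcongr
            exact Real.sqrt_le_self_iff.2 (Or.inr hn1)
    have hexp : Real.exp (-(n * tableKL (tableFreq T))) ≤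
        Real.exp (-(c * n)) * Real.exp (-(K * (n * tableDev (tableFreq T)))) := by
      rw [← Real.exp_add]
      apply Real.exp_le_exp.2
      have h1 : c ≤ (K₁ - K) * tableDev (tableFreq T) := by
        rw [hc, div_eq_mul_one_div]
        exact mul_le_mul_of_nonneg_left hdev (by linarith)
      have h2 : c + K * tableDev (tableFreq T) ≤ tableKL (tableFreq T) := by linarith
      nlinarith
    calc _ ≤ (Real.exp 1 ^ (2 * k) * (n : ℝ) ^ M) *
          (Real.exp (-(c * n)) * Real.exp (-(K * (n * tableDev (tableFreq T))))) :=
          mul_le_mul hst hexp (Real.exp_pos _).le (by positivity)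
      _ = Real.exp 1 ^ (2 * k) * ((n : ℝ) ^ M * Real.exp (-(c * n))) *
          Real.exp (-(K * (n * tableDev (tableFreq T)))) := by ring
      _ ≤ C₂ * Real.exp (-(K * (n * tableDev (tableFreq T)))) := by
          refine mul_le_mul_of_nonneg_right ?_ (Real.exp_pos _).le
          exact mul_le_mul_of_nonneg_left (pow_mul_exp_neg_le hc0 M hn0.le) (by positivity)
      _ ≤ _ := by
          gcongr
          exact le_max_right _ _

end Tables

/-! ### Free coordinates on tables with prescribed margins -/

section Fill

variable {r : ℕ} {R : Type*} [AddCommGroup R]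

/-- The table with given margins and given entries outside the last row and column. -/
def fillTable (a b : Fin (r + 1) → R) (z : Fin r → Fin r → R) : Fin (r + 1) → Fin (r + 1) → R :=
  Fin.snoc (α := fun _ => Fin (r + 1) → R)
    (fun i => Fin.snoc (α := fun _ => R) (z i) (a i.castSucc - ∑ j, z i j))
    (fun j => b j - ∑ i : Fin r,
      (Fin.snoc (α := fun _ => R) (z i) (a i.castSucc - ∑ j, z i j) : Fin (r + 1) → R) j)

@[simp]
lemma fillTable_castSucc_castSucc (a b : Fin (r + 1) → R) (z : Fin r → Fin r → R) (i j : Fin r) :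
    fillTable a b z i.castSucc j.castSucc = z i j := by
  simp [fillTable]

lemma fillTable_castSucc_last (a b : Fin (r + 1) → R) (z : Fin r → Fin r → R) (i : Fin r) :
    fillTable a b z i.castSucc (Fin.last r) = a i.castSucc - ∑ j, z i j := by
  simp [fillTable]

lemma fillTable_last (a b : Fin (r + 1) → R) (z : Fin r → Fin r → R) (j : Fin (r + 1)) :
    fillTable a b z (Fin.last r) j = b j - ∑ i : Fin r, fillTable a b z i.castSucc j := by
  simp [fillTable]

lemma colMass_fillTable (a b : Fin (r + 1) → R) (z : Fin r → Fin r → R) (j : Fin (r + 1)) :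
    colMass (fillTable a b z) j = b j := by
  rw [colMass, Fin.sum_univ_castSucc, fillTable_last, add_sub_cancel]

/-- Only the last row needs an argument: it is defined through the column sums, and its own sum is
right because both margins have the same total. -/
lemma rowMass_fillTable {a b : Fin (r + 1) → R} (h : ∑ i, a i = ∑ i, b i)
    (z : Fin r → Fin r → R) (i : Fin (r + 1)) :
    rowMass (fillTable a b z) i = a i := by
  have h1 : ∀ i : Fin r, rowMass (fillTable a b z) i.castSucc = a i.castSucc := by
    intro i
    rw [rowMass, Fin.sum_univ_castSucc, fillTable_castSucc_last]
    simp
  induction i using Fin.lastCases with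
  | cast i => exact h1 i
  | last =>
    have h2 := sum_rowMass_eq_sum_colMass (fillTable a b z)
    simp only [colMass_fillTable] at h2
    rw [Fin.sum_univ_castSucc, ← h, Fin.sum_univ_castSucc] at h2
    simp only [h1] at h2
    exact add_left_cancel h2

lemma fillTable_eq_self (S : Fin (r + 1) → Fin (r + 1) → R) :
    fillTable (rowMass S) (colMass S) (fun i j => S i.castSucc j.castSucc) = S := by
  have h1 : ∀ i : Fin r, fillTable (rowMass S) (colMass S)
      (fun i j => S i.castSucc j.castSucc) i.castSucc = S i.castSucc := by
    intro i
    funext j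
    induction j using Fin.lastCases with
    | cast j => simp
    | last => rw [fillTable_castSucc_last, rowMass, Fin.sum_univ_castSucc]; simp
  funext i
  induction i using Fin.lastCases with
  | cast i => exact h1 i
  | last =>
    funext j
    rw [fillTable_last, colMass, Fin.sum_univ_castSucc]
    simp [h1]

lemma eq_of_fillTable_data_eq {S T : Fin (r + 1) → Fin (r + 1) → R}
    (hrow : rowMass S = rowMass T) (hcol : colMass S = colMass T)
    (h : ∀ i j : Fin r, S i.castSucc j.castSucc = T i.castSucc j.castSucc) : S = T := by
  rw [← fillTable_eq_self S, ← fillTable_eq_self T, hrow, hcol]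
  simp only [h]

end Fill

/-! ### The Gaussian form on tables with vanishing margins -/

section Centred

variable {r : ℕ}

/-- The real table with vanishing margins and given entries outside the last row and column. -/
def centredTable (y : Fin r × Fin r → ℝ) : Fin (r + 1) → Fin (r + 1) → ℝ :=
  fillTable 0 0 fun i j => y (i, j)

lemma continuous_centredTable : Continuous (centredTable : (Fin r × Fin r → ℝ) → _) := by
  have h1 : ∀ (i : Fin r) (j : Fin (r + 1)),
      Continuous fun y : Fin r × Fin r → ℝ => centredTable y i.castSucc j := by
    intro i j
    induction j using Fin.lastCases with
    | cast j => simp only [centredTable, fillTable_castSucc_castSucc]; fun_prop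
    | last => simp only [centredTable, fillTable_castSucc_last]; fun_prop
  refine continuous_pi fun i => continuous_pi fun j => ?_
  induction i using Fin.lastCases with
  | cast i => exact h1 i j
  | last =>
    simp only [centredTable, fillTable_last] at h1 ⊢
    exact continuous_const.sub (continuous_finsetSum _ fun i _ => h1 i j)

lemma eq_centredTable {S : Fin (r + 1) → Fin (r + 1) → ℝ} (hrow : ∀ i, rowMass S i = 0)
    (hcol : ∀ j, colMass S j = 0) : S = centredTable fun p => S p.1.castSucc p.2.castSucc := by
  conv_lhs => rw [← fillTable_eq_self S]
  rw [centredTable, show rowMass S = 0 from funext hrow, show colMass S = 0 from funext hcol]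

lemma centredTable_smul (c : ℝ) (y : Fin r × Fin r → ℝ) :
    centredTable (c • y) = fun i j => c * centredTable y i j := by
  have hrow : ∀ i, rowMass (fun i j => c * centredTable y i j) i = 0 := by
    intro i
    have := rowMass_fillTable (a := (0 : Fin (r + 1) → ℝ)) (b := 0) rfl (fun i j => y (i, j)) i
    simp only [rowMass, ← Finset.mul_sum] at this ⊢
    simp [centredTable, this]
  have hcol : ∀ j, colMass (fun i j => c * centredTable y i j) j = 0 := by
    intro i
    have := colMass_fillTable (0 : Fin (r + 1) → ℝ) 0 (fun i j => y (i, j)) i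
    simp only [colMass, ← Finset.mul_sum] at this ⊢
    simp [centredTable, this]
  rw [eq_centredTable hrow hcol]
  congr 1
  funext p
  simp [centredTable]

/-- The quadratic form of the Gaussian limit of tables. -/
def centredSq (y : Fin r × Fin r → ℝ) : ℝ := ∑ i, ∑ j, centredTable y i j ^ 2

lemma continuous_centredSq : Continuous (centredSq : (Fin r × Fin r → ℝ) → ℝ) := by
  have h : ∀ i j, Continuous fun y : Fin r × Fin r → ℝ => centredTable y i j := fun i j =>
    (continuous_apply j).comp ((continuous_apply i).comp continuous_centredTable)
  unfold centredSq
  exact continuous_finsetSum _ fun i _ => continuous_finsetSum _ fun j _ => (h i j).pow 2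

lemma centredSq_smul (c : ℝ) (y : Fin r × Fin r → ℝ) :
    centredSq (c • y) = c ^ 2 * centredSq y := by
  simp only [centredSq, centredTable_smul, mul_pow, Finset.mul_sum]

/-- The sum of the squares of the entries outside the last row and column is at most the sum of
all squares. -/
lemma sum_sq_castSucc_le (S : Fin (r + 1) → Fin (r + 1) → ℝ) :
    ∑ p : Fin r × Fin r, S p.1.castSucc p.2.castSucc ^ 2 ≤ ∑ i, ∑ j, S i j ^ 2 := by
  rw [Fintype.sum_prod_type, Fin.sum_univ_castSucc]
  have h : ∀ i, ∑ j : Fin r, S i j.castSucc ^ 2 ≤ ∑ j, S i j ^ 2 := by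
    intro i
    rw [Fin.sum_univ_castSucc]
    exact le_add_of_nonneg_right (sq_nonneg _)
  refine (Finset.sum_le_sum fun i _ => h i.castSucc).trans ?_
  exact le_add_of_nonneg_right (Finset.sum_nonneg fun _ _ => sq_nonneg _)

/-- Positive definiteness of the form, from which integrability of the Gaussian follows. -/
lemma sum_sq_le_centredSq (y : Fin r × Fin r → ℝ) : ∑ p, y p ^ 2 ≤ centredSq y := by
  refine le_trans (le_of_eq ?_) (sum_sq_castSucc_le (centredTable y))
  simp [centredTable]

lemma integrable_exp_neg_mul_sum_sq {ι : Type*} [Fintype ι] {c : ℝ} (hc : 0 < c) :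
    MeasureTheory.Integrable fun y : ι → ℝ => Real.exp (-(c * ∑ p, y p ^ 2)) := by
  have := MeasureTheory.Integrable.fintype_prod (μ := fun _ : ι => MeasureTheory.volume)
    (f := fun (_ : ι) (t : ℝ) => Real.exp (-c * t ^ 2)) fun _ => integrable_exp_neg_mul_sq hc
  refine this.congr (Filter.Eventually.of_forall fun y => ?_)
  simp only [← Real.exp_sum, neg_mul, Finset.sum_neg_distrib, Finset.mul_sum]

lemma integrable_exp_neg_mul_centredSq {c : ℝ} (hc : 0 < c) :
    MeasureTheory.Integrable fun y : Fin r × Fin r → ℝ => Real.exp (-(c * centredSq y)) := by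
  refine (integrable_exp_neg_mul_sum_sq hc).mono ?_ (Filter.Eventually.of_forall fun y => ?_)
  · exact (Real.continuous_exp.comp
      (continuous_const.mul continuous_centredSq).neg).aestronglyMeasurable
  · rw [Real.norm_eq_abs, Real.norm_eq_abs, abs_of_pos (Real.exp_pos _),
      abs_of_pos (Real.exp_pos _)]
    apply Real.exp_le_exp.2
    have := sum_sq_le_centredSq y
    gcongr

/-- The Gaussian integral of the limiting quadratic form. -/
noncomputable def gaussIntegral (r : ℕ) (c : ℝ) : ℝ :=
  ∫ y : Fin r × Fin r → ℝ, Real.exp (-(c * centredSq y))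

lemma gaussIntegral_pos {c : ℝ} (hc : 0 < c) : 0 < gaussIntegral r c := by
  unfold gaussIntegral
  rw [MeasureTheory.integral_pos_iff_support_of_nonneg (fun _ => (Real.exp_pos _).le)
    (integrable_exp_neg_mul_centredSq hc)]
  have : (Function.support fun y : Fin r × Fin r → ℝ => Real.exp (-(c * centredSq y))) =
      Set.univ := by
    ext y; simp [(Real.exp_pos _).ne']
  rw [this]
  exact MeasureTheory.Measure.measure_univ_pos.2 (NeZero.ne _)

/-- Scaling by `√t` in dimension `r ^ 2`. Apart from positivity this is all that is needed: the
value of the integral cancels in the quotient of the moments. -/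
lemma gaussIntegral_mul {c t : ℝ} (ht : 0 < t) :
    gaussIntegral r (t * c) = gaussIntegral r c / √t ^ (r ^ 2) := by
  have h := MeasureTheory.Measure.integral_comp_smul
    (MeasureTheory.volume : MeasureTheory.Measure (Fin r × Fin r → ℝ))
    (fun y => Real.exp (-(c * centredSq y))) (√t)
  have e : ∀ y : Fin r × Fin r → ℝ, c * (√t ^ 2 * centredSq y) = t * c * centredSq y := by
    intro y
    rw [Real.sq_sqrt ht.le]; ring
  simp only [centredSq_smul, e] at h
  rw [gaussIntegral, h, gaussIntegral]
  simp only [Module.finrank_fintype_fun_eq_card, Fintype.card_prod, Fintype.card_fin, smul_eq_mul]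
  rw [abs_of_pos (by positivity), sq, inv_mul_eq_div]

end Centred

/-! ### Sums over tables as integrals of step functions -/

section Riemann

variable {r : ℕ}

/-- The tables of counts with given margins. -/
def marginTables {k : ℕ} (a b : Fin k → ℕ) : Finset (Fin k → Fin k → ℕ) :=
  (Fintype.piFinset fun i => Fintype.piFinset fun _ => Finset.range (a i + 1)).filter
    fun T => rowMass T = a ∧ colMass T = b

/-- No entry exceeds its row sum, so the range in the definition only serves to make the set finite.
-/
lemma mem_marginTables {k : ℕ} {a b : Fin k → ℕ} {T : Fin k → Fin k → ℕ} :
    T ∈ marginTables a b ↔ rowMass T = a ∧ colMass T = b := by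
  simp only [marginTables, Finset.mem_filter, and_iff_right_iff_imp, Fintype.mem_piFinset,
    Finset.mem_range, Nat.lt_succ_iff]
  rintro ⟨rfl, -⟩ i j
  exact Finset.single_le_sum (f := fun j => T i j) (fun _ _ => Nat.zero_le _) (Finset.mem_univ j)

/-- The expected entry of a table with given margins. -/
noncomputable def expectedEntry {k : ℕ} (a b : Fin k → ℕ) (i j : Fin k) : ℝ :=
  (a i : ℝ) * b j / (∑ i, a i : ℕ)

/-- The box of the rescaled parameter space that belongs to a table. -/
def tableBox (a b : Fin (r + 1) → ℕ) (T : Fin (r + 1) → Fin (r + 1) → ℕ) :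
    Set (Fin r × Fin r → ℝ) :=
  Set.pi Set.univ fun p => Set.Ico
    ((T p.1.castSucc p.2.castSucc - expectedEntry a b p.1.castSucc p.2.castSucc) /
      √(∑ i, a i : ℕ))
    ((T p.1.castSucc p.2.castSucc + 1 - expectedEntry a b p.1.castSucc p.2.castSucc) /
      √(∑ i, a i : ℕ))

lemma measurableSet_tableBox (a b : Fin (r + 1) → ℕ) (T : Fin (r + 1) → Fin (r + 1) → ℕ) :
    MeasurableSet (tableBox a b T) :=
  MeasurableSet.univ_pi fun _ => measurableSet_Ico

lemma volume_tableBox {a b : Fin (r + 1) → ℕ} (ha : ∑ i, a i ≠ 0)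
    (T : Fin (r + 1) → Fin (r + 1) → ℕ) :
    (MeasureTheory.volume (tableBox a b T)).toReal = (√(∑ i, a i : ℕ) ^ (r ^ 2))⁻¹ := by
  have hs : 0 < √((∑ i, a i : ℕ) : ℝ) := Real.sqrt_pos.2 (by positivity)
  rw [tableBox, Real.volume_pi_Ico_toReal]
  · have : ∀ t e : ℝ, (t + 1 - e) / √((∑ i, a i : ℕ) : ℝ) - (t - e) / √((∑ i, a i : ℕ) : ℝ) =
        (√((∑ i, a i : ℕ) : ℝ))⁻¹ := by
      intro t e; field_simp; ring
    simp only [this, Finset.prod_const, Finset.card_univ, Fintype.card_prod, Fintype.card_fin,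
      inv_pow, sq]
  · intro p
    dsimp only
    gcongr
    linarith

lemma mem_tableBox_iff {a b : Fin (r + 1) → ℕ} (ha : ∑ i, a i ≠ 0)
    {T : Fin (r + 1) → Fin (r + 1) → ℕ} {y : Fin r × Fin r → ℝ} :
    y ∈ tableBox a b T ↔ ∀ i j : Fin r,
      ⌊√(∑ i, a i : ℕ) * y (i, j) + expectedEntry a b i.castSucc j.castSucc⌋ =
        (T i.castSucc j.castSucc : ℤ) := by
  have hs : 0 < √((∑ i, a i : ℕ) : ℝ) := Real.sqrt_pos.2 (by positivity)
  simp only [tableBox, Set.mem_pi, Set.mem_univ, true_imp_iff, Set.mem_Ico, Prod.forall,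
    div_le_iff₀ hs, lt_div_iff₀ hs, Int.floor_eq_iff, Int.cast_natCast]
  refine forall_congr' fun i => forall_congr' fun j => and_congr ?_ ?_
  · rw [sub_le_iff_le_add, mul_comm]
  · rw [lt_sub_iff_add_lt, mul_comm]

/-- Rounding down the rescaled point recovers the free entries, and the margins determine the
others. The passage to `ℤ` provides the subtraction. -/
lemma eq_of_mem_tableBox {a b : Fin (r + 1) → ℕ} (ha : ∑ i, a i ≠ 0)
    {S T : Fin (r + 1) → Fin (r + 1) → ℕ} (hS : S ∈ marginTables a b) (hT : T ∈ marginTables a b)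
    {y : Fin r × Fin r → ℝ} (h1 : y ∈ tableBox a b S) (h2 : y ∈ tableBox a b T) : S = T := by
  rw [mem_tableBox_iff ha] at h1 h2
  rw [mem_marginTables] at hS hT
  have h : (fun i j => (S i j : ℤ)) = fun i j => (T i j : ℤ) := by
    apply eq_of_fillTable_data_eq
    · funext i
      have := congrFun (hS.1.trans hT.1.symm) i
      simp only [rowMass] at this ⊢
      exact_mod_cast this
    · funext i
      have := congrFun (hS.2.trans hT.2.symm) i
      simp only [colMass] at this ⊢
      exact_mod_cast this
    · intro i j
      rw [← h1, ← h2]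
  funext i j
  exact_mod_cast congrFun (congrFun h i) j

/-- The step function whose integral is the sum of a function over the tables with given
margins. -/
noncomputable def tableStep (a b : Fin (r + 1) → ℕ) (G : (Fin (r + 1) → Fin (r + 1) → ℕ) → ℝ)
    (y : Fin r × Fin r → ℝ) : ℝ :=
  ∑ T ∈ marginTables a b, (tableBox a b T).indicator (fun _ => G T) y

lemma tableStep_eq {a b : Fin (r + 1) → ℕ} (ha : ∑ i, a i ≠ 0)
    (G : (Fin (r + 1) → Fin (r + 1) → ℕ) → ℝ) {T : Fin (r + 1) → Fin (r + 1) → ℕ}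
    (hT : T ∈ marginTables a b) {y : Fin r × Fin r → ℝ} (hy : y ∈ tableBox a b T) :
    tableStep a b G y = G T := by
  rw [tableStep, Finset.sum_eq_single_of_mem T hT, Set.indicator_of_mem hy]
  intro S hS hne
  exact Set.indicator_of_notMem (fun h => hne (eq_of_mem_tableBox ha hS hT h hy)) _

lemma tableStep_eq_zero {a b : Fin (r + 1) → ℕ}
    (G : (Fin (r + 1) → Fin (r + 1) → ℕ) → ℝ) {y : Fin r × Fin r → ℝ}
    (hy : ∀ T ∈ marginTables a b, y ∉ tableBox a b T) :
    tableStep a b G y = 0 :=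
  Finset.sum_eq_zero fun T hT => Set.indicator_of_notMem (hy T hT) _

lemma measurable_tableStep (a b : Fin (r + 1) → ℕ) (G : (Fin (r + 1) → Fin (r + 1) → ℕ) → ℝ) :
    Measurable (tableStep a b G) := by
  unfold tableStep
  exact Finset.measurable_fun_sum _ fun T _ =>
    measurable_const.indicator (measurableSet_tableBox a b T)

/-- A box has volume `√n ^ (-r ^ 2)`; the compensating factor is the normalisation of the local
limit theorem with `k = r + 1`. -/
lemma sum_marginTables_eq_integral {a b : Fin (r + 1) → ℕ} (ha : ∑ i, a i ≠ 0)
    (G : (Fin (r + 1) → Fin (r + 1) → ℕ) → ℝ) :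
    ∑ T ∈ marginTables a b, G T =
      ∫ y, tableStep a b (fun T => √(∑ i, a i : ℕ) ^ (r ^ 2) * G T) y := by
  have hs : 0 < √((∑ i, a i : ℕ) : ℝ) := Real.sqrt_pos.2 (by positivity)
  unfold tableStep
  rw [MeasureTheory.integral_finsetSum]
  · refine Finset.sum_congr rfl fun T _ => ?_
    rw [MeasureTheory.integral_indicator (measurableSet_tableBox a b T),
      MeasureTheory.setIntegral_const, MeasureTheory.measureReal_def, volume_tableBox ha]
    rw [smul_eq_mul, inv_mul_cancel_left₀ (by positivity)]
  · intro T _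
    rw [MeasureTheory.integrable_indicator_iff (measurableSet_tableBox a b T)]
    refine MeasureTheory.integrableOn_const ?_
    intro h
    have := volume_tableBox (b := b) ha T
    rw [h, ENNReal.toReal_top] at this
    have : (0 : ℝ) < (√((∑ i, a i : ℕ) : ℝ) ^ (r ^ 2))⁻¹ := by positivity
    linarith

end Riemann

/-! ### The Laplace method -/

section Limit

variable {r : ℕ}

/-- The rescaled deviation of an entry of a table of counts from its expectation. -/
noncomputable def scaledDev {k : ℕ} (T : Fin k → Fin k → ℕ) (i j : Fin k) : ℝ :=
  √(∑ i, rowMass T i : ℕ) * (tableFreq T i j -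
    rowMass (tableFreq T) i * colMass (tableFreq T) j)

lemma sum_scaledDev_sq {k : ℕ} (T : Fin k → Fin k → ℕ) :
    ∑ i, ∑ j, scaledDev T i j ^ 2 = (∑ i, rowMass T i : ℕ) * tableDev (tableFreq T) := by
  simp only [scaledDev, tableDev, mul_pow, Real.sq_sqrt (Nat.cast_nonneg _), Finset.mul_sum]

lemma scaledDev_eq {k : ℕ} {a b : Fin k → ℕ} {T : Fin k → Fin k → ℕ} (hT : T ∈ marginTables a b)
    (ha : ∑ i, a i ≠ 0) (i j : Fin k) :
    scaledDev T i j = (T i j - expectedEntry a b i j) / √(∑ i, a i : ℕ) := by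
  rw [mem_marginTables] at hT
  have hn : (0 : ℝ) < (∑ i, a i : ℕ) := by positivity
  rw [scaledDev, rowMass_tableFreq, colMass_tableFreq, tableFreq, hT.1, hT.2, expectedEntry]
  have hs : 0 < √((∑ i, a i : ℕ) : ℝ) := Real.sqrt_pos.2 hn
  rw [eq_div_iff hs.ne', mul_comm, ← mul_assoc, Real.mul_self_sqrt hn.le]
  field_simp

/-- The Gaussian domination of the entries of a table whose box contains a point. -/
lemma sum_sq_le_of_mem_tableBox {a b : Fin (r + 1) → ℕ} (ha : ∑ i, a i ≠ 0)
    {T : Fin (r + 1) → Fin (r + 1) → ℕ} (hT : T ∈ marginTables a b) {y : Fin r × Fin r → ℝ}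
    (hy : y ∈ tableBox a b T) :
    (∑ p, y p ^ 2) / 2 - r ^ 2 ≤ (∑ i, rowMass T i : ℕ) * tableDev (tableFreq T) := by
  have hn1 : (1 : ℝ) ≤ (∑ i, a i : ℕ) := by exact_mod_cast Nat.one_le_iff_ne_zero.2 ha
  have hs1 : 1 ≤ √((∑ i, a i : ℕ) : ℝ) := Real.one_le_sqrt.2 hn1
  rw [← sum_scaledDev_sq]
  refine le_trans ?_ (sum_sq_castSucc_le (scaledDev T))
  -- The side length `1 / √n` of a box is at most `1`, so `y` exceeds the rescaled deviation `u` by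
  -- at most `1`, and `y ^ 2 ≤ 2 * u ^ 2 + 2 * (y - u) ^ 2`.
  have hp : ∀ p : Fin r × Fin r, y p ^ 2 / 2 - 1 ≤ scaledDev T p.1.castSucc p.2.castSucc ^ 2 := by
    intro p
    have h := Set.mem_pi.1 hy p (Set.mem_univ p)
    rw [scaledDev_eq hT ha]
    set u := ((T p.1.castSucc p.2.castSucc : ℝ) -
      expectedEntry a b p.1.castSucc p.2.castSucc) / √(∑ i, a i : ℕ) with hu
    have h1 : u ≤ y p := h.1
    have h2 : y p < u + 1 / √(∑ i, a i : ℕ) := by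
      have := h.2
      rwa [add_sub_right_comm, add_div] at this
    have h3 : 1 / √((∑ i, a i : ℕ) : ℝ) ≤ 1 := by
      rw [div_le_one (by linarith)]; exact hs1
    nlinarith [sq_nonneg (2 * u - y p)]
  refine le_trans (le_of_eq ?_) (Finset.sum_le_sum fun p _ => hp p)
  rw [Finset.sum_sub_distrib, Finset.sum_div]
  simp [sq]

lemma tendsto_floor_sub_div {ι : Type*} {l : Filter ι} {s e : ι → ℝ} (hs : Tendsto s l atTop)
    (y : ℝ) : Tendsto (fun x => ((⌊s x * y + e x⌋ : ℝ) - e x) / s x) l (𝓝 y) := by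
  have h1 : Tendsto (fun x => y - 1 / s x) l (𝓝 y) := by
    simpa using tendsto_const_nhds.sub (tendsto_const_nhds (x := (1 : ℝ)).div_atTop hs)
  refine tendsto_of_tendsto_of_tendsto_of_le_of_le' h1 tendsto_const_nhds ?_ ?_
  · filter_upwards [hs.eventually_gt_atTop 0] with x hx
    rw [le_div_iff₀ hx, sub_mul, div_mul_cancel₀ _ hx.ne']
    linarith [Int.lt_floor_add_one (s x * y + e x)]
  · filter_upwards [hs.eventually_gt_atTop 0] with x hx
    rw [div_le_iff₀ hx]
    linarith [Int.floor_le (s x * y + e x)]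

variable {ι : Type*} {l : Filter ι} {a b : ι → Fin (r + 1) → ℕ}

/-- Every point of the parameter space eventually lies in the box of a table, and these tables
deviate from the expectation in the direction of the point. -/
lemma exists_table_of_point (hab : ∀ x, ∑ i, a x i = ∑ i, b x i)
    (hN : Tendsto (fun x => ∑ i, a x i) l atTop)
    (ha : ∀ i, Tendsto (fun x => (a x i : ℝ) / (∑ i, a x i : ℕ)) l (𝓝 (1 / ((r : ℝ) + 1))))
    (hb : ∀ i, Tendsto (fun x => (b x i : ℝ) / (∑ i, a x i : ℕ)) l (𝓝 (1 / ((r : ℝ) + 1))))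
    (y : Fin r × Fin r → ℝ) :
    ∃ T : ι → Fin (r + 1) → Fin (r + 1) → ℕ,
      (∀ᶠ x in l, T x ∈ marginTables (a x) (b x) ∧ y ∈ tableBox (a x) (b x) (T x)) ∧
      ∀ i j, Tendsto (fun x => scaledDev (T x) i j) l (𝓝 (centredTable y i j)) := by
  have hNr : Tendsto (fun x => ((∑ i, a x i : ℕ) : ℝ)) l atTop :=
    tendsto_natCast_atTop_atTop.comp hN
  have hs : Tendsto (fun x => √((∑ i, a x i : ℕ) : ℝ)) l atTop :=
    Real.tendsto_sqrt_atTop.comp hNr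
  -- Only the free entries are rounded; the rest is filled in over `ℤ`, where it might be negative.
  -- Every entry is asymptotic to `n / (r + 1) ^ 2`, so `Int.toNat` eventually changes nothing.
  let z : ι → Fin r → Fin r → ℤ := fun x i j =>
    ⌊√(∑ i, a x i : ℕ) * y (i, j) + expectedEntry (a x) (b x) i.castSucc j.castSucc⌋
  let F : ι → Fin (r + 1) → Fin (r + 1) → ℤ := fun x =>
    fillTable (fun i => (a x i : ℤ)) (fun i => (b x i : ℤ)) (z x)
  let y' : ι → Fin r × Fin r → ℝ := fun x p =>
    ((z x p.1 p.2 : ℝ) - expectedEntry (a x) (b x) p.1.castSucc p.2.castSucc) /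
      √(∑ i, a x i : ℕ)
  have hy' : Tendsto y' l (𝓝 y) := by
    rw [tendsto_pi_nhds]
    rintro ⟨i, j⟩
    exact tendsto_floor_sub_div hs (y (i, j))
  have hFrow : ∀ x i, rowMass (F x) i = a x i := fun x i => by
    refine rowMass_fillTable ?_ _ i
    exact_mod_cast hab x
  have hFcol : ∀ x i, colMass (F x) i = b x i := fun x i => colMass_fillTable _ _ _ i
  have hFdev : ∀ᶠ x in l, (fun i j => ((F x i j : ℝ) - expectedEntry (a x) (b x) i j) /
      √(∑ i, a x i : ℕ)) = centredTable (y' x) := by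
    filter_upwards [hN.eventually_ne_atTop 0] with x hx
    have hn : ((∑ i, a x i : ℕ) : ℝ) ≠ 0 := by exact_mod_cast hx
    have hrow : ∀ i, rowMass (fun i j => ((F x i j : ℝ) - expectedEntry (a x) (b x) i j) /
        √(∑ i, a x i : ℕ)) i = 0 := by
      intro i
      have h1 : ∑ j, (F x i j : ℝ) = a x i := by exact_mod_cast hFrow x i
      have h2 : ∑ j, expectedEntry (a x) (b x) i j = a x i := by
        simp only [expectedEntry, ← Finset.sum_div, ← Finset.mul_sum]
        rw [← Nat.cast_sum, ← hab, mul_div_cancel_right₀ _ hn]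
      rw [rowMass, ← Finset.sum_div, Finset.sum_sub_distrib, h1, h2, sub_self, zero_div]
    have hcol : ∀ i, colMass (fun i j => ((F x i j : ℝ) - expectedEntry (a x) (b x) i j) /
        √(∑ i, a x i : ℕ)) i = 0 := by
      intro j
      have h1 : ∑ i, (F x i j : ℝ) = b x j := by exact_mod_cast hFcol x j
      have h2 : ∑ i, expectedEntry (a x) (b x) i j = b x j := by
        simp only [expectedEntry, ← Finset.sum_div, ← Finset.sum_mul]
        rw [← Nat.cast_sum, mul_div_cancel_left₀ _ hn]
      rw [colMass, ← Finset.sum_div, Finset.sum_sub_distrib, h1, h2, sub_self, zero_div]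
    rw [eq_centredTable hrow hcol]
    congr 1
    funext p
    simp [F, y']
  have hcent : Tendsto (fun x => centredTable (y' x)) l (𝓝 (centredTable y)) :=
    (continuous_centredTable.tendsto y).comp hy'
  have hdev : ∀ i j, Tendsto (fun x => ((F x i j : ℝ) - expectedEntry (a x) (b x) i j) /
      √(∑ i, a x i : ℕ)) l (𝓝 (centredTable y i j)) := by
    intro i j
    refine (tendsto_pi_nhds.1 (tendsto_pi_nhds.1 hcent i) j).congr' ?_
    filter_upwards [hFdev] with x hx
    rw [← hx]
  have hpos : ∀ i j, ∀ᶠ x in l, 0 < F x i j := by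
    intro i j
    have h1 := ((hdev i j).div_atTop hs).add ((ha i).mul (hb j))
    have h2 : (0 : ℝ) < 0 + 1 / ((r : ℝ) + 1) * (1 / ((r : ℝ) + 1)) := by positivity
    filter_upwards [h1.eventually_const_lt h2, hN.eventually_ne_atTop 0] with x hx hx0
    have hn : (0 : ℝ) < (∑ i, a x i : ℕ) := by positivity
    have hs0 := Real.mul_self_sqrt hn.le
    rw [div_div, hs0, expectedEntry, div_mul_div_comm, ← div_div, ← add_div] at hx
    rw [div_pos_iff_of_pos_right hn, sub_add_cancel] at hx
    exact_mod_cast hx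
  have hposall : ∀ᶠ x in l, ∀ i j, 0 < F x i j :=
    eventually_all.2 fun i => eventually_all.2 fun j => hpos i j
  have hmem : ∀ᶠ x in l, (fun i j => (F x i j).toNat) ∈ marginTables (a x) (b x) ∧
      y ∈ tableBox (a x) (b x) fun i j => (F x i j).toNat := by
    filter_upwards [hposall, hN.eventually_ne_atTop 0] with x hx hx0
    have hcast : ∀ i j, (((F x i j).toNat : ℕ) : ℤ) = F x i j := fun i j =>
      Int.toNat_of_nonneg (hx i j).le
    rw [mem_marginTables, mem_tableBox_iff hx0]
    refine ⟨⟨?_, ?_⟩, ?_⟩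
    · funext i
      rw [← Nat.cast_inj (R := ℤ), ← hFrow x i, rowMass, rowMass, Nat.cast_sum]
      simp only [hcast]
    · funext i
      rw [← Nat.cast_inj (R := ℤ), ← hFcol x i, colMass, colMass, Nat.cast_sum]
      simp only [hcast]
    · intro i j
      rw [hcast]
      simp [F, z]
  refine ⟨fun x i j => (F x i j).toNat, hmem, fun i j => ?_⟩
  refine (hdev i j).congr' ?_
  filter_upwards [hmem, hposall, hN.eventually_ne_atTop 0] with x hx hx1 hx0
  rw [scaledDev_eq hx.1 hx0]
  have : ((F x i j).toNat : ℝ) = (F x i j : ℝ) := by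
    exact_mod_cast congrArg (Int.cast (R := ℝ)) (Int.toNat_of_nonneg (hx1 i j).le)
  rw [this]

/-- The Laplace method for sums over tables with nearly uniform margins. -/
theorem tendsto_sum_tableWeight_mul [l.IsCountablyGenerated] (hr : 2 ≤ r)
    (hab : ∀ x, ∑ i, a x i = ∑ i, b x i)
    (hN : Tendsto (fun x => ∑ i, a x i) l atTop)
    (ha : ∀ i, Tendsto (fun x => (a x i : ℝ) / (∑ i, a x i : ℕ)) l (𝓝 (1 / ((r : ℝ) + 1))))
    (hb : ∀ i, Tendsto (fun x => (b x i : ℝ) / (∑ i, a x i : ℕ)) l (𝓝 (1 / ((r : ℝ) + 1))))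
    (W : ι → (Fin (r + 1) → Fin (r + 1) → ℕ) → ℝ) {C K w β : ℝ}
    (hK : K < entropyBound (r + 1))
    (hW : ∀ᶠ x in l, ∀ T ∈ marginTables (a x) (b x), 0 ≤ W x T ∧
      W x T ≤ C * Real.exp (K * ((∑ i, rowMass T i : ℕ) * tableDev (tableFreq T))))
    (hlim : ∀ (T : ι → Fin (r + 1) → Fin (r + 1) → ℕ) (V : Fin (r + 1) → Fin (r + 1) → ℝ),
      (∀ᶠ x in l, T x ∈ marginTables (a x) (b x)) →
      (∀ i j, Tendsto (fun x => scaledDev (T x) i j) l (𝓝 (V i j))) →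
      Tendsto (fun x => W x (T x)) l (𝓝 (w * Real.exp (β * ∑ i, ∑ j, V i j ^ 2)))) :
    Tendsto (fun x => ∑ T ∈ marginTables (a x) (b x), tableWeight T * W x T) l
      (𝓝 (tableConst (r + 1) * w * gaussIntegral r (((r + 1 : ℕ) : ℝ) ^ 2 / 2 - β))) := by
  -- The weights decay with exponent `K₁` and `W` grows with exponent at most `K`; the difference
  -- leaves an integrable Gaussian bound.
  obtain ⟨K₁, hK1, hK2⟩ := exists_between hK
  obtain ⟨ε, hε, C₁, hC₁, hbound⟩ := tableWeight_le (k := r + 1) (by omega) hK2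
  have hcast : ((r + 1 : ℕ) : ℝ) = (r : ℝ) + 1 := by push_cast; rfl
  set c := (K₁ - K) with hc
  have hc0 : 0 < c := by linarith
  have hweight0 : ∀ T : Fin (r + 1) → Fin (r + 1) → ℕ, 0 ≤ tableWeight T := fun T => by
    unfold tableWeight; positivity
  have hrowlim : ∀ T : ι → Fin (r + 1) → Fin (r + 1) → ℕ,
      (∀ᶠ x in l, T x ∈ marginTables (a x) (b x)) →
      ∀ i, Tendsto (fun x => rowMass (tableFreq (T x)) i) l (𝓝 (1 / ((r + 1 : ℕ) : ℝ))) := by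
    intro T hT i
    rw [hcast]
    refine (ha i).congr' ?_
    filter_upwards [hT] with x hx
    rw [rowMass_tableFreq, (mem_marginTables.1 hx).1]
  have hcollim : ∀ T : ι → Fin (r + 1) → Fin (r + 1) → ℕ,
      (∀ᶠ x in l, T x ∈ marginTables (a x) (b x)) →
      ∀ i, Tendsto (fun x => colMass (tableFreq (T x)) i) l (𝓝 (1 / ((r + 1 : ℕ) : ℝ))) := by
    intro T hT i
    rw [hcast]
    refine (hb i).congr' ?_
    filter_upwards [hT] with x hx
    rw [colMass_tableFreq, (mem_marginTables.1 hx).1, (mem_marginTables.1 hx).2]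
  have hpoint : ∀ y : Fin r × Fin r → ℝ, Tendsto (fun x => tableStep (a x) (b x)
      (fun T => √(∑ i, a x i : ℕ) ^ (r ^ 2) * (tableWeight T * W x T)) y) l
      (𝓝 (tableConst (r + 1) * w *
        Real.exp (-((((r + 1 : ℕ) : ℝ) ^ 2 / 2 - β) * centredSq y)))) := by
    intro y
    obtain ⟨T, hT, hTlim⟩ := exists_table_of_point hab hN ha hb y
    have hmem := hT.mono fun x hx => hx.1
    have hNT : Tendsto (fun x => ∑ i, rowMass (T x) i) l atTop := by
      refine hN.congr' ?_
      filter_upwards [hmem] with x hx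
      rw [(mem_marginTables.1 hx).1]
    have h1 := tendsto_tableWeight (by omega : r + 1 ≠ 0) hNT (hrowlim T hmem) (hcollim T hmem) hTlim
    have h2 := h1.mul (hlim T _ hmem hTlim)
    have e : tableConst (r + 1) * Real.exp (-(((r + 1 : ℕ) : ℝ) ^ 2 / 2 *
        ∑ i, ∑ j, centredTable y i j ^ 2)) * (w * Real.exp (β * ∑ i, ∑ j, centredTable y i j ^ 2)) =
        tableConst (r + 1) * w *
        Real.exp (-((((r + 1 : ℕ) : ℝ) ^ 2 / 2 - β) * centredSq y)) := by
      rw [centredSq, mul_mul_mul_comm, ← Real.exp_add]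
      congr 2; ring
    rw [e] at h2
    refine h2.congr' ?_
    filter_upwards [hT, hN.eventually_ne_atTop 0] with x hx hx0
    rw [tableStep_eq hx0 _ hx.1 hx.2, (mem_marginTables.1 hx.1).1, Nat.add_sub_cancel, mul_assoc]
  have hdom : ∀ᶠ x in l, ∀ y, ‖tableStep (a x) (b x)
      (fun T => √(∑ i, a x i : ℕ) ^ (r ^ 2) * (tableWeight T * W x T)) y‖ ≤
      C₁ * |C| * Real.exp (c * r ^ 2) * Real.exp (-(c / 2 * ∑ p, y p ^ 2)) := by
    have hcl : ∀ {f : ι → ℝ}, Tendsto f l (𝓝 (1 / ((r : ℝ) + 1))) →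
        ∀ᶠ x in l, |f x - 1 / ((r : ℝ) + 1)| ≤ ε := fun hf =>
      (hf.eventually (Metric.closedBall_mem_nhds _ hε)).mono fun x hx => by
        simpa [Real.dist_eq] using hx
    filter_upwards [hW, hN.eventually_ne_atTop 0, eventually_all.2 fun i => hcl (ha i),
      eventually_all.2 fun i => hcl (hb i)] with x hx hx0 hxa hxb y
    by_cases hy : ∃ T ∈ marginTables (a x) (b x), y ∈ tableBox (a x) (b x) T
    · obtain ⟨T, hT, hyT⟩ := hy
      rw [tableStep_eq hx0 _ hT hyT]
      have hm := mem_marginTables.1 hT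
      obtain ⟨hW0, hW1⟩ := hx T hT
      have hb1 := hbound T (by rw [hm.1]; exact hx0)
        (fun i => by rw [rowMass_tableFreq, hm.1, hcast]; exact hxa i)
        (fun i => by rw [colMass_tableFreq, hm.1, hm.2, hcast]; exact hxb i)
      rw [Nat.add_sub_cancel, hm.1] at hb1
      have hsq := sum_sq_le_of_mem_tableBox hx0 hT hyT
      rw [hm.1] at hsq hW1
      set D := ((∑ i, a x i : ℕ) : ℝ) * tableDev (tableFreq T) with hD
      have hW2 : W x T ≤ |C| * Real.exp (K * D) :=
        hW1.trans (mul_le_mul_of_nonneg_right (le_abs_self C) (Real.exp_pos _).le)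
      rw [Real.norm_eq_abs, abs_of_nonneg (by have := hweight0 T; positivity), ← mul_assoc]
      refine (mul_le_mul hb1 hW2 hW0 (by positivity)).trans ?_
      have e1 : C₁ * Real.exp (-(K₁ * D)) * (|C| * Real.exp (K * D)) =
          C₁ * |C| * Real.exp (-(c * D)) := by
        rw [mul_mul_mul_comm, ← Real.exp_add]; congr 2; rw [hc]; ring
      rw [e1, mul_assoc (C₁ * |C|), ← Real.exp_add]
      gcongr
      nlinarith
    · push Not at hy
      rw [tableStep_eq_zero _ hy, norm_zero]
      positivity
  have hint := MeasureTheory.tendsto_integral_filter_of_dominated_convergence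
    (μ := MeasureTheory.volume) (l := l) (F := fun x y => tableStep (a x) (b x)
      (fun T => √(∑ i, a x i : ℕ) ^ (r ^ 2) * (tableWeight T * W x T)) y)
    (fun y : Fin r × Fin r → ℝ =>
      C₁ * |C| * Real.exp (c * r ^ 2) * Real.exp (-(c / 2 * ∑ p, y p ^ 2)))
    (Eventually.of_forall fun x => (measurable_tableStep _ _ _).aestronglyMeasurable)
    (hdom.mono fun x hx => Eventually.of_forall hx)
    ((integrable_exp_neg_mul_sum_sq (by positivity)).const_mul _)
    (Eventually.of_forall hpoint)
  rw [MeasureTheory.integral_const_mul] at hint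
  refine hint.congr' ?_
  filter_upwards [hN.eventually_ne_atTop 0] with x hx
  rw [sum_marginTables_eq_integral hx]

end Limit

/-! ### Counting pairs of maps by their overlap -/

section Counting

open Classical in
/-- The sizes of the fibres of a map. -/
noncomputable def fibreCard {n : ℕ} {κ : Type*} (f : Fin n → κ) (c : κ) : ℕ :=
  (Finset.univ.filter fun v => f v = c).card

lemma sum_fibreCard {n : ℕ} {κ : Type*} [Fintype κ] (f : Fin n → κ) :
    ∑ c, fibreCard f c = n := by
  classical
  have := Finset.card_eq_sum_card_fiberwise (s := (Finset.univ : Finset (Fin n))) (f := f)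
    (t := Finset.univ) (fun _ _ => Finset.mem_univ _)
  rw [Finset.card_univ, Fintype.card_fin] at this
  refine Eq.trans (Finset.sum_congr rfl fun c _ => ?_) this.symm
  unfold fibreCard
  congr

lemma card_subtype_eq_fibreCard {n : ℕ} {κ : Type*} (f : Fin n → κ) (c : κ)
    [Fintype {v // f v = c}] : Fintype.card {v // f v = c} = fibreCard f c := by
  classical
  rw [Fintype.card_subtype]
  unfold fibreCard
  congr

open Classical in
/-- The number of maps with given fibre sizes is a multinomial coefficient. -/
theorem card_fibreCard_eq_mul {n : ℕ} {κ : Type*} [Fintype κ] (T : κ → ℕ)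
    (hT : ∑ c, T c = n) :
    (Finset.univ.filter fun f : Fin n → κ => fibreCard f = T).card * ∏ c, (T c).factorial =
      n.factorial := by
  obtain ⟨e⟩ : Nonempty (Fin n ≃ Σ c, Fin (T c)) := by
    apply Fintype.card_eq.1
    simp [hT]
  set f₀ : Fin n → κ := fun v => (e v).1 with hf₀
  have h0 : fibreCard f₀ = T := by
    funext c
    rw [← card_subtype_eq_fibreCard]
    have e1 : {v // f₀ v = c} ≃ {x : Σ c, Fin (T c) // x.1 = c} :=
      e.subtypeEquiv fun v => by simp [hf₀]
    have e2 : {x : Σ c, Fin (T c) // x.1 = c} ≃ Fin (T c) := Equiv.sigmaSubtype c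
    rw [Fintype.card_congr (e1.trans e2), Fintype.card_fin]
  have hmaps : ∀ g : Equiv.Perm (Fin n), fibreCard (f₀ ∘ g) = T := by
    intro g
    rw [← h0]
    funext c
    rw [← card_subtype_eq_fibreCard, ← card_subtype_eq_fibreCard]
    exact Fintype.card_congr (g.subtypeEquiv fun v => Iff.rfl)
  -- Orbit and stabiliser: permutations act transitively on the maps with fibre sizes `T`, and each
  -- fibre of `g ↦ f₀ ∘ g` is a translate of the stabiliser of `f₀`, of order `∏ c, (T c)!`.
  have hcount := Finset.card_eq_sum_card_fiberwise
    (s := (Finset.univ : Finset (Equiv.Perm (Fin n)))) (f := fun g : Equiv.Perm (Fin n) => f₀ ∘ g)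
    (t := Finset.univ.filter fun f : Fin n → κ => fibreCard f = T)
    (fun g _ => by simpa using hmaps g)
  rw [Finset.card_univ, Fintype.card_perm, Fintype.card_fin] at hcount
  rw [hcount, ← smul_eq_mul, ← Finset.sum_const]
  refine Finset.sum_congr rfl fun f hf => ?_
  have hfT : fibreCard f = T := by simpa using hf
  have hfib : ∀ c, Nonempty ({v // f v = c} ≃ {v // f₀ v = c}) := fun c => by
    apply Fintype.card_eq.1
    rw [card_subtype_eq_fibreCard, card_subtype_eq_fibreCard, hfT, h0]
  let g₀ : Equiv.Perm (Fin n) := Equiv.ofFiberEquiv fun c => (hfib c).some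
  have hg₀ : f₀ ∘ g₀ = f := funext fun v => Equiv.ofFiberEquiv_map _ v
  have hst := DomMulAct.stabilizer_card f₀
  simp only [card_subtype_eq_fibreCard, h0] at hst
  rw [← hst, ← Fintype.card_subtype]
  refine Fintype.card_congr ((Equiv.mulRight g₀).subtypeEquiv fun g => ?_)
  rw [Equiv.coe_mulRight, Equiv.Perm.coe_mul, ← Function.comp_assoc]
  constructor
  · intro h; rw [h, hg₀]
  · intro h
    have h' : (f₀ ∘ g) ∘ g₀ = f₀ ∘ g₀ := by rw [h, hg₀]
    funext v
    simpa using congrFun h' (g₀.symm v)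

/-- The overlap table of two maps. -/
noncomputable def overlap {n k : ℕ} (σ τ : Fin n → Fin k) (i j : Fin k) : ℕ :=
  fibreCard (fun v => (σ v, τ v)) (i, j)

lemma rowMass_overlap {n k : ℕ} (σ τ : Fin n → Fin k) :
    rowMass (overlap σ τ) = fibreCard σ := by
  funext i
  simp only [rowMass, overlap, fibreCard]
  rw [Finset.card_eq_sum_card_fiberwise (f := τ) (t := Finset.univ)
    (fun _ _ => Finset.mem_univ _)]
  refine Finset.sum_congr rfl fun j _ => ?_
  rw [Finset.filter_filter]
  simp only [Prod.mk.injEq]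
  congr

lemma colMass_overlap {n k : ℕ} (σ τ : Fin n → Fin k) :
    colMass (overlap σ τ) = fibreCard τ := by
  funext j
  simp only [colMass, overlap, fibreCard]
  rw [Finset.card_eq_sum_card_fiberwise (f := σ) (t := Finset.univ)
    (fun _ _ => Finset.mem_univ _)]
  refine Finset.sum_congr rfl fun i _ => ?_
  rw [Finset.filter_filter]
  simp only [Prod.mk.injEq, and_comm]

/-- The sum of a function of the overlap over pairs of maps with given fibre sizes. -/
theorem sum_overlap_eq {n k : ℕ} {a b : Fin k → ℕ} (ha : ∑ i, a i = n)
    (F : (Fin k → Fin k → ℕ) → ℝ) [DecidableEq (Fin k → ℕ)] :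
    ∑ σ : Fin n → Fin k with fibreCard σ = a, ∑ τ : Fin n → Fin k with fibreCard τ = b,
      F (overlap σ τ) =
    (n.factorial : ℝ) ^ 2 / ((∏ i, ((a i).factorial : ℝ)) * ∏ i, ((b i).factorial : ℝ)) *
      ∑ T ∈ marginTables a b, tableWeight T * F T := by
  classical
  rw [← Finset.sum_product', ← Finset.sum_fiberwise_of_maps_to (t := marginTables a b)
    (g := fun p : (Fin n → Fin k) × (Fin n → Fin k) => overlap p.1 p.2), Finset.mul_sum]
  · refine Finset.sum_congr rfl fun T hT => ?_
    have hm := mem_marginTables.1 hT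
    have hTn : ∑ c : Fin k × Fin k, T c.1 c.2 = n := by
      rw [Fintype.sum_prod_type, ← ha, ← hm.1]; rfl
    have hc := card_fibreCard_eq_mul (fun c : Fin k × Fin k => T c.1 c.2) hTn
    -- A pair of maps with overlap `T` is one map to pairs of colours with fibre sizes `T`, so the
    -- multinomial count applies.
    have hcard : (Finset.univ.filter fun f : Fin n → Fin k × Fin k =>
        fibreCard f = fun c => T c.1 c.2).card =
        ((((Finset.univ.filter fun σ : Fin n → Fin k => fibreCard σ = a) ×ˢ
        (Finset.univ.filter fun τ : Fin n → Fin k => fibreCard τ = b)).filter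
          fun p => overlap p.1 p.2 = T)).card := by
      refine Finset.card_bij' (fun f _ => (fun v => (f v).1, fun v => (f v).2))
        (fun p _ v => (p.1 v, p.2 v)) ?_ ?_ ?_ ?_
      · intro f hf
        have hf' : overlap (fun v => (f v).1) (fun v => (f v).2) = T := by
          funext i j
          exact congrFun (by simpa using hf : fibreCard f = fun c => T c.1 c.2) (i, j)
        simp only [Finset.mem_filter, Finset.mem_product, Finset.mem_univ, true_and]
        refine ⟨⟨?_, ?_⟩, hf'⟩
        · rw [← rowMass_overlap _ (fun v => (f v).2), hf', hm.1]
        · rw [← colMass_overlap (fun v => (f v).1), hf', hm.2]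
      · intro p hp
        simp only [Finset.mem_filter, Finset.mem_univ, true_and] at hp ⊢
        funext c
        rw [← hp.2]; rfl
      · intro f _; rfl
      · intro p _; rfl
    rw [Finset.sum_congr rfl (g := fun _ => F T) fun p hp => by
      rw [(Finset.mem_filter.1 hp).2], Finset.sum_const, ← hcard, nsmul_eq_mul, ← mul_assoc]
    congr 1
    rw [Fintype.prod_prod_type] at hc
    have hc' : (((Finset.univ.filter fun f : Fin n → Fin k × Fin k =>
        fibreCard f = fun c => T c.1 c.2).card : ℕ) : ℝ) *
        ∏ i, ∏ j, ((T i j).factorial : ℝ) = n.factorial := by exact_mod_cast hc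
    have hp : 0 < ∏ i, ∏ j, ((T i j).factorial : ℝ) :=
      Finset.prod_pos fun i _ => Finset.prod_pos fun j _ => by positivity
    have hpa : 0 < ∏ i, ((a i).factorial : ℝ) := Finset.prod_pos fun i _ => by positivity
    have hpb : 0 < ∏ i, ((b i).factorial : ℝ) := Finset.prod_pos fun i _ => by positivity
    rw [tableWeight, hm.1, hm.2, ha, eq_div_of_mul_eq hp.ne' hc']
    have : (0 : ℝ) < n.factorial := by positivity
    field_simp
  · intro p hp
    simp only [Finset.mem_product, Finset.mem_filter, Finset.mem_univ, true_and] at hp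
    rw [mem_marginTables, rowMass_overlap, colMass_overlap]
    exact hp

end Counting

/-! ### The moments as sums over maps -/

section Moments

/-- The probability that every edge of the random multigraph lies in a given graph. -/
lemma expectation_all_mem_edgeSet {n m : ℕ} (H : SimpleGraph (Fin n)) [DecidableRel H.Adj]
    [DecidablePred fun G : EdgeSeq n m => ∀ j, (G j : Sym2 (Fin n)) ∈ H.edgeSet] :
    expectation n m (fun G => if ∀ j, (G j : Sym2 (Fin n)) ∈ H.edgeSet then 1 else 0) =
      ((∑ u, ∑ v, if H.Adj u v then (1 : ℝ) else 0) / (n * (n - 1))) ^ m := by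
  classical
  have hdeg := H.sum_degrees_eq_twice_card_edges
  have h1 : (∑ u, ∑ v, if H.Adj u v then (1 : ℝ) else 0) = 2 * (H.edgeFinset.card : ℝ) := by
    have h2 : ∀ u, (∑ v, if H.Adj u v then (1 : ℝ) else 0) = H.degree u := by
      intro u
      rw [Finset.sum_boole, ← SimpleGraph.card_neighborFinset_eq_degree,
        SimpleGraph.neighborFinset_eq_filter]
    rw [Finset.sum_congr rfl fun u _ => h2 u]
    exact_mod_cast hdeg
  have h3 : (Finset.univ.filter fun e : {e : Sym2 (Fin n) // ¬ e.IsDiag} =>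
      (e : Sym2 (Fin n)) ∈ H.edgeSet).card = H.edgeFinset.card := by
    refine Finset.card_bij (fun e _ => (e : Sym2 (Fin n))) ?_ ?_ ?_
    · intro e he
      simpa using he
    · intro e _ e' _ h
      exact Subtype.ext h
    · intro e he
      rw [SimpleGraph.mem_edgeFinset] at he
      exact ⟨⟨e, H.not_isDiag_of_mem_edgeSet he⟩, by simpa using he, rfl⟩
  have h4 : (Finset.univ.filter fun G : EdgeSeq n m =>
      ∀ j, (G j : Sym2 (Fin n)) ∈ H.edgeSet).card = H.edgeFinset.card ^ m := by
    rw [← h3]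
    have : (Finset.univ.filter fun G : EdgeSeq n m =>
        ∀ j, (G j : Sym2 (Fin n)) ∈ H.edgeSet) = Fintype.piFinset fun _ : Fin m =>
        (Finset.univ.filter fun e : {e : Sym2 (Fin n) // ¬ e.IsDiag} =>
          (e : Sym2 (Fin n)) ∈ H.edgeSet) := by
      ext G; simp
    rw [this, Fintype.card_piFinset]
    simp
  have h5 : (Fintype.card (EdgeSeq n m) : ℝ) = ((n * (n - 1) : ℝ) / 2) ^ m := by
    rw [Fintype.card_fun, Fintype.card_fin, Sym2.card_subtype_not_diag, Fintype.card_fin]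
    push_cast
    rw [Nat.cast_choose_two]
  rw [expectation, Fintype.expect_eq_sum_div_card, Finset.sum_boole, h5]
  have h6 : ((Finset.univ.filter fun G : EdgeSeq n m =>
      ∀ j, (G j : Sym2 (Fin n)) ∈ H.edgeSet).card : ℝ) = (H.edgeFinset.card : ℝ) ^ m := by
    exact_mod_cast h4
  rw [h6, h1, ← div_pow]
  congr 1
  rw [div_div_eq_mul_div, mul_comm]

/-- The edges that `σ` allows form the pullback of the complete graph on the colours. Being coloured
by two maps means lying in the intersection of two such graphs, so one count serves both moments. -/
lemma isColouring_iff {n m k : ℕ} (G : EdgeSeq n m) (σ : Fin n → Fin k) :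
    IsColouring G σ ↔
      ∀ j, (G j : Sym2 (Fin n)) ∈ ((⊤ : SimpleGraph (Fin k)).comap σ).edgeSet := by
  constructor
  · intro h j
    induction hG : (G j : Sym2 (Fin n)) using Sym2.ind with
    | _ u v => simpa using h u v ⟨j, hG⟩
  · rintro h u v ⟨j, hj⟩
    have := h j
    rw [hj] at this
    simpa using this

lemma isColouring_and_iff {n m k : ℕ} (G : EdgeSeq n m) (σ τ : Fin n → Fin k) :
    IsColouring G σ ∧ IsColouring G τ ↔
      ∀ j, (G j : Sym2 (Fin n)) ∈ (((⊤ : SimpleGraph (Fin k)).comap σ) ⊓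
        ((⊤ : SimpleGraph (Fin k)).comap τ)).edgeSet := by
  simp only [isColouring_iff, SimpleGraph.edgeSet_inf, Set.mem_inter_iff, forall_and]

lemma sum_sum_ite_eq {n : ℕ} {κ : Type*} [Fintype κ] [DecidableEq κ] (f : Fin n → κ) :
    (∑ u, ∑ v, if f u = f v then (1 : ℝ) else 0) = ∑ c, (fibreCard f c : ℝ) ^ 2 := by
  have h : ∀ u v, (if f u = f v then (1 : ℝ) else 0) =
      ∑ c, (if f u = c then 1 else 0) * (if f v = c then 1 else 0) := by
    intro u v
    simp [eq_comm]
  have h2 : ∀ c, (∑ u, if f u = c then (1 : ℝ) else 0) = fibreCard f c := by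
    intro c
    rw [Finset.sum_boole]
    unfold fibreCard
    congr
  simp only [h]
  rw [Finset.sum_congr rfl fun u _ => Finset.sum_comm, Finset.sum_comm]
  refine Finset.sum_congr rfl fun c _ => ?_
  rw [← Finset.sum_mul_sum, h2, sq]

/-- The probability that a map with given fibre sizes is a colouring. -/
noncomputable def colouringProb {k : ℕ} (n m : ℕ) (a : Fin k → ℕ) : ℝ :=
  (((n : ℝ) ^ 2 - ∑ i, (a i : ℝ) ^ 2) / (n * (n - 1))) ^ m

/-- The probability that two maps with given overlap are both colourings. -/
noncomputable def pairColouringProb {k : ℕ} (n m : ℕ) (T : Fin k → Fin k → ℕ) : ℝ :=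
  (((n : ℝ) ^ 2 - ∑ i, ((rowMass T i : ℕ) : ℝ) ^ 2 - ∑ i, ((colMass T i : ℕ) : ℝ) ^ 2
    + ∑ i, ∑ j, (T i j : ℝ) ^ 2) / (n * (n - 1))) ^ m

open Classical in
lemma expectation_isColouring {n m k : ℕ} (σ : Fin n → Fin k) :
    expectation n m (fun G => if IsColouring G σ then 1 else 0) =
      colouringProb n m (fibreCard σ) := by
  simp only [isColouring_iff]
  rw [expectation_all_mem_edgeSet, colouringProb]
  congr 2
  have h : ∀ u v, (if ((⊤ : SimpleGraph (Fin k)).comap σ).Adj u v then (1 : ℝ) else 0) =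
      1 - if σ u = σ v then 1 else 0 := by
    intro u v
    by_cases h : σ u = σ v <;> simp [h]
  simp only [h, Finset.sum_sub_distrib, sum_sum_ite_eq]
  simp [sq]

-- Inclusion and exclusion over the pairs of vertices that are monochromatic under `σ`, under `τ` or
-- under both; the last are counted by the squares of the overlap entries.
open Classical in
lemma expectation_isColouring_and {n m k : ℕ} (σ τ : Fin n → Fin k) :
    expectation n m (fun G => if IsColouring G σ ∧ IsColouring G τ then 1 else 0) =
      pairColouringProb n m (overlap σ τ) := by
  simp only [isColouring_and_iff]
  rw [expectation_all_mem_edgeSet, pairColouringProb]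
  congr 2
  have h : ∀ u v, (if ((⊤ : SimpleGraph (Fin k)).comap σ ⊓
      (⊤ : SimpleGraph (Fin k)).comap τ).Adj u v then (1 : ℝ) else 0) =
      1 - (if σ u = σ v then 1 else 0) - (if τ u = τ v then 1 else 0) +
        if (σ u, τ u) = (σ v, τ v) then 1 else 0 := by
    intro u v
    by_cases h : σ u = σ v <;> by_cases h' : τ u = τ v <;> simp [h, h']
  simp only [h, Finset.sum_sub_distrib, Finset.sum_add_distrib]
  rw [sum_sum_ite_eq σ, sum_sum_ite_eq τ, sum_sum_ite_eq (fun v => (σ v, τ v)),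
    rowMass_overlap, colMass_overlap, Fintype.sum_prod_type]
  simp [sq, overlap]

open Classical in
/-- The maps whose colour density lies in a cell. -/
noncomputable def cellMaps (k ω ν : ℕ) (s : Fin k → ℤ) (n : ℕ) : Finset (Fin n → Fin k) :=
  Finset.univ.filter fun σ => colourDensity σ ∈ cell k ω ν n s

open Classical in
lemma cellColourings_eq_sum {k ω ν n m : ℕ} (s : Fin k → ℤ) (G : EdgeSeq n m) :
    (cellColourings k ω ν s G : ℝ) =
      ∑ σ ∈ cellMaps k ω ν s n, if IsColouring G σ then 1 else 0 := by
  rw [Finset.sum_boole, cellMaps, Finset.filter_filter, cellColourings]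
  simp only [and_comm]

lemma expectation_sum {n m : ℕ} {ι : Type*} (S : Finset ι) (X : ι → EdgeSeq n m → ℝ) :
    expectation n m (fun G => ∑ i ∈ S, X i G) = ∑ i ∈ S, expectation n m (X i) :=
  Finset.expect_sum_comm _ _ _

theorem firstMoment_eq (k ω ν : ℕ) (s : Fin k → ℤ) (d' : ℝ) (n : ℕ) :
    firstMoment k ω ν s d' n =
      ∑ σ ∈ cellMaps k ω ν s n, colouringProb n (numEdges d' n) (fibreCard σ) := by
  classical
  simp only [firstMoment, cellColourings_eq_sum, expectation_sum, expectation_isColouring]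

theorem secondMoment_eq (k ω ν : ℕ) (s : Fin k → ℤ) (d' : ℝ) (n : ℕ) :
    secondMoment k ω ν s d' n =
      ∑ σ ∈ cellMaps k ω ν s n, ∑ τ ∈ cellMaps k ω ν s n,
        pairColouringProb n (numEdges d' n) (overlap σ τ) := by
  classical
  have h : ∀ G : EdgeSeq n (numEdges d' n), (cellColourings k ω ν s G : ℝ) ^ 2 =
      ∑ σ ∈ cellMaps k ω ν s n, ∑ τ ∈ cellMaps k ω ν s n,
        if IsColouring G σ ∧ IsColouring G τ then 1 else 0 := by
    intro G
    rw [cellColourings_eq_sum, sq, Finset.sum_mul_sum]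
    refine Finset.sum_congr rfl fun σ _ => Finset.sum_congr rfl fun τ _ => ?_
    by_cases h1 : IsColouring G σ <;> by_cases h2 : IsColouring G τ <;> simp [h1, h2]
  simp only [secondMoment, h, expectation_sum, expectation_isColouring_and]

end Moments

/-- The compound interest limit along an arbitrary filter. -/
lemma tendsto_one_add_pow_exp_of_tendsto_mul {ι : Type*} {l : Filter ι} {m : ι → ℕ} {δ : ι → ℝ}
    {B : ℝ} (hm : Tendsto m l atTop) (h : Tendsto (fun x => m x * δ x) l (𝓝 B)) :
    Tendsto (fun x => (1 + δ x) ^ m x) l (𝓝 (Real.exp B)) := by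
  have hmr : Tendsto (fun x => (m x : ℝ)) l atTop := tendsto_natCast_atTop_atTop.comp hm
  have hδ : Tendsto δ l (𝓝 0) := by
    refine (h.div_atTop hmr).congr' ?_
    filter_upwards [hm.eventually_ne_atTop 0] with x hx
    have : (m x : ℝ) ≠ 0 := by exact_mod_cast hx
    field_simp
  have h1 : Tendsto (fun x => 1 + δ x) l (𝓝 1) := by simpa using hδ.const_add 1
  have hpos := h1.eventually_const_lt zero_lt_one
  have hlog : Tendsto (fun x => m x * Real.log (1 + δ x)) l (𝓝 B) := by
    have hlo := h.div h1 one_ne_zero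
    rw [div_one] at hlo
    refine tendsto_of_tendsto_of_tendsto_of_le_of_le' hlo h ?_ ?_
    · filter_upwards [hpos] with x hx
      rw [Pi.div_apply, mul_div_assoc]
      gcongr
      have := Real.one_sub_inv_le_log_of_pos hx
      have e : δ x / (1 + δ x) = 1 - (1 + δ x)⁻¹ := by field_simp; ring
      rw [e]; exact this
    · filter_upwards [hpos] with x hx
      gcongr
      linarith [Real.log_le_sub_one_of_pos hx]
  refine ((Real.continuous_exp.tendsto B).comp hlog).congr' ?_
  filter_upwards [hpos] with x hx
  rw [Function.comp, mul_comm, Real.exp_mul, Real.exp_log hx, Real.rpow_natCast]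

/-! ### The correlation of two colourings -/

section Overlaps

variable {k : ℕ}

/-- The covariance-like term that governs the correlation of two maps being colourings. -/
noncomputable def overlapExcess (r : Fin k → Fin k → ℝ) : ℝ :=
  ∑ i, ∑ j, r i j ^ 2 - (∑ i, rowMass r i ^ 2) * ∑ j, colMass r j ^ 2

/-- The difference between a table and the product of its margins has vanishing margins, so the
margins in the cross term may be shifted by any `u`. With `u = 1 / k` both shifted factors are `O(1
/ √n)`, and the cross term is negligible. -/
lemma overlapExcess_eq (r : Fin k → Fin k → ℝ) (h1 : ∑ i, rowMass r i = 1) (u : ℝ) :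
    overlapExcess r = tableDev r + 2 * ∑ i, ∑ j, (rowMass r i - u) * (colMass r j - u) *
      (r i j - rowMass r i * colMass r j) := by
  have h1' : ∑ j, colMass r j = 1 := by rw [← sum_rowMass_eq_sum_colMass, h1]
  have hrow : ∀ i, ∑ j, (r i j - rowMass r i * colMass r j) = 0 := by
    intro i
    rw [Finset.sum_sub_distrib, ← Finset.mul_sum, h1', mul_one]
    exact sub_self _
  have hcol : ∀ j, ∑ i, (r i j - rowMass r i * colMass r j) = 0 := by
    intro j
    rw [Finset.sum_sub_distrib, ← Finset.sum_mul, h1, one_mul]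
    exact sub_self _
  have e1 : ∑ i, ∑ j, (rowMass r i - u) * (colMass r j - u) *
      (r i j - rowMass r i * colMass r j) =
      ∑ i, ∑ j, rowMass r i * colMass r j * (r i j - rowMass r i * colMass r j) := by
    have e : ∀ i j, (rowMass r i - u) * (colMass r j - u) *
        (r i j - rowMass r i * colMass r j) =
        rowMass r i * colMass r j * (r i j - rowMass r i * colMass r j)
        - (u * rowMass r i - u * u) * (r i j - rowMass r i * colMass r j)
        - (u * colMass r j) * (r i j - rowMass r i * colMass r j) := by
      intro i j; ring
    simp only [e, Finset.sum_sub_distrib]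
    have z1 : ∑ i, ∑ j, (u * rowMass r i - u * u) * (r i j - rowMass r i * colMass r j) = 0 := by
      simp only [← Finset.mul_sum, hrow, mul_zero, Finset.sum_const_zero]
    have z2 : ∑ i, ∑ j, (u * colMass r j) * (r i j - rowMass r i * colMass r j) = 0 := by
      rw [Finset.sum_comm]
      simp only [← Finset.mul_sum, hcol, mul_zero, Finset.sum_const_zero]
    rw [z1, z2]; ring
  rw [e1, overlapExcess, tableDev, Finset.sum_mul_sum]
  simp only [Finset.mul_sum, ← Finset.sum_add_distrib, ← Finset.sum_sub_distrib]
  refine Finset.sum_congr rfl fun i _ => Finset.sum_congr rfl fun j _ => ?_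
  ring

lemma abs_overlapExcess_sub_le (r : Fin k → Fin k → ℝ) (h1 : ∑ i, rowMass r i = 1) {u ε : ℝ}
    (hrow : ∀ i, |rowMass r i - u| ≤ ε) (hcol : ∀ j, |colMass r j - u| ≤ ε) :
    |overlapExcess r - tableDev r| ≤
      2 * ε ^ 2 * ∑ i, ∑ j, |r i j - rowMass r i * colMass r j| := by
  rw [overlapExcess_eq r h1 u, add_sub_cancel_left, abs_mul, abs_two, mul_assoc]
  gcongr
  rw [Finset.mul_sum]
  refine (Finset.abs_sum_le_sum_abs _ _).trans (Finset.sum_le_sum fun i _ => ?_)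
  rw [Finset.mul_sum]
  refine (Finset.abs_sum_le_sum_abs _ _).trans (Finset.sum_le_sum fun j _ => ?_)
  rw [abs_mul, abs_mul, sq]
  gcongr
  · exact (abs_nonneg _).trans (hrow i)
  · exact hrow i
  · exact hcol j

lemma rowMass_add_colMass_sub_le (r : Fin k → Fin k → ℝ) (hr : ∀ i j, 0 ≤ r i j)
    (h1 : ∑ i, rowMass r i = 1) (i j : Fin k) : rowMass r i + colMass r j - r i j ≤ 1 := by
  rw [← h1, ← Finset.add_sum_erase _ _ (Finset.mem_univ i), colMass,
    ← Finset.add_sum_erase _ _ (Finset.mem_univ i)]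
  have : ∑ x ∈ Finset.univ.erase i, r x j ≤ ∑ x ∈ Finset.univ.erase i, rowMass r x :=
    Finset.sum_le_sum fun x _ => Finset.single_le_sum (f := fun j => r x j)
      (fun j _ => hr x j) (Finset.mem_univ j)
  linarith

/-- The expression is the probability that two independent samples from `r` differ in both
coordinates. It keeps the base of the power in `pairRatio` nonnegative for every table, so that it
can be bounded by an exponential. -/
lemma pair_nonneg (r : Fin k → Fin k → ℝ) (hr : ∀ i j, 0 ≤ r i j)
    (h1 : ∑ i, rowMass r i = 1) :
    0 ≤ 1 - ∑ i, rowMass r i ^ 2 - ∑ j, colMass r j ^ 2 + ∑ i, ∑ j, r i j ^ 2 := by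
  have e : 1 - ∑ i, rowMass r i ^ 2 - ∑ j, colMass r j ^ 2 + ∑ i, ∑ j, r i j ^ 2 =
      ∑ i, ∑ j, r i j * (1 - (rowMass r i + colMass r j - r i j)) := by
    have e1 : ∑ i, rowMass r i ^ 2 = ∑ i, ∑ j, r i j * rowMass r i := by
      refine Finset.sum_congr rfl fun i _ => ?_
      rw [← Finset.sum_mul, sq]; rfl
    have e2 : ∑ j, colMass r j ^ 2 = ∑ i, ∑ j, r i j * colMass r j := by
      rw [Finset.sum_comm]
      refine Finset.sum_congr rfl fun i _ => ?_
      rw [← Finset.sum_mul, sq]; rfl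
    have e3 : (1 : ℝ) = ∑ i, ∑ j, r i j := h1.symm
    rw [e1, e2]
    nth_rewrite 1 [e3]
    simp only [← Finset.sum_add_distrib, ← Finset.sum_sub_distrib]
    refine Finset.sum_congr rfl fun i _ => Finset.sum_congr rfl fun j _ => ?_
    ring
  rw [e]
  refine Finset.sum_nonneg fun i _ => Finset.sum_nonneg fun j _ => mul_nonneg (hr i j) ?_
  linarith [rowMass_add_colMass_sub_le r hr h1 i j]

/-- The sum of the squared densities of given class sizes. -/
noncomputable def densitySq (a : Fin k → ℕ) : ℝ := ∑ i, ((a i : ℝ) / (∑ i, a i : ℕ)) ^ 2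

/-- The ratio between the joint probability of two maps being colourings and the product of the
individual probabilities. -/
noncomputable def pairRatio (m : ℕ) (a b : Fin k → ℕ) (T : Fin k → Fin k → ℕ) : ℝ :=
  pairColouringProb (∑ i, a i) m T /
    (colouringProb (∑ i, a i) m a * colouringProb (∑ i, a i) m b)

lemma colouringProb_eq (m : ℕ) {n : ℕ} (hn : 2 ≤ n) (a : Fin k → ℕ) :
    colouringProb n m a =
      ((n : ℝ) / (n - 1) * (1 - ∑ i, ((a i : ℝ) / n) ^ 2)) ^ m := by
  have h1 : (2 : ℝ) ≤ n := by exact_mod_cast hn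
  have h2 : (n : ℝ) - 1 ≠ 0 := by linarith
  have h3 : (n : ℝ) ≠ 0 := by linarith
  rw [colouringProb]
  congr 1
  simp only [div_pow, ← Finset.sum_div]
  field_simp

/-- The base of the joint probability is `(1 - densitySq a) * (1 - densitySq b)` plus the excess, up
to a factor `n / (n - 1)`. That factor occurs once above and twice below, which leaves `1 - 1 / n`.
-/
lemma pairRatio_eq {m : ℕ} {a b : Fin k → ℕ} (hn : 2 ≤ ∑ i, a i) (hab : ∑ i, a i = ∑ i, b i)
    (ha : densitySq a < 1) (hb : densitySq b < 1) {T : Fin k → Fin k → ℕ}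
    (hT : T ∈ marginTables a b) :
    pairRatio m a b T = (1 + -1 / (∑ i, a i : ℕ)) ^ m *
      (1 + overlapExcess (tableFreq T) / ((1 - densitySq a) * (1 - densitySq b))) ^ m := by
  have hm := mem_marginTables.1 hT
  have hS : ∑ i, rowMass (tableFreq T) i ^ 2 = densitySq a := by
    simp only [rowMass_tableFreq, hm.1]; rfl
  have hS' : ∑ i, colMass (tableFreq T) i ^ 2 = densitySq b := by
    simp only [colMass_tableFreq, hm.1, hm.2, hab]; rfl
  have hpa : ∑ i, ((a i : ℝ) / (∑ i, a i : ℕ)) ^ 2 = densitySq a := rfl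
  have hpb : ∑ i, ((b i : ℝ) / (∑ i, a i : ℕ)) ^ 2 = densitySq b := by rw [hab]; rfl
  rw [pairRatio, colouringProb_eq m hn, colouringProb_eq m hn, hpa, hpb, pairColouringProb,
    ← mul_pow, ← mul_pow, ← div_pow, overlapExcess, hS, hS']
  congr 1
  have hR : ∑ i, ∑ j, tableFreq T i j ^ 2 = (∑ i, ∑ j, (T i j : ℝ) ^ 2) / (∑ i, a i : ℕ) ^ 2 := by
    simp only [tableFreq, hm.1, div_pow, ← Finset.sum_div]
  rw [hR, hm.1, hm.2, ← hpa, ← hpb]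
  simp only [div_pow, ← Finset.sum_div]
  rw [← hpa] at ha
  rw [← hpb] at hb
  simp only [div_pow, ← Finset.sum_div] at ha hb
  set n : ℝ := ((∑ i, a i : ℕ) : ℝ) with hnr
  have h1 : (2 : ℝ) ≤ n := by rw [hnr]; exact_mod_cast hn
  have h2 : n - 1 ≠ 0 := by linarith
  have h3 : n ≠ 0 := by linarith
  have h3' : 0 < n ^ 2 := by positivity
  rw [div_lt_one h3'] at ha hb
  have h4 : n ^ 2 - ∑ i, (a i : ℝ) ^ 2 ≠ 0 := by linarith
  have h5 : n ^ 2 - ∑ i, (b i : ℝ) ^ 2 ≠ 0 := by linarith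
  field_simp
  ring

lemma one_add_overlapExcess_nonneg {a b : Fin k → ℕ} (hn : ∑ i, a i ≠ 0)
    (hab : ∑ i, a i = ∑ i, b i)
    (ha : densitySq a < 1) (hb : densitySq b < 1) {T : Fin k → Fin k → ℕ}
    (hT : T ∈ marginTables a b) :
    0 ≤ 1 + overlapExcess (tableFreq T) / ((1 - densitySq a) * (1 - densitySq b)) := by
  have hm := mem_marginTables.1 hT
  have hS : ∑ i, rowMass (tableFreq T) i ^ 2 = densitySq a := by
    simp only [rowMass_tableFreq, hm.1]; rfl
  have hS' : ∑ i, colMass (tableFreq T) i ^ 2 = densitySq b := by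
    simp only [colMass_tableFreq, hm.1, hm.2, hab]; rfl
  have h := pair_nonneg (tableFreq T) (fun i j => by unfold tableFreq; positivity)
    (sum_rowMass_tableFreq T (by rw [hm.1]; exact hn))
  have hpos : 0 < (1 - densitySq a) * (1 - densitySq b) :=
    mul_pos (by linarith) (by linarith)
  rw [hS, hS'] at h
  rw [overlapExcess, hS, hS', one_add_div hpos.ne']
  apply div_nonneg _ hpos.le
  linarith

end Overlaps

/-! ### Limit and domination of the correlation ratio -/

section Limits

variable {r : ℕ} {ι : Type*} {l : Filter ι} {a b : ι → Fin (r + 1) → ℕ} {m : ι → ℕ} {ω d : ℝ}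

lemma tendsto_density (hN : Tendsto (fun x => ∑ i, a x i) l atTop) {c : ι → Fin (r + 1) → ℕ}
    (hc : ∀ x i, |(c x i : ℝ) / (∑ i, a x i : ℕ) - 1 / (r + 1)| ≤ ω / √(∑ i, a x i : ℕ))
    (i : Fin (r + 1)) :
    Tendsto (fun x => (c x i : ℝ) / (∑ i, a x i : ℕ)) l (𝓝 (1 / ((r : ℝ) + 1))) := by
  have hs : Tendsto (fun x => √((∑ i, a x i : ℕ) : ℝ)) l atTop :=
    Real.tendsto_sqrt_atTop.comp (tendsto_natCast_atTop_atTop.comp hN)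
  rw [tendsto_iff_norm_sub_tendsto_zero]
  exact squeeze_zero (fun _ => norm_nonneg _) (fun x => hc x i) (tendsto_const_nhds.div_atTop hs)

lemma tendsto_densitySq {N : ι → ℕ} {c : ι → Fin (r + 1) → ℕ} (hN : ∀ x, ∑ i, c x i = N x)
    (hc : ∀ i, Tendsto (fun x => (c x i : ℝ) / N x) l (𝓝 (1 / ((r : ℝ) + 1)))) :
    Tendsto (fun x => densitySq (c x)) l (𝓝 (1 / ((r : ℝ) + 1))) := by
  have h := tendsto_finsetSum Finset.univ fun i _ => (hc i).pow 2
  simp only [densitySq, hN]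
  convert h using 2
  simp
  field_simp

/-- The growth rate of the correlation of two maps being colourings. -/
noncomputable def overlapRate (r : ℕ) (d : ℝ) : ℝ :=
  d / 2 / ((1 - 1 / ((r : ℝ) + 1)) * (1 - 1 / ((r : ℝ) + 1)))

lemma tendsto_mul_overlapExcess (hN : Tendsto (fun x => ∑ i, a x i) l atTop)
    (ha : ∀ x i, |(a x i : ℝ) / (∑ i, a x i : ℕ) - 1 / (r + 1)| ≤ ω / √(∑ i, a x i : ℕ))
    (hb : ∀ x i, |(b x i : ℝ) / (∑ i, a x i : ℕ) - 1 / (r + 1)| ≤ ω / √(∑ i, a x i : ℕ))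
    {T : ι → Fin (r + 1) → Fin (r + 1) → ℕ} {V : Fin (r + 1) → Fin (r + 1) → ℝ}
    (hT : ∀ᶠ x in l, T x ∈ marginTables (a x) (b x))
    (hV : ∀ i j, Tendsto (fun x => scaledDev (T x) i j) l (𝓝 (V i j))) :
    Tendsto (fun x => ((∑ i, a x i : ℕ) : ℝ) * overlapExcess (tableFreq (T x))) l
      (𝓝 (∑ i, ∑ j, V i j ^ 2)) := by
  have hs : Tendsto (fun x => √((∑ i, a x i : ℕ) : ℝ)) l atTop :=
    Real.tendsto_sqrt_atTop.comp (tendsto_natCast_atTop_atTop.comp hN)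
  have hdev : Tendsto (fun x => ∑ i, ∑ j, scaledDev (T x) i j ^ 2) l
      (𝓝 (∑ i, ∑ j, V i j ^ 2)) :=
    tendsto_finsetSum _ fun i _ => tendsto_finsetSum _ fun j _ => (hV i j).pow 2
  have hsum : Tendsto (fun x => ∑ i, ∑ j, |scaledDev (T x) i j|) l (𝓝 (∑ i, ∑ j, |V i j|)) :=
    tendsto_finsetSum _ fun i _ => tendsto_finsetSum _ fun j _ => (hV i j).abs
  have herr : Tendsto (fun x => 2 * ω ^ 2 * (∑ i, ∑ j, |scaledDev (T x) i j|) /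
      √((∑ i, a x i : ℕ) : ℝ)) l (𝓝 0) := (hsum.const_mul _).div_atTop hs
  have hdiff : Tendsto (fun x => ((∑ i, a x i : ℕ) : ℝ) * overlapExcess (tableFreq (T x)) -
      ∑ i, ∑ j, scaledDev (T x) i j ^ 2) l (𝓝 0) := by
    refine squeeze_zero_norm' ?_ herr
    filter_upwards [hT, hN.eventually_ne_atTop 0] with x hx hx0
    have hm := mem_marginTables.1 hx
    have hn : (0 : ℝ) < (∑ i, a x i : ℕ) := by positivity
    have hs0 := Real.sqrt_pos.2 hn
    have h := abs_overlapExcess_sub_le (tableFreq (T x))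
      (sum_rowMass_tableFreq _ (by rw [hm.1]; exact hx0)) (u := 1 / ((r : ℝ) + 1))
      (ε := ω / √((∑ i, a x i : ℕ) : ℝ))
      (fun i => by rw [rowMass_tableFreq, hm.1]; exact ha x i)
      (fun i => by rw [colMass_tableFreq, hm.1, hm.2]; exact hb x i)
    rw [sum_scaledDev_sq, hm.1, ← mul_sub, Real.norm_eq_abs, abs_mul, abs_of_pos hn]
    refine (mul_le_mul_of_nonneg_left h hn.le).trans_eq ?_
    have e : ∀ i j, |scaledDev (T x) i j| = √((∑ i, a x i : ℕ) : ℝ) * |tableFreq (T x) i j -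
        rowMass (tableFreq (T x)) i * colMass (tableFreq (T x)) j| := by
      intro i j
      rw [scaledDev, hm.1, abs_mul, abs_of_pos hs0]
    simp only [e, ← Finset.mul_sum]
    rw [div_pow, Real.sq_sqrt hn.le]
    field_simp
  simpa using hdiff.add hdev

/-- The limit of the correlation ratio. -/
lemma tendsto_pairRatio (hr : 1 ≤ r) (hd : 0 < d) (hN : Tendsto (fun x => ∑ i, a x i) l atTop)
    (hab : ∀ x, ∑ i, a x i = ∑ i, b x i)
    (ha : ∀ x i, |(a x i : ℝ) / (∑ i, a x i : ℕ) - 1 / (r + 1)| ≤ ω / √(∑ i, a x i : ℕ))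
    (hb : ∀ x i, |(b x i : ℝ) / (∑ i, a x i : ℕ) - 1 / (r + 1)| ≤ ω / √(∑ i, a x i : ℕ))
    (hm : Tendsto (fun x => (m x : ℝ) / (∑ i, a x i : ℕ)) l (𝓝 (d / 2)))
    {T : ι → Fin (r + 1) → Fin (r + 1) → ℕ} {V : Fin (r + 1) → Fin (r + 1) → ℝ}
    (hT : ∀ᶠ x in l, T x ∈ marginTables (a x) (b x))
    (hV : ∀ i j, Tendsto (fun x => scaledDev (T x) i j) l (𝓝 (V i j))) :
    Tendsto (fun x => pairRatio (m x) (a x) (b x) (T x)) l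
      (𝓝 (Real.exp (-(d / 2)) * Real.exp (overlapRate r d * ∑ i, ∑ j, V i j ^ 2))) := by
  have hNr : Tendsto (fun x => ((∑ i, a x i : ℕ) : ℝ)) l atTop :=
    tendsto_natCast_atTop_atTop.comp hN
  have hm_top : Tendsto m l atTop := by
    rw [← tendsto_natCast_atTop_iff (R := ℝ)]
    refine (hm.pos_mul_atTop (by positivity) hNr).congr' ?_
    filter_upwards [hN.eventually_ne_atTop 0] with x hx
    have : ((∑ i, a x i : ℕ) : ℝ) ≠ 0 := by exact_mod_cast hx
    field_simp
  have hSa := tendsto_densitySq (l := l) (N := fun x => ∑ i, a x i) (c := a) (fun x => rfl)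
    (tendsto_density hN ha)
  have hSb := tendsto_densitySq (l := l) (N := fun x => ∑ i, a x i) (c := b)
    (fun x => (hab x).symm) (tendsto_density hN hb)
  have hr0 : (0 : ℝ) < r := by exact_mod_cast hr
  have hlt : 1 / ((r : ℝ) + 1) < 1 := by rw [div_lt_one (by linarith)]; linarith
  have h1 : Tendsto (fun x => (1 + -1 / ((∑ i, a x i : ℕ) : ℝ)) ^ m x) l
      (𝓝 (Real.exp (-(d / 2)))) := by
    apply tendsto_one_add_pow_exp_of_tendsto_mul hm_top
    refine hm.neg.congr fun x => ?_
    ring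
  have h2 : Tendsto (fun x => (1 + overlapExcess (tableFreq (T x)) /
      ((1 - densitySq (a x)) * (1 - densitySq (b x)))) ^ m x) l
      (𝓝 (Real.exp (overlapRate r d * ∑ i, ∑ j, V i j ^ 2))) := by
    apply tendsto_one_add_pow_exp_of_tendsto_mul hm_top
    have := (hm.div ((hSa.const_sub 1).mul (hSb.const_sub 1)) (by
      have : 0 < 1 - 1 / ((r : ℝ) + 1) := by linarith
      positivity)).mul (tendsto_mul_overlapExcess hN ha hb hT hV)
    refine this.congr' ?_
    filter_upwards [hN.eventually_ne_atTop 0] with x hx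
    have : ((∑ i, a x i : ℕ) : ℝ) ≠ 0 := by exact_mod_cast hx
    rw [Pi.div_apply]
    field_simp
  refine (h1.mul h2).congr' ?_
  filter_upwards [hT, hN.eventually_ge_atTop 2, hSa.eventually_lt_const hlt,
    hSb.eventually_lt_const hlt] with x hx hx2 hxa hxb
  rw [pairRatio_eq hx2 (hab x) hxa hxb hx]

/-- The upper bound for the correlation ratio. -/
lemma pairRatio_le (hr : 1 ≤ r) (hN : Tendsto (fun x => ∑ i, a x i) l atTop)
    (hab : ∀ x, ∑ i, a x i = ∑ i, b x i)
    (ha : ∀ x i, |(a x i : ℝ) / (∑ i, a x i : ℕ) - 1 / (r + 1)| ≤ ω / √(∑ i, a x i : ℕ))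
    (hb : ∀ x i, |(b x i : ℝ) / (∑ i, a x i : ℕ) - 1 / (r + 1)| ≤ ω / √(∑ i, a x i : ℕ))
    (hm : Tendsto (fun x => (m x : ℝ) / (∑ i, a x i : ℕ)) l (𝓝 (d / 2)))
    {K : ℝ} (hK : overlapRate r d < K) :
    ∀ᶠ x in l, ∀ T ∈ marginTables (a x) (b x), 0 ≤ pairRatio (m x) (a x) (b x) T ∧
      pairRatio (m x) (a x) (b x) T ≤ Real.exp (K * (2 * ω ^ 2 * (r + 1) ^ 2)) *
        Real.exp (K * ((∑ i, rowMass T i : ℕ) * tableDev (tableFreq T))) := by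
  have hSa := tendsto_densitySq (l := l) (N := fun x => ∑ i, a x i) (c := a) (fun x => rfl)
    (tendsto_density hN ha)
  have hSb := tendsto_densitySq (l := l) (N := fun x => ∑ i, a x i) (c := b)
    (fun x => (hab x).symm) (tendsto_density hN hb)
  have hr0 : (0 : ℝ) < r := by exact_mod_cast hr
  have hlt : 1 / ((r : ℝ) + 1) < 1 := by rw [div_lt_one (by linarith)]; linarith
  have hrate := hm.div ((hSa.const_sub 1).mul (hSb.const_sub 1)) (by
      have : 0 < 1 - 1 / ((r : ℝ) + 1) := by linarith
      positivity)
  filter_upwards [hrate.eventually_lt_const hK, hN.eventually_ge_atTop 2,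
    hSa.eventually_lt_const hlt, hSb.eventually_lt_const hlt] with x hxK hx2 hxa hxb T hT
  have hmT := mem_marginTables.1 hT
  have hx0 : ∑ i, a x i ≠ 0 := by omega
  have hn2 : (2 : ℝ) ≤ (∑ i, a x i : ℕ) := by exact_mod_cast hx2
  have hn : (0 : ℝ) < (∑ i, a x i : ℕ) := by linarith
  have hs0 := Real.sqrt_pos.2 hn
  have hnn := one_add_overlapExcess_nonneg hx0 (hab x) hxa hxb hT
  have hden : 0 < (1 - densitySq (a x)) * (1 - densitySq (b x)) :=
    mul_pos (by linarith) (by linarith)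
  have hinv : 0 ≤ 1 + -1 / ((∑ i, a x i : ℕ) : ℝ) := by
    rw [neg_div, ← sub_eq_add_neg, sub_nonneg, div_le_one hn]; linarith
  have hinv1 : 1 + -1 / ((∑ i, a x i : ℕ) : ℝ) ≤ 1 := by
    rw [neg_div]
    have : 0 < 1 / ((∑ i, a x i : ℕ) : ℝ) := by positivity
    linarith
  rw [pairRatio_eq hx2 (hab x) hxa hxb hT]
  refine ⟨by positivity, ?_⟩
  rw [← Real.exp_add]
  have hT1 := sum_rowMass_tableFreq T (by rw [hmT.1]; exact hx0)
  have hrow0 : ∀ i, 0 ≤ rowMass (tableFreq T) i := fun i => by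
    rw [rowMass_tableFreq]; positivity
  have hcol0 : ∀ i, 0 ≤ colMass (tableFreq T) i := fun i => by
    rw [colMass_tableFreq]; positivity
  -- For arbitrary tables each deviation is only known to be at most `1`. Even so, `n` times the
  -- error is at most `2 * ω ^ 2 * (r + 1) ^ 2`, a constant factor after exponentiation.
  have habs : ∑ i, ∑ j, |tableFreq T i j - rowMass (tableFreq T) i * colMass (tableFreq T) j| ≤
      (r + 1 : ℝ) ^ 2 := by
    have h2 : ∀ i j, |tableFreq T i j - rowMass (tableFreq T) i * colMass (tableFreq T) j| ≤
        1 := by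
      intro i j
      have h0 : 0 ≤ tableFreq T i j := by unfold tableFreq; positivity
      have hr1 : rowMass (tableFreq T) i ≤ 1 := by
        rw [← hT1]
        exact Finset.single_le_sum (f := rowMass (tableFreq T)) (fun i _ => hrow0 i)
          (Finset.mem_univ i)
      have hc1 : colMass (tableFreq T) j ≤ 1 := by
        rw [← hT1, sum_rowMass_eq_sum_colMass]
        exact Finset.single_le_sum (f := colMass (tableFreq T)) (fun i _ => hcol0 i)
          (Finset.mem_univ j)
      have h1 : tableFreq T i j ≤ rowMass (tableFreq T) i :=
        Finset.single_le_sum (f := fun j => tableFreq T i j)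
          (fun j _ => by unfold tableFreq; positivity) (Finset.mem_univ j)
      have h3 := mul_le_one₀ hr1 (hcol0 j) hc1
      have h4 := mul_nonneg (hrow0 i) (hcol0 j)
      rw [abs_le]
      constructor <;> linarith
    refine (Finset.sum_le_sum fun i _ => Finset.sum_le_sum fun j _ => h2 i j).trans_eq ?_
    simp only [Finset.sum_const, Finset.card_univ, Fintype.card_fin, nsmul_eq_mul]
    push_cast
    ring
  have h := abs_overlapExcess_sub_le (tableFreq T) hT1 (u := 1 / ((r : ℝ) + 1))
    (ε := ω / √((∑ i, a x i : ℕ) : ℝ))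
    (fun i => by rw [rowMass_tableFreq, hmT.1]; exact ha x i)
    (fun i => by rw [colMass_tableFreq, hmT.1, hmT.2]; exact hb x i)
  rw [div_pow, Real.sq_sqrt hn.le] at h
  have hE : ((∑ i, a x i : ℕ) : ℝ) * overlapExcess (tableFreq T) ≤
      (∑ i, a x i : ℕ) * tableDev (tableFreq T) + 2 * ω ^ 2 * (r + 1) ^ 2 := by
    have h3 := (abs_le.1 h).2
    have h4 : 2 * (ω ^ 2 / ((∑ i, a x i : ℕ) : ℝ)) * ∑ i, ∑ j, |tableFreq T i j -
        rowMass (tableFreq T) i * colMass (tableFreq T) j| ≤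
        2 * (ω ^ 2 / ((∑ i, a x i : ℕ) : ℝ)) * (r + 1) ^ 2 := by gcongr
    have h5 : overlapExcess (tableFreq T) ≤ tableDev (tableFreq T) +
        2 * (ω ^ 2 / ((∑ i, a x i : ℕ) : ℝ)) * (r + 1) ^ 2 := by linarith
    refine (mul_le_mul_of_nonneg_left h5 hn.le).trans_eq ?_
    field_simp
  have hdev0 := tableDev_nonneg (tableFreq T)
  have hpow : (1 + overlapExcess (tableFreq T) /
      ((1 - densitySq (a x)) * (1 - densitySq (b x)))) ^ m x ≤
      Real.exp (K * (2 * ω ^ 2 * (r + 1) ^ 2) +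
        K * ((∑ i, a x i : ℕ) * tableDev (tableFreq T))) := by
    have h1 := Real.add_one_le_exp (overlapExcess (tableFreq T) /
      ((1 - densitySq (a x)) * (1 - densitySq (b x))))
    rw [add_comm] at h1
    refine (pow_le_pow_left₀ hnn h1 _).trans ?_
    rw [← Real.exp_nat_mul]
    apply Real.exp_le_exp.2
    have e : (m x : ℝ) * (overlapExcess (tableFreq T) /
        ((1 - densitySq (a x)) * (1 - densitySq (b x)))) =
        ((m x : ℝ) / (∑ i, a x i : ℕ) / ((1 - densitySq (a x)) * (1 - densitySq (b x)))) *
        ((∑ i, a x i : ℕ) * overlapExcess (tableFreq T)) := by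
      field_simp
    rw [e]
    have hrate0 : 0 ≤ (m x : ℝ) / (∑ i, a x i : ℕ) /
        ((1 - densitySq (a x)) * (1 - densitySq (b x))) := by positivity
    calc _ ≤ ((m x : ℝ) / (∑ i, a x i : ℕ) / ((1 - densitySq (a x)) * (1 - densitySq (b x)))) *
          ((∑ i, a x i : ℕ) * tableDev (tableFreq T) + 2 * ω ^ 2 * (r + 1) ^ 2) :=
          mul_le_mul_of_nonneg_left hE hrate0
      _ ≤ K * ((∑ i, a x i : ℕ) * tableDev (tableFreq T) + 2 * ω ^ 2 * (r + 1) ^ 2) := by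
          apply mul_le_mul_of_nonneg_right (le_of_lt hxK)
          positivity
      _ = _ := by ring
  rw [hmT.1]
  calc _ ≤ 1 * _ := mul_le_mul (pow_le_one₀ hinv hinv1) hpow (by positivity) zero_le_one
    _ = _ := one_mul _

/-- The limit of the ratio of the moments. -/
noncomputable def momentLimit (r : ℕ) (d : ℝ) : ℝ :=
  Real.exp (-(d / 2)) / √(1 - d / (r : ℝ) ^ 2) ^ (r ^ 2)

/-- The growth rate is the fraction `d / (k - 1) ^ 2` of the Gaussian exponent `k ^ 2 / 2`, where `k
= r + 1`; hence `1 - d / (k - 1) ^ 2` in the limit. -/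
lemma overlapRate_eq {r : ℕ} (hr : r ≠ 0) (d : ℝ) :
    overlapRate r d = d / (r : ℝ) ^ 2 * (((r + 1 : ℕ) : ℝ) ^ 2 / 2) := by
  have : (0 : ℝ) < r := by positivity
  rw [overlapRate]
  have e : 1 - 1 / ((r : ℝ) + 1) = r / (r + 1) := by field_simp; ring
  rw [e]
  push_cast
  field_simp

/-- The ratio of the weighted sums over tables with nearly uniform margins. -/
theorem tendsto_sum_pairRatio_div [l.IsCountablyGenerated] (hr : 2 ≤ r) (hd : 0 < d)
    (hd' : d < 2 * r * Real.log r)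
    (hN : Tendsto (fun x => ∑ i, a x i) l atTop)
    (hab : ∀ x, ∑ i, a x i = ∑ i, b x i)
    (ha : ∀ x i, |(a x i : ℝ) / (∑ i, a x i : ℕ) - 1 / (r + 1)| ≤ ω / √(∑ i, a x i : ℕ))
    (hb : ∀ x i, |(b x i : ℝ) / (∑ i, a x i : ℕ) - 1 / (r + 1)| ≤ ω / √(∑ i, a x i : ℕ))
    (hm : Tendsto (fun x => (m x : ℝ) / (∑ i, a x i : ℕ)) l (𝓝 (d / 2))) :
    (∀ᶠ x in l, 0 < ∑ T ∈ marginTables (a x) (b x), tableWeight T) ∧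
    Tendsto (fun x => (∑ T ∈ marginTables (a x) (b x), tableWeight T *
        pairRatio (m x) (a x) (b x) T) / ∑ T ∈ marginTables (a x) (b x), tableWeight T) l
      (𝓝 (momentLimit r d)) := by
  have hr0 : (0 : ℝ) < r := by positivity
  have hk2 : (0 : ℝ) < ((r + 1 : ℕ) : ℝ) ^ 2 / 2 := by positivity
  have hrc : ((r + 1 : ℕ) : ℝ) - 1 = r := by push_cast; ring
  have hlogpos : 0 < Real.log r := Real.log_pos (by exact_mod_cast (by omega : 1 < r))
  -- Equivalent to the degree hypothesis, which enters here in full strength.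
  have hrate : overlapRate r d < entropyBound (r + 1) := by
    rw [overlapRate_eq (by omega), entropyBound, hrc]
    have : ((r + 1 : ℕ) : ℝ) ^ 2 * Real.log r / r =
        (2 * r * Real.log r) / (r : ℝ) ^ 2 * (((r + 1 : ℕ) : ℝ) ^ 2 / 2) := by field_simp
    rw [this]
    gcongr
  have hent : 0 < entropyBound (r + 1) := by
    rw [entropyBound, hrc]; positivity
  obtain ⟨K, hK1, hK2⟩ := exists_between hrate
  have hq : 0 < 1 - d / (r : ℝ) ^ 2 := by
    rw [sub_pos, div_lt_one (by positivity)]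
    have := two_mul_log_le hr0
    nlinarith
  have ha' := fun i => tendsto_density hN ha i
  have hb' := fun i => tendsto_density hN hb i
  -- The normalising sum is treated by the same theorem with `W = 1`, so the leading constants
  -- cancel without being evaluated.
  have h1 := tendsto_sum_tableWeight_mul hr hab hN ha' hb' (fun _ _ => 1) (C := 1) (K := 0)
    (w := 1) (β := 0) hent (Eventually.of_forall fun x T _ => by simp)
    (fun T V _ _ => by simpa using tendsto_const_nhds)
  have h2 := tendsto_sum_tableWeight_mul hr hab hN ha' hb'
    (fun x T => pairRatio (m x) (a x) (b x) T) (w := Real.exp (-(d / 2)))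
    hK2 (pairRatio_le (by omega) hN hab ha hb hm hK1)
    (fun T V hT hV => tendsto_pairRatio (by omega) hd hN hab ha hb hm hT hV)
  have hg : 0 < gaussIntegral r (((r + 1 : ℕ) : ℝ) ^ 2 / 2) := gaussIntegral_pos hk2
  have hc := tableConst_pos (k := r + 1) (by omega)
  simp only [mul_one, sub_zero] at h1
  refine ⟨h1.eventually_const_lt (by positivity), ?_⟩
  have h3 := h2.div h1 (by positivity)
  have e : ((r + 1 : ℕ) : ℝ) ^ 2 / 2 - overlapRate r d =
      (1 - d / (r : ℝ) ^ 2) * (((r + 1 : ℕ) : ℝ) ^ 2 / 2) := by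
    rw [overlapRate_eq (by omega)]; ring
  have e2 : tableConst (r + 1) * Real.exp (-(d / 2)) *
      gaussIntegral r (((r + 1 : ℕ) : ℝ) ^ 2 / 2 - overlapRate r d) /
      (tableConst (r + 1) * gaussIntegral r (((r + 1 : ℕ) : ℝ) ^ 2 / 2)) = momentLimit r d := by
    rw [e, gaussIntegral_mul hq, momentLimit]
    field_simp
  rw [e2] at h3
  exact h3

end Limits

/-! ### The average degree and the cycle series -/

section Degree

lemma tendsto_numEdges_div {d' : ℝ} (hd : 0 < d') :
    Tendsto (fun n : ℕ => (numEdges d' n : ℝ) / n) atTop (𝓝 (d' / 2)) := by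
  have h := (tendsto_nat_ceil_mul_div_atTop (R := ℝ) (a := d' / 2) (by positivity)).comp
    tendsto_natCast_atTop_atTop
  refine h.congr fun n => ?_
  simp only [Function.comp, numEdges]
  rw [mul_div_right_comm]

lemma tendsto_avgDegree {d' : ℝ} (hd : 0 < d') : Tendsto (avgDegree d') atTop (𝓝 d') := by
  have h := (tendsto_numEdges_div hd).const_mul 2
  rw [mul_div_cancel₀ d' two_ne_zero] at h
  refine h.congr fun n => ?_
  rw [avgDegree, mul_div_assoc]

/-- The sum of the series of cycle corrections. -/
lemma hasSum_cycle {r : ℕ} (hr : r ≠ 0) {d : ℝ} (hd : |d / (r : ℝ) ^ 2| < 1) :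
    HasSum (fun l : ℕ => cycleLambda d (l + 2) * cycleDelta (r + 1) (l + 2) ^ 2)
      ((r : ℝ) ^ 2 / 2 * (-Real.log (1 - d / (r : ℝ) ^ 2) - d / (r : ℝ) ^ 2)) := by
  have hr' : (r : ℝ) ≠ 0 := by exact_mod_cast hr
  have h := Real.hasSum_pow_div_log_of_abs_lt_one hd
  -- Dropping the first term of the logarithm series makes it start at cycle length `2`.
  rw [← hasSum_nat_add_iff' 1] at h
  have h2 := h.mul_left ((r : ℝ) ^ 2 / 2)
  simp only [Finset.range_one, Finset.sum_singleton, Nat.cast_zero, zero_add, pow_one,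
    div_one] at h2
  refine h2.congr_fun fun l => ?_
  have hl : ((l : ℝ) + 1 + 1) ≠ 0 := by positivity
  rw [cycleLambda, cycleDelta]
  push_cast
  rw [add_sub_cancel_right, div_pow, ← pow_mul, ← pow_mul, mul_comm (l + 2) 2, pow_mul (-1 : ℝ),
    neg_one_sq, one_pow, div_pow, ← pow_mul]
  have hl2 : ((l : ℝ) + 2) ≠ 0 := by positivity
  have e : ((l : ℝ) + 1 + 1) = l + 2 := by ring
  rw [e]
  field_simp
  ring

lemma exp_cycle_eq_momentLimit {r : ℕ} (hr : r ≠ 0) {d : ℝ} (hd : d / (r : ℝ) ^ 2 < 1) :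
    Real.exp ((r : ℝ) ^ 2 / 2 * (-Real.log (1 - d / (r : ℝ) ^ 2) - d / (r : ℝ) ^ 2)) =
      momentLimit r d := by
  have hr' : (r : ℝ) ≠ 0 := by exact_mod_cast hr
  have hq : 0 < 1 - d / (r : ℝ) ^ 2 := by linarith
  have h1 : √(1 - d / (r : ℝ) ^ 2) ^ (r ^ 2) =
      Real.exp ((r : ℝ) ^ 2 / 2 * Real.log (1 - d / (r : ℝ) ^ 2)) := by
    rw [← Real.exp_log (Real.sqrt_pos.2 hq), ← Real.exp_nat_mul, Real.log_sqrt hq.le]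
    push_cast
    congr 1; ring
  rw [momentLimit, h1, ← Real.exp_sub]
  congr 1
  field_simp
  ring

lemma momentLimit_pos {r : ℕ} {d : ℝ} (hd : d / (r : ℝ) ^ 2 < 1) : 0 < momentLimit r d := by
  have : 0 < √(1 - d / (r : ℝ) ^ 2) := Real.sqrt_pos.2 (by linarith)
  unfold momentLimit
  positivity

end Degree

/-! ### Uniformity in the class sizes -/

section Uniform

/-- Class sizes that deviate from balanced ones by at most `ω √n`. -/
def IsBalanced (r ω n : ℕ) (a : Fin (r + 1) → ℕ) : Prop :=
  ∑ i, a i = n ∧ ∀ i, |(a i : ℝ) / n - 1 / (r + 1)| ≤ ω / √(n : ℝ)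

variable {r : ℕ} (ω : ℕ) {d' : ℝ}

/-- Balanced class sizes eventually have a positive colouring probability. -/
lemma eventually_colouringProb_pos (hr : 1 ≤ r) :
    ∀ᶠ n in atTop, ∀ m, ∀ a, IsBalanced r ω n a → 0 < colouringProb n m a := by
  -- Convergence along the pullback of `atTop` to the type of all balanced data is convergence as `n
  -- → ∞`, uniformly in the class sizes.
  let ι := {x : ℕ × (Fin (r + 1) → ℕ) // IsBalanced r ω x.1 x.2}
  let l : Filter ι := comap (fun x => x.1.1) atTop
  have hN : Tendsto (fun x : ι => ∑ i, x.1.2 i) l atTop :=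
    tendsto_comap.congr fun x => x.2.1.symm
  have hr0 : (0 : ℝ) < r := by exact_mod_cast hr
  have hlt : 1 / ((r : ℝ) + 1) < 1 := by rw [div_lt_one (by linarith)]; linarith
  have hS := tendsto_densitySq (l := l) (N := fun x => ∑ i, x.1.2 i) (c := fun x : ι => x.1.2)
    (fun x => rfl) (tendsto_density (ω := ω) hN fun x i => by rw [x.2.1]; exact x.2.2 i)
  have h := hS.eventually_lt_const hlt
  rw [eventually_comap] at h
  filter_upwards [h, eventually_ge_atTop 2] with n hn hn2 m a ha
  have h1 := hn ⟨(n, a), ha⟩ rfl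
  have hn2' : (2 : ℝ) ≤ n := by exact_mod_cast hn2
  rw [densitySq, ha.1] at h1
  rw [colouringProb_eq m hn2]
  apply pow_pos
  apply mul_pos (div_pos (by linarith) (by linarith))
  linarith

/-- The second moment asymptotics, uniformly over pairs of balanced class sizes. -/
lemma eventually_sum_pairRatio (hr : 2 ≤ r) (hd : 0 < d') (hd' : d' < 2 * r * Real.log r) {ε : ℝ}
    (hε : 0 < ε) :
    ∀ᶠ n in atTop, ∀ a b, IsBalanced r ω n a → IsBalanced r ω n b →
      |∑ T ∈ marginTables a b, tableWeight T * pairRatio (numEdges d' n) a b T -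
        momentLimit r d' * ∑ T ∈ marginTables a b, tableWeight T| ≤
      ε * ∑ T ∈ marginTables a b, tableWeight T := by
  let ι := {x : ℕ × (Fin (r + 1) → ℕ) × (Fin (r + 1) → ℕ) //
    IsBalanced r ω x.1 x.2.1 ∧ IsBalanced r ω x.1 x.2.2}
  let l : Filter ι := comap (fun x => x.1.1) atTop
  have hfst : Tendsto (fun x : ι => x.1.1) l atTop := tendsto_comap
  have hN : Tendsto (fun x : ι => ∑ i, x.1.2.1 i) l atTop := hfst.congr fun x => x.2.1.1.symm
  obtain ⟨h1, h2⟩ := tendsto_sum_pairRatio_div (l := l) (ω := ω) (a := fun x : ι => x.1.2.1)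
    (b := fun x : ι => x.1.2.2) (m := fun x : ι => numEdges d' x.1.1) hr hd hd' hN
    (fun x => x.2.1.1.trans x.2.2.1.symm)
    (fun x i => by rw [x.2.1.1]; exact x.2.1.2 i) (fun x i => by rw [x.2.1.1]; exact x.2.2.2 i)
    (((tendsto_numEdges_div hd).comp hfst).congr fun x => by rw [x.2.1.1]; rfl)
  have h3 := h1.and (h2.eventually (Metric.closedBall_mem_nhds _ hε))
  rw [eventually_comap] at h3
  filter_upwards [h3] with n hn a b ha hb
  obtain ⟨hpos, hclose⟩ := hn ⟨(n, a, b), ha, hb⟩ rfl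
  dsimp only at hpos hclose
  rw [Real.dist_eq, div_sub' hpos.ne', abs_div, abs_of_pos hpos,
    div_le_iff₀ hpos, mul_comm _ (momentLimit r d')] at hclose
  exact hclose

end Uniform

/-! ### Comparison of the two moments -/

section Assembly

variable {r ω ν : ℕ} {s : Fin (r + 1) → ℤ} {d' : ℝ}

lemma isBalanced_of_mem_cellMaps {n : ℕ} {σ : Fin n → Fin (r + 1)}
    (hσ : σ ∈ cellMaps (r + 1) ω ν s n) : IsBalanced r ω n (fibreCard σ) := by
  classical
  refine ⟨sum_fibreCard σ, fun i => ?_⟩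
  have h := (Finset.mem_filter.1 hσ).2.1.2 i
  have e : colourDensity σ i = (fibreCard σ i : ℝ) / n := by
    unfold colourDensity fibreCard
    congr
  rw [e] at h
  push_cast at h
  rw [abs_le]
  constructor <;> linarith [h.1, h.2]

/-- A cell consists of all maps with certain class sizes, so sums over it split by class sizes. -/
lemma mem_cellMaps_congr {k n : ℕ} {s : Fin k → ℤ} {σ τ : Fin n → Fin k}
    (h : fibreCard σ = fibreCard τ) :
    σ ∈ cellMaps k ω ν s n ↔ τ ∈ cellMaps k ω ν s n := by
  classical
  have e : ∀ σ : Fin n → Fin k, colourDensity σ = fun i => (fibreCard σ i : ℝ) / n := by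
    intro σ
    funext i
    unfold colourDensity fibreCard
    congr
  simp only [cellMaps, Finset.mem_filter, Finset.mem_univ, true_and]
  rw [e σ, e τ, h]

open Classical in
lemma sum_cellMaps_eq {k n : ℕ} {s : Fin k → ℤ} (F : (Fin n → Fin k) → ℝ) :
    ∑ σ ∈ cellMaps k ω ν s n, F σ = ∑ a ∈ (cellMaps k ω ν s n).image fibreCard,
      ∑ σ : Fin n → Fin k with fibreCard σ = a, F σ := by
  rw [← Finset.sum_fiberwise_of_maps_to (t := (cellMaps k ω ν s n).image fibreCard)
    (g := fibreCard) fun σ hσ => Finset.mem_image_of_mem _ hσ]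
  refine Finset.sum_congr rfl fun a ha => Finset.sum_congr ?_ fun _ _ => rfl
  obtain ⟨τ, hτ, rfl⟩ := Finset.mem_image.1 ha
  ext σ
  simp only [Finset.mem_filter, Finset.mem_univ, true_and, and_iff_right_iff_imp]
  intro h
  exact (mem_cellMaps_congr h).2 hτ

/-- The second moment is asymptotic to a constant times the square of the first moment. -/
theorem eventually_abs_secondMoment_sub_le (hr : 2 ≤ r) (hd : 0 < d')
    (hd' : d' < 2 * r * Real.log r) {ε : ℝ} (hε : 0 < ε) :
    ∀ᶠ n in atTop, |secondMoment (r + 1) ω ν s d' n -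
      momentLimit r d' * firstMoment (r + 1) ω ν s d' n ^ 2| ≤
        ε * firstMoment (r + 1) ω ν s d' n ^ 2 := by
  classical
  filter_upwards [eventually_sum_pairRatio ω hr hd hd' hε,
    eventually_colouringProb_pos (r := r) ω (by omega)] with n h1 h2
  set A := (cellMaps (r + 1) ω ν s n).image fibreCard with hA
  set m := numEdges d' n with hm
  have hbal : ∀ a ∈ A, IsBalanced r ω n a := by
    intro a ha
    obtain ⟨σ, hσ, rfl⟩ := Finset.mem_image.1 ha
    exact isBalanced_of_mem_cellMaps hσ
  let K : (Fin (r + 1) → ℕ) → (Fin (r + 1) → ℕ) → ℝ := fun a b =>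
    (n.factorial : ℝ) ^ 2 / ((∏ i, ((a i).factorial : ℝ)) * ∏ i, ((b i).factorial : ℝ))
  let P : (Fin (r + 1) → ℕ) → ℝ := colouringProb n m
  have hsecond : secondMoment (r + 1) ω ν s d' n = ∑ a ∈ A, ∑ b ∈ A,
      K a b * (P a * P b) * ∑ T ∈ marginTables a b, tableWeight T * pairRatio m a b T := by
    rw [secondMoment_eq, sum_cellMaps_eq]
    refine Finset.sum_congr rfl fun a ha => ?_
    simp only [sum_cellMaps_eq (ω := ω) (ν := ν) (s := s)]
    rw [Finset.sum_comm]
    refine Finset.sum_congr rfl fun b hb => ?_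
    have hPa := h2 m a (hbal a ha)
    have hPb := h2 m b (hbal b hb)
    rw [sum_overlap_eq (hbal a ha).1 (pairColouringProb n m), mul_assoc]
    congr 1
    rw [Finset.mul_sum]
    refine Finset.sum_congr rfl fun T _ => ?_
    rw [pairRatio, (hbal a ha).1, mul_left_comm, mul_div_cancel₀ _ (mul_pos hPa hPb).ne']
  -- The square of the first moment is also expanded over overlap tables, with a summand constant in
  -- `T`, so the moments can be compared for each pair `(a, b)`.
  have hfirst : firstMoment (r + 1) ω ν s d' n ^ 2 = ∑ a ∈ A, ∑ b ∈ A,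
      K a b * (P a * P b) * ∑ T ∈ marginTables a b, tableWeight T := by
    rw [firstMoment_eq, sq, sum_cellMaps_eq, Finset.sum_mul_sum]
    refine Finset.sum_congr rfl fun a ha => Finset.sum_congr rfl fun b hb => ?_
    have h := sum_overlap_eq (b := b) (hbal a ha).1 (fun _ => P a * P b)
    rw [Finset.sum_mul_sum]
    rw [mul_assoc, Finset.mul_sum]
    refine Eq.trans ?_ (h.trans ?_)
    · refine Finset.sum_congr rfl fun σ hσ => Finset.sum_congr rfl fun τ hτ => ?_
      rw [(Finset.mem_filter.1 hσ).2, (Finset.mem_filter.1 hτ).2]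
    · congr 1
      exact Finset.sum_congr rfl fun T _ => mul_comm _ _
  rw [hsecond, hfirst, Finset.mul_sum, ← Finset.sum_sub_distrib, Finset.mul_sum]
  refine (Finset.abs_sum_le_sum_abs _ _).trans (Finset.sum_le_sum fun a ha => ?_)
  rw [Finset.mul_sum, ← Finset.sum_sub_distrib, Finset.mul_sum]
  refine (Finset.abs_sum_le_sum_abs _ _).trans (Finset.sum_le_sum fun b hb => ?_)
  have hPa : 0 < P a := h2 m a (hbal a ha)
  have hPb : 0 < P b := h2 m b (hbal b hb)
  have hK : 0 ≤ K a b := by positivity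
  rw [mul_left_comm (momentLimit r d'), ← mul_sub, abs_mul, abs_of_nonneg (by positivity),
    mul_left_comm ε]
  exact mul_le_mul_of_nonneg_left (h1 a b (hbal a ha) (hbal b hb)) (by positivity)

theorem tendsto_secondMoment_div (hr : 2 ≤ r) (hd : 0 < d')
    (hd' : d' < 2 * r * Real.log r) :
    Tendsto (fun n => secondMoment (r + 1) ω ν s d' n / firstMoment (r + 1) ω ν s d' n ^ 2)
      (atTop ⊓ 𝓟 {n : ℕ | firstMoment (r + 1) ω ν s d' n ≠ 0}) (𝓝 (momentLimit r d')) := by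
  rw [Metric.tendsto_nhds]
  intro ε hε
  rw [eventually_inf_principal]
  filter_upwards [eventually_abs_secondMoment_sub_le (ω := ω) (ν := ν) (s := s) hr hd hd'
    (half_pos hε)] with n hn hne
  have hpos : 0 < firstMoment (r + 1) ω ν s d' n ^ 2 := by
    have : firstMoment (r + 1) ω ν s d' n ≠ 0 := hne
    positivity
  rw [Real.dist_eq, div_sub' hpos.ne', abs_div, abs_of_pos hpos, div_lt_iff₀ hpos,
    mul_comm _ (momentLimit r d')]
  refine hn.trans_lt ?_
  nlinarith

end Assembly

/-! ### Nonemptiness of the cells -/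

section Positivity

lemma exists_fibreCard_eq {n : ℕ} {κ : Type*} [Fintype κ] (a : κ → ℕ) (ha : ∑ c, a c = n) :
    ∃ f : Fin n → κ, fibreCard f = a := by
  classical
  have h := card_fibreCard_eq_mul a ha
  have hne : (Finset.univ.filter fun f : Fin n → κ => fibreCard f = a).card ≠ 0 := by
    intro h0
    rw [h0, zero_mul] at h
    exact (Nat.factorial_pos n).ne h
  obtain ⟨f, hf⟩ := Finset.card_ne_zero.1 hne
  exact ⟨f, by simpa using hf⟩

/-- Real numbers with an integral sum can be rounded to integers with the same sum. -/
lemma exists_int_round {r : ℕ} (x : Fin (r + 1) → ℝ) {n : ℤ} (hx : ∑ i, x i = n) :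
    ∃ a : Fin (r + 1) → ℤ, ∑ i, a i = n ∧ ∀ i, |(a i : ℝ) - x i| ≤ r + 1 := by
  -- All coordinates but the first are rounded down; the first absorbs the total error, at most `r`.
  refine ⟨Fin.cons (n - ∑ i : Fin r, ⌊x i.succ⌋) fun i => ⌊x i.succ⌋, ?_, ?_⟩
  · rw [Fin.sum_univ_succ]; simp
  · have hr0 : (0 : ℝ) ≤ r := Nat.cast_nonneg r
    intro i
    refine Fin.cases ?_ (fun i => ?_) i
    · simp only [Fin.cons_zero]
      rw [Fin.sum_univ_succ] at hx
      push_cast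
      have e : (n : ℝ) - ∑ i : Fin r, (⌊x i.succ⌋ : ℝ) - x 0 =
          ∑ i : Fin r, (x i.succ - ⌊x i.succ⌋) := by
        rw [Finset.sum_sub_distrib]; linarith
      rw [e, abs_of_nonneg (Finset.sum_nonneg fun i _ => sub_nonneg.2 (Int.floor_le _))]
      have : ∑ i : Fin r, (x i.succ - ⌊x i.succ⌋) ≤ ∑ _i : Fin r, (1 : ℝ) :=
        Finset.sum_le_sum fun i _ => by linarith [Int.lt_floor_add_one (x i.succ)]
      simp at this
      simp
      linarith
    · simp only [Fin.cons_succ]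
      rw [abs_le]
      constructor <;> linarith [Int.lt_floor_add_one (x i.succ), Int.floor_le (x i.succ)]

/-- If the coordinates of the index sum to less than the number of colours, then the cell is
eventually nonempty. -/
lemma eventually_cellMaps_nonempty {r ω ν : ℕ} (hν : 0 < ν) {s : Fin (r + 1) → ℤ}
    (hs : s ∈ cellIndices (r + 1) ω ν) (hsum : |∑ i, s i| < ((r + 1 : ℕ) : ℤ)) :
    ∀ᶠ n in atTop, (cellMaps (r + 1) ω ν s n).Nonempty := by
  classical
  have hν0 : (0 : ℝ) < ν := by exact_mod_cast hν
  have hk : (0 : ℝ) < (r : ℝ) + 1 := by positivity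
  set t : ℝ := ((∑ i, s i : ℤ) : ℝ) / (r + 1) with ht
  have ht1 : |t| < 1 := by
    rw [ht, abs_div, abs_of_pos hk, div_lt_one hk]
    exact_mod_cast hsum
  -- This bound puts the window of the cell inside the window of the balanced densities.
  have hsi : ∀ i, |(s i : ℝ)| ≤ ω * ν - 1 := by
    intro i
    obtain ⟨j, hj1, hj2⟩ := hs
    have h1 : |s i| ≤ ∑ j, |s j| :=
      Finset.single_le_sum (f := fun j => |s j|) (fun j _ => abs_nonneg _) (Finset.mem_univ i)
    rw [hj1] at h1
    have h2 : |(s i : ℝ)| ≤ 2 * j := by exact_mod_cast h1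
    linarith
  have hsqrt : Tendsto (fun n : ℕ => √(n : ℝ)) atTop atTop :=
    Real.tendsto_sqrt_atTop.comp tendsto_natCast_atTop_atTop
  have hc : Tendsto (fun n : ℕ => √(n : ℝ) / ν) atTop atTop := hsqrt.atTop_div_const hν0
  have hev1 : ∀ᶠ n : ℕ in atTop, (r : ℝ) + 1 < (1 - |t|) * (√(n : ℝ) / ν) :=
    (hc.const_mul_atTop (by linarith)).eventually_gt_atTop _
  have hev2 : ∀ᶠ n : ℕ in atTop, (r + 1 : ℝ) * ω ≤ √(n : ℝ) := hsqrt.eventually_ge_atTop _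
  filter_upwards [hev1, hev2, eventually_gt_atTop 0] with n h1 h2 hn
  have hn0 : (0 : ℝ) < n := by exact_mod_cast hn
  have hs0 : 0 < √(n : ℝ) := Real.sqrt_pos.2 hn0
  have hsq : √(n : ℝ) * √(n : ℝ) = n := Real.mul_self_sqrt hn0.le
  set c : ℝ := √(n : ℝ) / ν with hcdef
  have hc0 : 0 < c := by positivity
  -- Subtracting the mean `t` of `s` makes the targets sum to `n`. Since `|t| < 1`, the shift `t *
  -- c` and the rounding error together stay below the half-width `c` of the cell for large `n`.
  obtain ⟨a, ha1, ha2⟩ := exists_int_round (fun i => n / ((r : ℝ) + 1) + (s i - t) * c)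
    (n := (n : ℤ)) (by
      simp only [Finset.sum_add_distrib, ← Finset.sum_mul, Finset.sum_sub_distrib,
        Finset.sum_const, Finset.card_univ, Fintype.card_fin, nsmul_eq_mul]
      rw [ht]
      push_cast
      field_simp
      ring)
  have htc : |t * c| = |t| * c := by rw [abs_mul, abs_of_pos hc0]
  have hb : ∀ i, n / ((r : ℝ) + 1) + (s i - 1) * c ≤ a i ∧
      (a i : ℝ) < n / ((r : ℝ) + 1) + (s i + 1) * c := by
    intro i
    have h3 := abs_le.1 (ha2 i)
    have h4 := abs_le.1 htc.le
    constructor <;> nlinarith [h3.1, h3.2, h4.1, h4.2]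
  have hωc : (ω : ℝ) * √(n : ℝ) = ν * ω * c := by rw [hcdef]; field_simp
  have hlow : ∀ i, n / ((r : ℝ) + 1) - ω * √(n : ℝ) ≤ n / ((r : ℝ) + 1) + (s i - 1) * c := by
    intro i
    have := (abs_le.1 (hsi i)).1
    nlinarith
  have hup : ∀ i, n / ((r : ℝ) + 1) + (s i + 1) * c ≤ n / ((r : ℝ) + 1) + ω * √(n : ℝ) := by
    intro i
    have := (abs_le.1 (hsi i)).2
    nlinarith
  have ha0 : ∀ i, 0 ≤ a i := by
    intro i
    have h3 : (ω : ℝ) * √(n : ℝ) ≤ n / (r + 1) := by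
      rw [le_div_iff₀ hk]; nlinarith
    have : (0 : ℝ) ≤ a i := by linarith [(hb i).1, hlow i]
    exact_mod_cast this
  obtain ⟨σ, hσ⟩ := exists_fibreCard_eq (n := n) (fun i => (a i).toNat) (by
    rw [← Nat.cast_inj (R := ℤ), Nat.cast_sum, ← ha1]
    exact Finset.sum_congr rfl fun i _ => Int.toNat_of_nonneg (ha0 i))
  have hcd : ∀ i, colourDensity σ i = (a i : ℝ) / n := by
    intro i
    have e1 : colourDensity σ i = (fibreCard σ i : ℝ) / n := by
      unfold colourDensity fibreCard
      congr
    rw [e1, hσ]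
    congr 1
    exact_mod_cast congrArg (Int.cast (R := ℝ)) (Int.toNat_of_nonneg (ha0 i))
  have e1 : ∀ u : ℝ, 1 / (((r + 1 : ℕ) : ℝ)) + u / (ν * √(n : ℝ)) =
      (n / ((r : ℝ) + 1) + u * c) / n := by
    intro u
    have key : ∀ q : ℝ, 0 < q → 1 / ((r : ℝ) + 1) + u / (ν * q) =
        (q * q / ((r : ℝ) + 1) + u * (q / ν)) / (q * q) := by
      intro q hq
      field_simp
    have h := key _ hs0
    rw [hsq] at h
    push_cast
    exact h
  refine ⟨σ, Finset.mem_filter.2 ⟨Finset.mem_univ _, ⟨⟨σ, rfl⟩, fun i => ?_⟩, fun i => ?_⟩⟩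
  · have e2 : 1 / (((r + 1 : ℕ) : ℝ)) - ω / √(n : ℝ) =
        (n / ((r : ℝ) + 1) - ω * √(n : ℝ)) / n := by
      have := e1 (-(ν * ω))
      rw [neg_div, mul_div_mul_left _ _ hν0.ne', ← sub_eq_add_neg, neg_mul, ← hωc,
        ← sub_eq_add_neg] at this
      exact this
    have e3 : 1 / (((r + 1 : ℕ) : ℝ)) + ω / √(n : ℝ) =
        (n / ((r : ℝ) + 1) + ω * √(n : ℝ)) / n := by
      have := e1 (ν * ω)
      rw [mul_div_mul_left _ _ hν0.ne', ← hωc] at this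
      exact this
    rw [hcd, e2, e3]
    constructor
    · gcongr
      linarith [hlow i, (hb i).1]
    · gcongr
      linarith [hup i, (hb i).2]
  · have e2 : cellCentre (r + 1) ν n s i - 1 / (ν * √(n : ℝ)) =
        (n / ((r : ℝ) + 1) + (s i - 1) * c) / n := by
      rw [← e1, cellCentre]; ring
    have e3 : cellCentre (r + 1) ν n s i + 1 / (ν * √(n : ℝ)) =
        (n / ((r : ℝ) + 1) + (s i + 1) * c) / n := by
      rw [← e1, cellCentre]; ring
    rw [hcd, e2, e3]
    constructor
    · gcongr
      exact (hb i).1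
    · gcongr
      exact (hb i).2

end Positivity

/-! ### The theorem -/

theorem proposition2p5 (k : ℕ) (hk : 3 ≤ k) (d' : ℝ) (hd'_pos : 0 < d')
    (hd' : d' < 2 * ((k : ℝ) - 1) * Real.log ((k : ℝ) - 1))
    (ω ν : ℕ) (hω : Odd ω) (hν : Odd ν)
    (s : Fin k → ℤ) (hs : s ∈ cellIndices k ω ν) :
    (|∑ i, s i| < (k : ℤ) → ∀ᶠ n : ℕ in atTop, 0 < firstMoment k ω ν s d' n) ∧
    (∀ᶠ n : ℕ in atTop,
      Summable fun l : ℕ => cycleLambda (avgDegree d' n) (l + 2) * cycleDelta k (l + 2) ^ 2) ∧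
    (fun n : ℕ => secondMoment k ω ν s d' n / firstMoment k ω ν s d' n ^ 2)
      ~[atTop ⊓ 𝓟 {n : ℕ | firstMoment k ω ν s d' n ≠ 0}]
    (fun n : ℕ => Real.exp
      (∑' l : ℕ, cycleLambda (avgDegree d' n) (l + 2) * cycleDelta k (l + 2) ^ 2)) := by
  obtain ⟨r, rfl⟩ : ∃ r, k = r + 1 := ⟨k - 1, by omega⟩
  have hr : 2 ≤ r := by omega
  have hr0 : (0 : ℝ) < r := by positivity
  have hcast : ((r + 1 : ℕ) : ℝ) - 1 = r := by push_cast; ring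
  rw [hcast] at hd'
  have hq : d' / (r : ℝ) ^ 2 < 1 := by
    rw [div_lt_one (by positivity)]
    have := two_mul_log_le hr0
    nlinarith
  have hqlim : Tendsto (fun n => avgDegree d' n / (r : ℝ) ^ 2) atTop (𝓝 (d' / (r : ℝ) ^ 2)) :=
    (tendsto_avgDegree hd'_pos).div_const _
  have habs : ∀ᶠ n in atTop, |avgDegree d' n / (r : ℝ) ^ 2| < 1 := by
    apply hqlim.abs.eventually_lt_const
    rwa [abs_of_pos (by positivity)]
  refine ⟨fun hsum => ?_, ?_, ?_⟩
  · filter_upwards [eventually_cellMaps_nonempty hν.pos hs hsum,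
      eventually_colouringProb_pos (r := r) ω (by omega)] with n hne hpos
    rw [firstMoment_eq]
    exact Finset.sum_pos (fun σ hσ => hpos _ _ (isBalanced_of_mem_cellMaps hσ)) hne
  · filter_upwards [habs] with n hn
    exact (hasSum_cycle (by omega) hn).summable
  · have hL := momentLimit_pos hq
    have h1 := tendsto_secondMoment_div (ω := ω) (ν := ν) (s := s) hr hd'_pos hd'
    have h2 : Tendsto (fun n : ℕ => Real.exp (∑' l : ℕ, cycleLambda (avgDegree d' n) (l + 2) *
        cycleDelta (r + 1) (l + 2) ^ 2)) atTop (𝓝 (momentLimit r d')) := by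
      rw [← exp_cycle_eq_momentLimit (by omega) hq]
      have h3 : Tendsto (fun n => Real.exp ((r : ℝ) ^ 2 / 2 *
          (-Real.log (1 - avgDegree d' n / (r : ℝ) ^ 2) - avgDegree d' n / (r : ℝ) ^ 2))) atTop
          (𝓝 (Real.exp ((r : ℝ) ^ 2 / 2 *
            (-Real.log (1 - d' / (r : ℝ) ^ 2) - d' / (r : ℝ) ^ 2)))) := by
        refine (Real.continuous_exp.tendsto _).comp (Tendsto.const_mul _ ?_)
        exact (((hqlim.const_sub 1).log (by linarith)).neg).sub hqlim
      refine h3.congr' ?_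
      filter_upwards [habs] with n hn
      rw [(hasSum_cycle (by omega) hn).tsum_eq]
    -- Both sides tend to the same positive constant; the series does so because the degree `d(n)`
    -- tends to `d'`.
    exact ((isEquivalent_const_iff_tendsto hL.ne').2 h1).trans
      ((isEquivalent_const_iff_tendsto hL.ne').2 (h2.mono_left inf_le_left)).symm
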